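/- **Setting.** Let $d\ge 1$ and let $\Omega\subset\mathbb R^d$ be a bounded, connected, polytopal open set (its boundary lies in a finite union of hyperplanes) with Lipschitz boundary. Let $\Lambda$ be a measurable matrix-valued function on $\Omega$ such that, for some $\underline\lambda,\overline\lambda>0$ and a.e. $x$, $\Lambda(x)$ is symmetric with eigenvalues in $[\underline\lambda,\overline\lambda]$. Let $\Gamma_1,\Gamma_2,\Gamma_3$ be a partition of $\partial\Omega$ into measurable sets, $\Gamma_1$ having positive $(d-1)$-dimensional measure, let $f\in L^2(\Omega)$ and let the barrier $a\in\mathbb R$ be constant. Let $\gamma:H^1(\Omega)\to H^{1/2}(\partial\Omega)$ be the trace, $\mathcal K=\{v\in H^1(\Omega):\gamma(v)=0\text{ on }\Gamma_1,\ \gamma(v)\le a\text{ on }\Gamma_3\}$, and let $\bar u\in\mathcal K$ be the solution of $$\int_\Omega\Lambda\nabla\bar u\cdot\nabla(\bar u-v)\,dx\le\int_\Omega f(\bar u-v)\,dx\qquad\forall v\in\mathcal K .$$ The normal trace $\gamma_{\mathbf n}(\psi)\in (H^{1/2}(\partial\Omega))'$ of $\psi\in H_{\rm div}(\Omega)$ is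 defined by $\langle\gamma_{\mathbf n}(\psi),\gamma(w)\rangle=\int_\Omega\psi\cdot\nabla w\,dx+\int_\Omega \mathrm{div}(\psi)\,w\,dx$ for $w\in H^1(\Omega)$. **Gradient discretisation.** $\mathcal D=(X,\Pi_{\mathcal D},\mathbb T_{\mathcal D},\nabla_{\mathcal D})$, where $X$ is a finite-dimensional real vector space, and $\Pi_{\mathcal D}:X\to L^2(\Omega)$, $\mathbb T_{\mathcal D}:X\to\{t\in H^{1/2}(\partial\Omega):t=0\text{ on }\Gamma_1\}$ and $\nabla_{\mathcal D}:X\to L^2(\Omega)^d$ are linear, $\|\nabla_{\mathcal D}\cdot\|_{L^2(\Omega)^d}$ being a norm on $X$. Put $\mathcal K_{\mathcal D}=\{v\in X:\mathbb T_{\mathcal D}v\le a\text{ on }\Gamma_3\}$ and $$C_{\mathcal D}=\max_{v\in X\setminus\{0\}}\frac{\|\Pi_{\mathcal D}v\|_{L^2(\Omega)}+\|\mathbb T_{\mathcal D}v\|_{H^{1/2}(\partial\Omega)}}{\|\nabla_{\mathcal D}v\|_{L^2(\Omega)^d}},\qquad S_{\mathcal D}(\varphi,v)=\|\Pi_{\mathcal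 D}v-\varphi\|_{L^2(\Omega)}+\|\nabla_{\mathcal D}v-\nabla\varphi\|_{L^2(\Omega)^d},$$ $$W_{\mathcal D}(\psi)=\sup_{v\in X\setminus\{0\}}\frac{1}{\|\nabla_{\mathcal D}v\|_{L^2(\Omega)^d}}\Big|\int_\Omega(\nabla_{\mathcal D}v\cdot\psi+\Pi_{\mathcal D}v\,\mathrm{div}\,\psi)\,dx-\langle\gamma_{\mathbf n}(\psi),\mathbb T_{\mathcal D}v\rangle\Big| .$$ Let $u\in\mathcal K_{\mathcal D}$ be the solution of the gradient scheme $$\int_\Omega\Lambda\nabla_{\mathcal D}u\cdot\nabla_{\mathcal D}(u-v)\,dx\le\int_\Omega f\,\Pi_{\mathcal D}(u-v)\,dx\qquad\forall v\in\mathcal K_{\mathcal D}.$$ **Mesh.** Let $\mathcal T=(\mathcal M,\mathcal E,(x_K)_{K\in\mathcal M})$ be a polytopal mesh of $\Omega$, that is: - $\mathcal M$ is a finite family of disjoint non-empty connected polytopal open subsets of $\Omega$ (the cells) with $\overline\Omega=\bigcup_{K\in\mathcal M}\overline K$; - $\mathcal E$ is a finite family of disjoint subsets of $\overline\Omega$ (the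 faces), each a non-empty open subset of a hyperplane; for each $K\in\mathcal M$ a subset $\mathcal E_K\subset\mathcal E$ is given with $\partial K=\bigcup_{\sigma\in\mathcal E_K}\overline\sigma$; and for each $\sigma\in\mathcal E$ either $\sigma\subset\partial\Omega$ and $\sigma\in\mathcal E_K$ for exactly one $K$ (a boundary face, $\sigma\in\mathcal E_{\rm ext}$), or $\sigma\subset\Omega$ and $\sigma\in\mathcal E_K$ for exactly two $K$; - each boundary face $\sigma$ is connected, and $\overline\sigma\setminus\sigma$ has zero $(d-1)$-dimensional measure; - $x_K\in K$, and $[x_K,x)\subset K$ for all $x\in\overline K$. Write $h_{\mathcal M}$ for the maximal diameter of the cells, and $h_\sigma$, $|\sigma|$ for the diameter and the $(d-1)$-dimensional measure of $\sigma$. **Theorem.** Assume that $\gamma_{\mathbf n}(\Lambda\nabla\bar u)\in L^2(\partial\Omega)$ and that $\gamma(\bar u)|_F\in W^{2,\infty}(F)$ for each face $F$ of $\partial\Omega$ (a connected component of the relative interior of $\partial\Omega\cap H$ in a hyperplane $H$), so that $\gamma(\bar u)$ has a continuous representative on $F$. Assume that, for some points $x_\sigma\in\sigma$ ($\sigma\in\mathcal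 E_{\rm ext}$), there is $v_{\mathcal D}\in\mathcal K_{\mathcal D}$ such that $S_{\mathcal D}(\bar u,v_{\mathcal D})\le C_1h_{\mathcal M}$ and $$\|\mathbb T_{\mathcal D}v_{\mathcal D}-\gamma(\bar u)(x_\sigma)\|_{L^2(\sigma)}\le C_2\,h_\sigma^2\,|\sigma|^{1/2}\qquad\forall\sigma\in\mathcal E_{\rm ext}.$$ Then there is $C$, depending only on $\Omega$, $\Lambda$, $\bar u$, $a$, $C_1$, $C_2$ and an upper bound of $C_{\mathcal D}$, such that $$\|\nabla_{\mathcal D}u-\nabla\bar u\|_{L^2(\Omega)^d}+\|\Pi_{\mathcal D}u-\bar u\|_{L^2(\Omega)}\le C\,h_{\mathcal M}+C\,W_{\mathcal D}(\Lambda\nabla\bar u).$$ -/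

import Mathlib

open MeasureTheory Set Filter Topology
open scoped ENNReal NNReal ContDiff RealInnerProductSpace

namespace Signorini

noncomputable section

/-- The Euclidean space `ℝ^m`. -/
abbrev Euc (m : ℕ) : Type := EuclideanSpace ℝ (Fin m)

/-! ### Polytopal domains with Lipschitz boundary -/

/-- The affine hyperplane `{x : ⟪ν, x⟫ = c}` (used with `ν ≠ 0`). -/
def hyperplane {m : ℕ} (ν : Euc m) (c : ℝ) : Set (Euc m) := {x | ⟪ν, x⟫ = c}

/-- A bounded open set is polytopal if its boundary lies in a finite union of hyperplanes. -/
def IsPolytopal {m : ℕ} (U : Set (Euc m)) : Prop :=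
  IsOpen U ∧ Bornology.IsBounded U ∧
    ∃ S : Set (Euc m × ℝ), S.Finite ∧ (∀ p ∈ S, p.1 ≠ 0) ∧
      frontier U ⊆ ⋃ p ∈ S, hyperplane p.1 p.2

/-- Lipschitz boundary: near each boundary point, in the direction of some unit vector `e`, the set
`Ω` is the strict subgraph of a Lipschitz function of the component orthogonal to `e`. -/
def HasLipschitzBoundary {m : ℕ} (Ω : Set (Euc m)) : Prop :=
  ∀ x ∈ frontier Ω, ∃ r > 0, ∃ e : Euc m, ‖e‖ = 1 ∧ ∃ (L : ℝ≥0) (η : Euc m → ℝ),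
    LipschitzWith L η ∧ ∀ y ∈ Metric.ball x r, y ∈ Ω ↔ ⟪e, y⟫ < η (y - ⟪e, y⟫ • e)

/-! ### Function spaces on `Ω` and on `∂Ω` -/

/-- `L²(Ω)`. -/
abbrev L2 {m : ℕ} (Ω : Set (Euc m)) : Type := Lp ℝ 2 (volume.restrict Ω)

/-- `L²(Ω)^m`. -/
abbrev L2V {m : ℕ} (Ω : Set (Euc m)) : Type := Lp (Euc m) 2 (volume.restrict Ω)

/-- The surface measure on `∂Ω`, for `Ω ⊆ ℝ^(n+1)`: the `n`-dimensional Hausdorff measure,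
normalised so as to agree with Lebesgue measure on hyperplanes. -/
def surf {n : ℕ} (Ω : Set (Euc (n + 1))) : Measure (Euc (n + 1)) :=
  (μHE[n] : Measure (Euc (n + 1))).restrict (frontier Ω)

/-- `L²(∂Ω)`. -/
abbrev L2Bd {n : ℕ} (Ω : Set (Euc (n + 1))) : Type := Lp ℝ 2 (surf Ω)

/-- `φ ∈ C_c^∞(U)`. -/
def IsTest {m : ℕ} (U : Set (Euc m)) (φ : Euc m → ℝ) : Prop :=
  ContDiff ℝ ∞ φ ∧ HasCompactSupport φ ∧ tsupport φ ⊆ U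

/-- `G` is the weak gradient of `v` on the open set `U` (for locally integrable `v`, `G`). -/
def IsWeakGrad {m : ℕ} (U : Set (Euc m)) (v : Euc m → ℝ) (G : Euc m → Euc m) : Prop :=
  ∀ φ, IsTest U φ → ∀ e : Euc m,
    ∫ x in U, v x * fderiv ℝ φ x e = - ∫ x in U, ⟪G x, e⟫ * φ x

/-- `δ` is the weak divergence of `ψ` on the open set `U` (for locally integrable `ψ`, `δ`). -/
def IsWeakDiv {m : ℕ} (U : Set (Euc m)) (ψ : Euc m → Euc m) (δ : Euc m → ℝ) : Prop :=
  ∀ φ, IsTest U φ → ∫ x in U, fderiv ℝ φ x (ψ x) = - ∫ x in U, δ x * φ x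

/-- `H¹(Ω)`: a function in `L²(Ω)` together with its weak gradient in `L²(Ω)^m`. -/
structure H1 {m : ℕ} (Ω : Set (Euc m)) where
  fn : L2 Ω
  grad : L2V Ω
  isWeakGrad : IsWeakGrad Ω fn grad

/-- The norm of `H¹(Ω)`. -/
def H1.norm {m : ℕ} {Ω : Set (Euc m)} (w : H1 Ω) : ℝ := √(‖w.fn‖ ^ 2 + ‖w.grad‖ ^ 2)

/-- All triples `(φ|_Ω, ∇φ|_Ω, φ|_∂Ω)` with `φ ∈ C_c^∞(ℝ^(n+1))`. -/
def smoothTriples {n : ℕ} (Ω : Set (Euc (n + 1))) : Set (L2 Ω × L2V Ω × L2Bd Ω) :=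
  {p | ∃ φ : Euc (n + 1) → ℝ, IsTest univ φ ∧ p.1 =ᵐ[volume.restrict Ω] φ ∧
    p.2.1 =ᵐ[volume.restrict Ω] gradient φ ∧ p.2.2 =ᵐ[surf Ω] φ}

/-- `t = γ(w)`: the trace operator `γ : H¹(Ω) → L²(∂Ω)`, given by its graph. It is the continuous
extension of the restriction `φ ↦ φ|_∂Ω` of smooth functions: `φ_k → w` in `H¹(Ω)` and
`φ_k|_∂Ω → t` in `L²(∂Ω)` for some smooth `φ_k`. -/
def IsTrace {n : ℕ} {Ω : Set (Euc (n + 1))} (w : H1 Ω) (t : L2Bd Ω) : Prop :=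
  (w.fn, w.grad, t) ∈ closure (smoothTriples Ω)

/-- `t ∈ H^{1/2}(∂Ω) = γ(H¹(Ω))`. -/
def MemHhalf {n : ℕ} {Ω : Set (Euc (n + 1))} (t : L2Bd Ω) : Prop := ∃ w : H1 Ω, IsTrace w t

/-- The (quotient) norm of `H^{1/2}(∂Ω)`, the infimum of `‖w‖_{H¹(Ω)}` over `γ(w) = t`. -/
def hhalfNorm {n : ℕ} {Ω : Set (Euc (n + 1))} (t : L2Bd Ω) : ℝ :=
  sInf {r | ∃ w : H1 Ω, IsTrace w t ∧ r = w.norm}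

/-! ### `H_div(Ω)` and the normal trace -/

/-- `ψ ∈ H_div(Ω)`. -/
def MemHdiv {m : ℕ} (Ω : Set (Euc m)) (ψ : Euc m → Euc m) : Prop :=
  MemLp ψ 2 (volume.restrict Ω) ∧ ∃ δ : L2 Ω, IsWeakDiv Ω ψ δ

open Classical in
/-- `div ψ ∈ L²(Ω)` for `ψ ∈ H_div(Ω)`. -/
def weakDiv {m : ℕ} (Ω : Set (Euc m)) (ψ : Euc m → Euc m) : L2 Ω :=
  if h : ∃ δ : L2 Ω, IsWeakDiv Ω ψ δ then h.choose else 0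

open Classical in
/-- `⟨γ_n(ψ), t⟩` for `ψ ∈ H_div(Ω)` and `t ∈ H^{1/2}(∂Ω)`: this is
`∫_Ω ψ · ∇w + ∫_Ω div(ψ) w` for any `w ∈ H¹(Ω)` with `γ(w) = t`. -/
def normalTracePairing {n : ℕ} (Ω : Set (Euc (n + 1))) (ψ : Euc (n + 1) → Euc (n + 1))
    (t : L2Bd Ω) : ℝ :=
  if h : ∃ w : H1 Ω, IsTrace w t then
    (∫ x in Ω, ⟪ψ x, h.choose.grad x⟫) + ∫ x in Ω, weakDiv Ω ψ x * h.choose.fn x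
  else 0

/-- `ψ ∈ H_div(Ω)` and `γ_n(ψ) ∈ L²(∂Ω)`. -/
def NormalTraceMemL2 {n : ℕ} (Ω : Set (Euc (n + 1))) (ψ : Euc (n + 1) → Euc (n + 1)) : Prop :=
  MemHdiv Ω ψ ∧ ∃ g : L2Bd Ω, ∀ t : L2Bd Ω, MemHhalf t →
    normalTracePairing Ω ψ t = ∫ x, g x * t x ∂(surf Ω)

/-! ### Faces of `∂Ω` and `W^{2,∞}` on the faces -/

/-- The interior of `∂Ω ∩ {⟪ν, x⟫ = c}` relative to the hyperplane `{⟪ν, x⟫ = c}`. -/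
def flatPart {m : ℕ} (Ω : Set (Euc m)) (ν : Euc m) (c : ℝ) : Set (Euc m) :=
  {x | x ∈ hyperplane ν c ∧ ∃ r > 0, Metric.ball x r ∩ hyperplane ν c ⊆ frontier Ω}

/-- `F` is a (relatively open) face of `∂Ω`: a connected component of the relative interior of
`∂Ω ∩ H` in a hyperplane `H`. -/
def IsBoundaryFace {m : ℕ} (Ω F : Set (Euc m)) : Prop :=
  ∃ (ν : Euc m) (c : ℝ), ν ≠ 0 ∧ ∃ x ∈ flatPart Ω ν c, F = connectedComponentIn (flatPart Ω ν c) x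

/-- `v ∈ W^{2,∞}(U)`, for an open `U ⊆ ℝ^m`. -/
def MemW2Infty {m : ℕ} (U : Set (Euc m)) (v : Euc m → ℝ) : Prop :=
  MemLp v ∞ (volume.restrict U) ∧
    ∃ G : Euc m → Euc m, MemLp G ∞ (volume.restrict U) ∧ IsWeakGrad U v G ∧
      ∀ i : Fin m, ∃ H : Euc m → Euc m, MemLp H ∞ (volume.restrict U) ∧
        IsWeakGrad U (fun y => G y i) H

/-- `t ∈ W^{2,∞}(∂Ω)`, i.e. `t|_F ∈ W^{2,∞}(F)` for each face `F` of `∂Ω` (in Cartesian coordinates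
`ι` of the hyperplane of `F`), and `v` is the representative of `t` that is continuous on each face,
so that the point values `v x` make sense. -/
structure IsW2InftyRep {n : ℕ} {Ω : Set (Euc (n + 1))} (t : L2Bd Ω) (v : Euc (n + 1) → ℝ) :
    Prop where
  ae_eq : t =ᵐ[surf Ω] v
  continuousOn : ∀ F, IsBoundaryFace Ω F → ContinuousOn v F
  memW2Infty : ∀ F, IsBoundaryFace Ω F → ∃ ι : Euc n →ᵃⁱ[ℝ] Euc (n + 1),
    F ⊆ range ι ∧ MemW2Infty (ι ⁻¹' F) (v ∘ ι)

/-! ### The Signorini problem -/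

/-- `Λ` is measurable on `Ω`, and `Λ(x)` is symmetric with eigenvalues in `[lo, hi]` for a.e.
`x ∈ Ω`, for some constants `lo, hi > 0`. -/
def IsDiffusionTensor {m : ℕ} (Ω : Set (Euc m)) (Λ : Euc m → Matrix (Fin m) (Fin m) ℝ) : Prop :=
  (∀ i j, AEMeasurable (fun x => Λ x i j) (volume.restrict Ω)) ∧
    ∃ lo hi : ℝ, 0 < lo ∧ 0 < hi ∧
      ∀ᵐ x ∂(volume.restrict Ω), (Λ x).IsSymm ∧ spectrum ℝ (Λ x) ⊆ Icc lo hi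

/-- `(Γ₁, Γ₂, Γ₃)` is a measurable partition of `∂Ω` and `Γ₁` has positive surface measure. -/
structure IsBoundaryPartition {n : ℕ} (Ω Γ₁ Γ₂ Γ₃ : Set (Euc (n + 1))) : Prop where
  meas₁ : MeasurableSet Γ₁
  meas₂ : MeasurableSet Γ₂
  meas₃ : MeasurableSet Γ₃
  disj₁₂ : Disjoint Γ₁ Γ₂
  disj₁₃ : Disjoint Γ₁ Γ₃
  disj₂₃ : Disjoint Γ₂ Γ₃
  union_eq : Γ₁ ∪ Γ₂ ∪ Γ₃ = frontier Ω
  pos : 0 < surf Ω Γ₁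

/-- The field `Λ G`. -/
def flux {m : ℕ} (Λ : Euc m → Matrix (Fin m) (Fin m) ℝ) (G : Euc m → Euc m) : Euc m → Euc m :=
  fun x => Matrix.toEuclideanLin (Λ x) (G x)

/-- `v ∈ 𝒦`, where `t` is the trace of `v`: `t = 0` on `Γ₁` and `t ≤ a` on `Γ₃`. -/
def MemK {n : ℕ} {Ω : Set (Euc (n + 1))} (Γ₁ Γ₃ : Set (Euc (n + 1))) (a : ℝ)
    (v : H1 Ω) (t : L2Bd Ω) : Prop :=
  IsTrace v t ∧ (∀ᵐ x ∂(surf Ω).restrict Γ₁, t x = 0) ∧ ∀ᵐ x ∂(surf Ω).restrict Γ₃, t x ≤ a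

/-- `u`, with trace `t`, is the weak solution of the Signorini problem with constant barrier `a`. -/
def IsSignoriniSolution {n : ℕ} {Ω : Set (Euc (n + 1))}
    (Λ : Euc (n + 1) → Matrix (Fin (n + 1)) (Fin (n + 1)) ℝ) (f : L2 Ω)
    (Γ₁ Γ₃ : Set (Euc (n + 1))) (a : ℝ) (u : H1 Ω) (t : L2Bd Ω) : Prop :=
  MemK Γ₁ Γ₃ a u t ∧ ∀ (v : H1 Ω) (s : L2Bd Ω), MemK Γ₁ Γ₃ a v s →
    ∫ x in Ω, ⟪flux Λ u.grad x, u.grad x - v.grad x⟫ ≤ ∫ x in Ω, f x * (u.fn x - v.fn x)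

/-! ### Gradient discretisations -/

/-- A gradient discretisation `(X, Π, 𝕋, ∇)` for the Signorini problem. -/
structure GradientDiscretisation {n : ℕ} (Ω Γ₁ : Set (Euc (n + 1))) (X : Type*)
    [AddCommGroup X] [Module ℝ X] [FiniteDimensional ℝ X] where
  /-- the reconstructed function -/
  recFn : X →ₗ[ℝ] L2 Ω
  /-- the reconstructed trace, with values in `H^{1/2}(∂Ω)` and vanishing on `Γ₁` -/
  recTrace : X →ₗ[ℝ] L2Bd Ω
  recTrace_mem : ∀ v, MemHhalf (recTrace v)
  recTrace_zero : ∀ v, ∀ᵐ x ∂(surf Ω).restrict Γ₁, recTrace v x = 0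
  /-- the reconstructed gradient; its `L²` norm is a norm on `X` -/
  recGrad : X →ₗ[ℝ] L2V Ω
  recGrad_norm : ∀ v, ‖recGrad v‖ = 0 → v = 0

namespace GradientDiscretisation

variable {n : ℕ} {Ω Γ₁ : Set (Euc (n + 1))} {X : Type*}
  [AddCommGroup X] [Module ℝ X] [FiniteDimensional ℝ X]

/-- `v ∈ 𝒦_D`. -/
def MemK (D : GradientDiscretisation Ω Γ₁ X) (Γ₃ : Set (Euc (n + 1))) (a : ℝ) (v : X) : Prop :=
  ∀ᵐ x ∂(surf Ω).restrict Γ₃, D.recTrace v x ≤ a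

/-- `u` is the solution of the gradient scheme. -/
def IsSolution (D : GradientDiscretisation Ω Γ₁ X)
    (Λ : Euc (n + 1) → Matrix (Fin (n + 1)) (Fin (n + 1)) ℝ) (f : L2 Ω)
    (Γ₃ : Set (Euc (n + 1))) (a : ℝ) (u : X) : Prop :=
  D.MemK Γ₃ a u ∧ ∀ v, D.MemK Γ₃ a v →
    ∫ x in Ω, ⟪flux Λ (D.recGrad u) x, D.recGrad (u - v) x⟫ ≤ ∫ x in Ω, f x * D.recFn (u - v) x

/-- The coercivity constant `C_D` (the supremum of a bounded set since `X` is finite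
dimensional; it is `0` if `X = {0}`). -/
def coercivity (D : GradientDiscretisation Ω Γ₁ X) : ℝ :=
  ⨆ v : {v : X // v ≠ 0},
    (‖D.recFn v‖ / ‖D.recGrad v‖ + hhalfNorm (D.recTrace v) / ‖D.recGrad v‖)

/-- The consistency indicator `S_D(φ, v)`. -/
def consistency (D : GradientDiscretisation Ω Γ₁ X) (φ : H1 Ω) (v : X) : ℝ :=
  ‖D.recFn v - φ.fn‖ + ‖D.recGrad v - φ.grad‖

/-- The limit-conformity indicator `W_D(ψ)`, for `ψ ∈ H_div(Ω)` (the supremum of a bounded set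
since `X` is finite dimensional; it is `0` if `X = {0}`). -/
def limitConformity (D : GradientDiscretisation Ω Γ₁ X) (ψ : Euc (n + 1) → Euc (n + 1)) : ℝ :=
  ⨆ v : {v : X // v ≠ 0}, 1 / ‖D.recGrad v‖ *
    |(∫ x in Ω, (⟪D.recGrad v x, ψ x⟫ + D.recFn v x * weakDiv Ω ψ x)) -
      normalTracePairing Ω ψ (D.recTrace v)|

end GradientDiscretisation

/-! ### Polytopal meshes -/

/-- A polytopal mesh of `Ω`. -/
structure PolytopalMesh {n : ℕ} (Ω : Set (Euc (n + 1))) where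
  /-- the cells -/
  cells : Set (Set (Euc (n + 1)))
  cells_finite : cells.Finite
  cells_polytopal : ∀ K ∈ cells, IsPolytopal K
  cells_connected : ∀ K ∈ cells, IsConnected K
  cells_subset : ∀ K ∈ cells, K ⊆ Ω
  cells_disjoint : cells.PairwiseDisjoint id
  closure_eq : closure Ω = ⋃ K ∈ cells, closure K
  /-- the faces of the mesh -/
  faces : Set (Set (Euc (n + 1)))
  faces_finite : faces.Finite
  faces_disjoint : faces.PairwiseDisjoint id
  faces_nonempty : ∀ σ ∈ faces, σ.Nonempty
  /-- each face is an open subset of a hyperplane -/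
  faces_open : ∀ σ ∈ faces, ∃ (ν : Euc (n + 1)) (c : ℝ) (O : Set (Euc (n + 1))),
    ν ≠ 0 ∧ IsOpen O ∧ σ = O ∩ hyperplane ν c
  faces_subset : ∀ σ ∈ faces, σ ⊆ closure Ω
  /-- the faces of each cell -/
  cellFaces : Set (Euc (n + 1)) → Set (Set (Euc (n + 1)))
  cellFaces_subset : ∀ K ∈ cells, cellFaces K ⊆ faces
  frontier_eq : ∀ K ∈ cells, frontier K = ⋃ σ ∈ cellFaces K, closure σ
  /-- each face is a boundary face of exactly one cell or an interior face of exactly two cells -/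
  faces_cells : ∀ σ ∈ faces,
    ({K ∈ cells | σ ∈ cellFaces K}.ncard = 1 ∧ σ ⊆ frontier Ω) ∨
      ({K ∈ cells | σ ∈ cellFaces K}.ncard = 2 ∧ σ ⊆ Ω)
  /-- boundary faces are connected, and their relative boundary is negligible -/
  boundary_connected : ∀ σ ∈ faces, σ ⊆ frontier Ω → IsConnected σ
  boundary_null : ∀ σ ∈ faces, σ ⊆ frontier Ω → (μHE[n] : Measure (Euc (n + 1))) (closure σ \ σ) = 0
  /-- the centres of the cells -/
  center : Set (Euc (n + 1)) → Euc (n + 1)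
  center_mem : ∀ K ∈ cells, center K ∈ K
  /-- each cell `K` is strictly star-shaped with respect to its centre -/
  star_shaped : ∀ K ∈ cells, ∀ x ∈ closure K, ∀ s ∈ Ico (0 : ℝ) 1,
    AffineMap.lineMap (center K) x s ∈ K

/-- The boundary faces of a mesh. -/
def PolytopalMesh.extFaces {n : ℕ} {Ω : Set (Euc (n + 1))} (T : PolytopalMesh Ω) :
    Set (Set (Euc (n + 1))) := {σ ∈ T.faces | σ ⊆ frontier Ω}

/-- The size of a mesh, the largest diameter of a cell. -/
def PolytopalMesh.size {n : ℕ} {Ω : Set (Euc (n + 1))} (T : PolytopalMesh Ω) : ℝ :=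
  sSup (Metric.diam '' T.cells)

end

end Signorini

/-! Put `ψ = Λ∇ū`. Variations with zero trace give `div ψ = -f`, and `γ_n(ψ)` is represented by some
`g ∈ L²(∂Ω)`. Testing the scheme with `v = v_D` and replacing Green's formula by its discrete
version, at the cost of `W_D(ψ)`, leads to `lo ‖∇_D(u - v)‖² ≤ (W_D(ψ) + hi S_D(ū, v)) ‖∇_D(u - v)‖
+ ∫ g (𝕋_D v - γ(ū))`. The remaining term `∫ g (γ(ū) - 𝕋_D u)` is nonpositive, because the barrier
is not discretised: `𝕋_D u` is the trace of an element of `𝒦` (`energy_estimate`). Since the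
estimate is quadratic in `‖∇_D(u - v)‖`, first order convergence requires the boundary integral to
be of order `h²`, whereas `𝕋_D v` is close to the constant `γ(ū)(x_σ)` on `σ`, which in general is
only within `O(h)` of `γ(ū)`.

The missing order comes from complementarity. Against traces vanishing on `Γ₁`, `g` sees only the
contact set `{γ(ū) = a}` (`integral_normalTrace_eq`), so the integral is that of `g (𝕋_D v - a)`
over this set. A face `σ` meeting it in a null set contributes nothing. If the measure is positive,
the tangential gradient of `γ(ū)` vanishes at some contact point of `σ`, because the gradient of a
function is zero almost everywhere on a level set. A Taylor expansion from that point gives `|γ(ū) -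
a| ≤ L diam(σ)²` on all of `σ`, hence `𝕋_D v - a` is of order `h²` there (`exists_quadratic_bound`,
`eLpNorm_contact_le`).

Two points need care. A `W^{2,∞}` function on a nonconvex face admits Taylor estimates only along
segments inside the face, and `σ` is merely connected. The hyperplanes containing `∂Ω` cut space
into finitely many convex cells, and the faces of `∂Ω` are unions of cells; two points of `σ` are
therefore joined by a chain of segments of the face whose length is bounded in terms of `Ω` alone
(`exists_chain`). Moreover, the boundary faces of the mesh have to cover `∂Ω` up to a null set
(`surf_compl_extFaces`), so that the local estimates can be summed. -/

namespace Signorini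

noncomputable section

/-! ### Mollification and regularity of `W^{2,∞}` functions -/

section Mollification

open scoped Convolution

variable {m : ℕ} {U : Set (Euc m)} {v : Euc m → ℝ} {G : Euc m → Euc m}

/-- The mollification of `v`, extended by zero outside of `U`. -/
def mollify (ρ : ContDiffBump (0 : Euc m)) (U : Set (Euc m)) (v : Euc m → ℝ) : Euc m → ℝ :=
  ρ.normed volume ⋆[ContinuousLinearMap.lsmul ℝ ℝ, volume] U.indicator v

lemma locallyIntegrable_indicator (hU : MeasurableSet U) (hv : MemLp v ∞ (volume.restrict U)) :
    LocallyIntegrable (U.indicator v) volume :=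
  (memLp_indicator_iff_restrict hU |>.2 hv).locallyIntegrable (by simp)

lemma mollify_eq (ρ : ContDiffBump (0 : Euc m)) (hU : MeasurableSet U) (x : Euc m) :
    mollify ρ U v x = ∫ s in U, ρ.normed volume (x - s) * v s := by
  rw [mollify, convolution_eq_swap, ← integral_indicator hU]
  congr 1 with s
  by_cases hs : s ∈ U <;> simp [hs]

lemma abs_mollify_le (ρ : ContDiffBump (0 : Euc m)) (hU : MeasurableSet U) {L : ℝ}
    (hL : ∀ᵐ x ∂volume.restrict U, |v x| ≤ L) (hL0 : 0 ≤ L) (x : Euc m) :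
    |mollify ρ U v x| ≤ L := by
  rw [mollify_eq ρ hU]
  have hi : Integrable (fun s => ρ.normed volume (x - s) * L) volume :=
    ((ρ.integrable_normed (μ := volume)).comp_sub_left x).mul_const L
  rw [← Real.norm_eq_abs]
  calc ‖∫ s in U, ρ.normed volume (x - s) * v s‖
      ≤ ∫ s in U, ρ.normed volume (x - s) * L := by
        refine norm_integral_le_of_norm_le hi.integrableOn ?_
        filter_upwards [hL] with s hs
        rw [norm_mul, Real.norm_eq_abs, Real.norm_eq_abs, abs_of_nonneg (ρ.nonneg_normed _)]
        exact mul_le_mul_of_nonneg_left hs (ρ.nonneg_normed _)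
    _ ≤ ∫ s, ρ.normed volume (x - s) * L :=
        setIntegral_le_integral hi (Eventually.of_forall fun s =>
          mul_nonneg (ρ.nonneg_normed _) hL0)
    _ = L := by
        rw [integral_mul_const, integral_sub_left_eq_self (fun s => ρ.normed volume s),
          ρ.integral_normed, one_mul]

lemma hasFDerivAt_mollify (ρ : ContDiffBump (0 : Euc m)) (hU : MeasurableSet U)
    (hv : MemLp v ∞ (volume.restrict U)) (x : Euc m) :
    HasFDerivAt (mollify ρ U v) (fderiv ℝ (mollify ρ U v) x) x := by
  have h := (ρ.hasCompactSupport_normed (μ := volume)).hasFDerivAt_convolution_left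
    (ContinuousLinearMap.lsmul ℝ ℝ) (ρ.contDiff_normed (n := 1)) (locallyIntegrable_indicator hU hv) x
  exact h.differentiableAt.hasFDerivAt

/-- The derivative falls on the kernel. When the ball lies in `U`, `s ↦ ρ(x - s)` is a test function
of `U`, and the weak gradient identity moves the derivative onto `v`; extending by zero outside `U`
is harmless there. -/
lemma fderiv_mollify (ρ : ContDiffBump (0 : Euc m)) (hU : IsOpen U)
    (hv : MemLp v ∞ (volume.restrict U)) (hG : IsWeakGrad U v G) {x : Euc m}
    (hx : Metric.closedBall x ρ.rOut ⊆ U) (e : Euc m) :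
    fderiv ℝ (mollify ρ U v) x e = mollify ρ U (fun y => ⟪G y, e⟫) x := by
  have hloc := locallyIntegrable_indicator hU.measurableSet hv
  have hcs := ρ.hasCompactSupport_normed (μ := volume)
  have hcd : ContDiff ℝ ∞ (ρ.normed volume) := ρ.contDiff_normed
  have h := hcs.hasFDerivAt_convolution_left
    (ContinuousLinearMap.lsmul ℝ ℝ) (ρ.contDiff_normed (n := 1)) hloc x
  have hex : ConvolutionExistsAt (fderiv ℝ (ρ.normed volume)) (U.indicator v) x
      ((ContinuousLinearMap.lsmul ℝ ℝ).precompL (Euc m)) volume :=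
    (hcs.fderiv ℝ).convolutionExists_left _ (hcd.continuous_fderiv (by simp)) hloc x
  have h' : fderiv ℝ (mollify ρ U v) x e =
      ∫ s in U, fderiv ℝ (ρ.normed volume) (x - s) e * v s := by
    rw [mollify, h.fderiv, convolution_eq_swap, ContinuousLinearMap.integral_apply,
      ← integral_indicator hU.measurableSet]
    · congr 1 with s
      by_cases hs : s ∈ U <;> simp [hs, ContinuousLinearMap.precompL_apply]
    · exact hex.integrable_swap
  have hφ : IsTest U (fun s => ρ.normed volume (x - s)) := by
    have hsup : Function.support (fun s => ρ.normed volume (x - s)) ⊆ Metric.closedBall x ρ.rOut := by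
      intro s hs
      have : x - s ∈ Function.support (ρ.normed volume) := hs
      rw [ρ.support_normed_eq, mem_ball_zero_iff] at this
      rw [Metric.mem_closedBall, dist_comm, dist_eq_norm]
      exact this.le
    refine ⟨hcd.comp (contDiff_const.sub contDiff_id), ?_, ?_⟩
    · exact HasCompactSupport.of_support_subset_isCompact (isCompact_closedBall x ρ.rOut) hsup
    · exact (closure_minimal hsup Metric.isClosed_closedBall).trans hx
  have hw := hG _ hφ e
  have hd : ∀ s, fderiv ℝ (fun s => ρ.normed volume (x - s)) s e =
      - fderiv ℝ (ρ.normed volume) (x - s) e := by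
    intro s
    have h1 : HasFDerivAt (fun s => ρ.normed volume (x - s))
        ((fderiv ℝ (ρ.normed volume) (x - s)).comp (-ContinuousLinearMap.id ℝ (Euc m))) s :=
      HasFDerivAt.comp s ((hcd.differentiable (by simp)) (x - s)).hasFDerivAt
        ((hasFDerivAt_id s).const_sub x)
    rw [h1.fderiv]; simp
  simp only [hd, mul_neg, integral_neg, neg_inj] at hw
  rw [h', mollify_eq ρ hU.measurableSet]
  simpa only [mul_comm] using hw

lemma tendsto_mollify {ι : Type*} {l : Filter ι} {ρ : ι → ContDiffBump (0 : Euc m)}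
    (hρ : Tendsto (fun i => (ρ i).rOut) l (𝓝 0)) (hU : IsOpen U)
    (hv : MemLp v ∞ (volume.restrict U)) (hc : ContinuousOn v U) {x : Euc m} (hx : x ∈ U) :
    Tendsto (fun i => mollify (ρ i) U v x) l (𝓝 (v x)) := by
  refine ContDiffBump.convolution_tendsto_right hρ (g := fun _ => U.indicator v)
    (k := fun _ => x) (Eventually.of_forall fun _ =>
      (locallyIntegrable_indicator hU.measurableSet hv).aestronglyMeasurable) ?_ tendsto_const_nhds
  have h1 : ContinuousAt (U.indicator v) x := by
    refine (hc.continuousAt (hU.mem_nhds hx)).congr ?_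
    filter_upwards [hU.mem_nhds hx] with y hy
    simp [hy]
  have : v x = U.indicator v x := by simp [hx]
  rw [this]
  exact h1.tendsto.comp tendsto_snd

lemma exists_ae_norm_le_of_memLp_top {α E : Type*} [MeasurableSpace α] [NormedAddCommGroup E]
    {μ : Measure α} {f : α → E} (hf : MemLp f ∞ μ) : ∃ B : ℝ, 0 ≤ B ∧ ∀ᵐ x ∂μ, ‖f x‖ ≤ B := by
  refine ⟨(eLpNorm f ∞ μ).toReal, ENNReal.toReal_nonneg, ?_⟩
  filter_upwards [ae_le_eLpNormEssSup (f := f) (μ := μ)] with x hx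
  rw [← eLpNorm_exponent_top] at hx
  have := ENNReal.toReal_mono hf.2.ne hx
  simpa using this

/-- The second derivatives are bounded one component of the gradient at a time; this assembles the
bounds. -/
lemma opNorm_le_sum_single (A : Euc m →L[ℝ] ℝ) :
    ‖A‖ ≤ ∑ i, |A (EuclideanSpace.single i 1)| := by
  refine A.opNorm_le_bound (Finset.sum_nonneg fun _ _ => abs_nonneg _) fun z => ?_
  have hz : z = ∑ i, z i • EuclideanSpace.single i (1 : ℝ) := by
    ext j
    simp [Finset.sum_apply, Pi.single_apply]
  conv_lhs => rw [hz]
  rw [map_sum, Finset.sum_mul]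
  refine (norm_sum_le _ _).trans (Finset.sum_le_sum fun i _ => ?_)
  rw [map_smul, norm_smul, mul_comm]
  exact mul_le_mul_of_nonneg_left (PiLp.norm_apply_le z i) (abs_nonneg _)

set_option maxHeartbeats 800000 in
/-- A continuous `W^{2,∞}` function is of class `C^{1,1}` along the segments of its domain. -/
theorem exists_taylor_of_memW2Infty {w : Euc m → ℝ} (hU : IsOpen U) (hc : ContinuousOn w U)
    (hw : MemW2Infty U w) :
    ∃ L : ℝ, 0 ≤ L ∧ ∃ p : Euc m → (Euc m →L[ℝ] ℝ), ∀ x y, segment ℝ x y ⊆ U →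
      ‖p y - p x‖ ≤ L * ‖y - x‖ ∧ |w y - w x - p x (y - x)| ≤ L * ‖y - x‖ ^ 2 := by
  obtain ⟨hwi, G, hGi, hG, hH⟩ := hw
  choose H hHi hH using hH
  obtain ⟨B₀, hB₀, hB₀'⟩ := exists_ae_norm_le_of_memLp_top hGi
  choose B hB hB' using fun i => exists_ae_norm_le_of_memLp_top (hHi i)
  have hGc : ∀ i, MemLp (fun y => G y i) ∞ (volume.restrict U) := fun i => by
    refine hGi.of_le ?_ (Eventually.of_forall fun y => PiLp.norm_apply_le (G y) i)
    exact (EuclideanSpace.proj (𝕜 := ℝ) i).continuous.comp_aestronglyMeasurable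
      hGi.aestronglyMeasurable
  let ρ : ℕ → ContDiffBump (0 : Euc m) := fun k =>
    ⟨1 / ((k : ℝ) + 1) / 2, 1 / ((k : ℝ) + 1), by positivity, half_lt_self (by positivity)⟩
  have hρ : Tendsto (fun k => (ρ k).rOut) atTop (𝓝 0) := tendsto_one_div_add_atTop_nhds_zero_nat
  let D : ℕ → Euc m → (Euc m →L[ℝ] ℝ) := fun k x => fderiv ℝ (mollify (ρ k) U w) x
  have hcoord : ∀ k x, Metric.closedBall x (ρ k).rOut ⊆ U → ∀ i,
      D k x (EuclideanSpace.single i 1) = mollify (ρ k) U (fun y => G y i) x := by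
    intro k x hx i
    rw [show D k x = fderiv ℝ (mollify (ρ k) U w) x from rfl, fderiv_mollify (ρ k) hU hwi hG hx]
    simp [EuclideanSpace.inner_single_right]
  have hbound : ∀ k x, Metric.closedBall x (ρ k).rOut ⊆ U → ‖D k x‖ ≤ B₀ := by
    intro k x hx
    refine ContinuousLinearMap.opNorm_le_bound _ hB₀ fun e => ?_
    rw [show D k x = fderiv ℝ (mollify (ρ k) U w) x from rfl, fderiv_mollify (ρ k) hU hwi hG hx]
    refine abs_mollify_le (ρ k) hU.measurableSet ?_ (by positivity) x
    filter_upwards [hB₀'] with y hy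
    exact (abs_real_inner_le_norm _ _).trans (by gcongr)
  let L := ∑ i, B i
  have hL : 0 ≤ L := Finset.sum_nonneg fun i _ => hB i
  have hlip : ∀ k x y, (∀ z ∈ segment ℝ x y, Metric.closedBall z (ρ k).rOut ⊆ U) →
      ‖D k y - D k x‖ ≤ L * ‖y - x‖ := by
    intro k x y hxy
    refine (opNorm_le_sum_single _).trans ?_
    rw [Finset.sum_mul]
    refine Finset.sum_le_sum fun i _ => ?_
    rw [sub_apply, hcoord k y (hxy y (right_mem_segment _ _ _)),
      hcoord k x (hxy x (left_mem_segment _ _ _))]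
    refine (convex_segment x y).norm_image_sub_le_of_norm_hasFDerivWithin_le
      (fun z _ => (hasFDerivAt_mollify (ρ k) hU.measurableSet (hGc i) z).hasFDerivWithinAt) ?_
      (left_mem_segment _ _ _) (right_mem_segment _ _ _)
    intro z hz
    refine ContinuousLinearMap.opNorm_le_bound _ (hB i) fun e => ?_
    rw [fderiv_mollify (ρ k) hU (hGc i) (hH i) (hxy z hz)]
    refine abs_mollify_le (ρ k) hU.measurableSet ?_ (mul_nonneg (hB i) (norm_nonneg _)) z
    filter_upwards [hB' i] with y hy
    exact (abs_real_inner_le_norm _ _).trans (by gcongr)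
  have htaylor : ∀ k x y, (∀ z ∈ segment ℝ x y, Metric.closedBall z (ρ k).rOut ⊆ U) →
      |mollify (ρ k) U w y - mollify (ρ k) U w x - D k x (y - x)| ≤ L * ‖y - x‖ ^ 2 := by
    intro k x y hxy
    rw [sq, ← mul_assoc]
    refine (convex_segment x y).norm_image_sub_le_of_norm_hasFDerivWithin_le'
      (fun z _ => (hasFDerivAt_mollify (ρ k) hU.measurableSet hwi z).hasFDerivWithinAt) ?_
      (left_mem_segment _ _ _) (right_mem_segment _ _ _)
    intro z hz
    refine (hlip k x z fun z' hz' => hxy z' ?_).trans ?_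
    · exact (convex_segment x y).segment_subset (left_mem_segment _ _ _) hz hz'
    · gcongr
      exact norm_sub_le_of_mem_segment hz
  -- The gradients of the mollifications are bounded by `B₀`, so along a fixed ultrafilter they
  -- converge at every point of `U` at once. The limit `p` inherits the uniform Lipschitz and Taylor
  -- bounds, with no need to identify it with `G`.
  let 𝒰 : Ultrafilter ℕ := hyperfilter ℕ
  have h𝒰 : (𝒰 : Filter ℕ) ≤ atTop := Nat.hyperfilter_le_atTop
  -- A segment in `U` is compact, hence at positive distance from the complement: small
  -- mollification balls centred on it stay in `U`.
  have hev : ∀ x y, segment ℝ x y ⊆ U →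
      ∀ᶠ k in (𝒰 : Filter ℕ), ∀ z ∈ segment ℝ x y, Metric.closedBall z (ρ k).rOut ⊆ U := by
    intro x y hxy
    have hcomp : IsCompact (segment ℝ x y) := by
      rw [segment_eq_image_lineMap]
      exact isCompact_Icc.image AffineMap.lineMap_continuous
    obtain ⟨δ, hδ, hδU⟩ := hcomp.exists_cthickening_subset_open hU hxy
    filter_upwards [h𝒰 (hρ.eventually (Iic_mem_nhds hδ))] with k hk z hz
    exact (Metric.closedBall_subset_closedBall hk).trans
      ((Metric.closedBall_subset_cthickening hz δ).trans hδU)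
  have hlim : ∀ x, ∃ p : Euc m →L[ℝ] ℝ, x ∈ U → Tendsto (fun k => D k x) 𝒰 (𝓝 p) := by
    intro x
    by_cases hx : x ∈ U
    · have hmem : ∀ᶠ k in (𝒰 : Filter ℕ), D k x ∈ Metric.closedBall 0 B₀ := by
        filter_upwards [hev x x (by simpa using hx)] with k hk
        exact mem_closedBall_zero_iff.2 (hbound k x (hk x (left_mem_segment _ _ _)))
      obtain ⟨p, -, hp⟩ := (isCompact_closedBall (0 : Euc m →L[ℝ] ℝ) B₀).ultrafilter_le_nhds'
        (𝒰.map fun k => D k x) hmem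
      exact ⟨p, fun _ => hp⟩
    · exact ⟨0, fun h => absurd h hx⟩
  choose p hp using hlim
  refine ⟨L, hL, p, fun x y hxy => ?_⟩
  have hx := hp x (hxy (left_mem_segment _ _ _))
  have hy := hp y (hxy (right_mem_segment _ _ _))
  constructor
  · refine le_of_tendsto (hy.sub hx).norm ?_
    filter_upwards [hev x y hxy] with k hk using hlip k x y hk
  · have hwx := tendsto_mollify (hρ.mono_left h𝒰) hU hwi hc (hxy (left_mem_segment _ _ _))
    have hwy := tendsto_mollify (hρ.mono_left h𝒰) hU hwi hc (hxy (right_mem_segment _ _ _))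
    have happ : Tendsto (fun k => D k x (y - x)) 𝒰 (𝓝 (p x (y - x))) :=
      ((ContinuousLinearMap.apply ℝ ℝ (y - x)).continuous.tendsto _).comp hx
    refine le_of_tendsto ((hwy.sub hwx).sub happ).abs ?_
    filter_upwards [hev x y hxy] with k hk using htaylor k x y hk

/-- The derivative vanishes almost everywhere on the level sets. -/
theorem exists_deriv_eq_zero_of_level_set {w : Euc m → ℝ} (hU : IsOpen U) {L : ℝ}
    {p : Euc m → (Euc m →L[ℝ] ℝ)}
    (hp : ∀ x y, segment ℝ x y ⊆ U → |w y - w x - p x (y - x)| ≤ L * ‖y - x‖ ^ 2)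
    {Z : Set (Euc m)} (hZ : MeasurableSet Z) (hZU : Z ⊆ U) {a : ℝ} (ha : ∀ x ∈ Z, w x = a)
    (hpos : volume Z ≠ 0) : ∃ x ∈ Z, p x = 0 := by
  have hderiv : ∀ x ∈ U, HasFDerivAt w (p x) x := by
    intro x hx
    obtain ⟨r, hr, hrU⟩ := Metric.isOpen_iff.1 hU x hx
    rw [hasFDerivAt_iff_isLittleO]
    have h1 : (fun y => w y - w x - p x (y - x)) =O[𝓝 x] fun y => ‖y - x‖ ^ 2 := by
      refine Asymptotics.IsBigO.of_bound L ?_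
      filter_upwards [Metric.ball_mem_nhds x hr] with y hy
      rw [Real.norm_eq_abs, Real.norm_eq_abs, abs_of_nonneg (sq_nonneg ‖y - x‖)]
      exact hp x y (((convex_ball x r).segment_subset (Metric.mem_ball_self hr) hy).trans hrU)
    refine h1.trans_isLittleO ?_
    have h2 : Tendsto (fun y : Euc m => y - x) (𝓝 x) (𝓝 0) := by
      have : Tendsto (fun y : Euc m => y - x) (𝓝 x) (𝓝 (x - x)) :=
        (continuous_id.sub continuous_const).tendsto x
      rwa [sub_self] at this
    exact (Asymptotics.isLittleO_norm_pow_id one_lt_two).comp_tendsto h2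
  have hne : (ae (volume.restrict Z)).NeBot := by
    rw [ae_neBot]; simpa [Measure.restrict_eq_zero] using hpos
  by_cases hsub : Subsingleton (Euc m)
  · obtain ⟨x, hx⟩ := nonempty_of_measure_ne_zero hpos
    exact ⟨x, hx, ContinuousLinearMap.ext fun y => by simp [Subsingleton.elim y 0]⟩
  · rw [not_subsingleton_iff_nontrivial] at hsub
    obtain ⟨e, he⟩ := exists_ne (0 : Euc m)
    -- Multiplying by `e` makes `w` a self-map of the space. It is constant on `Z`, hence
    -- approximated there by the zero map with constant `0`; a density argument then makes its
    -- derivative zero almost everywhere on `Z`.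
    have happ : ApproximatesLinearOn (fun x => w x • e) (0 : Euc m →L[ℝ] Euc m) Z 0 := by
      intro x hx y hy
      simp [ha x hx, ha y hy]
    have hae := happ.norm_fderiv_sub_le volume hZ (fun x => (p x).smulRight e)
      (fun x hx => ((hderiv x (hZU hx)).smul_const e).hasFDerivWithinAt)
    obtain ⟨x, hx, hxZ⟩ := (hae.and (ae_restrict_mem hZ)).exists
    refine ⟨x, hxZ, ContinuousLinearMap.ext fun y => ?_⟩
    have h0 : p x = 0 ∨ e = 0 := by simpa using hx
    rw [h0.resolve_right he]

end Mollification


/-! ### Hyperplane arrangements -/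

section Arrangement

variable {m : ℕ} {S : Set (Euc m × ℝ)}

/-- The position of `x` with respect to the hyperplanes of the family `S`. -/
def signVec (S : Set (Euc m × ℝ)) (x : Euc m) : S → SignType :=
  fun p => SignType.sign (⟪p.1.1, x⟫ - p.1.2)

lemma signVec_eq_zero_iff {x : Euc m} (p : S) :
    signVec S x p = 0 ↔ x ∈ hyperplane p.1.1 p.1.2 := by
  simp [signVec, hyperplane, sign_eq_zero_iff, sub_eq_zero]

lemma isClosed_hyperplane (ν : Euc m) (c : ℝ) : IsClosed (hyperplane ν c) :=
  isClosed_eq (by fun_prop) continuous_const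

lemma convex_hyperplane (ν : Euc m) (c : ℝ) : Convex ℝ (hyperplane ν c) := by
  intro x hx y hy s t _ _ hst
  simp only [hyperplane, mem_ofPred_eq] at *
  rw [inner_add_right, real_inner_smul_right, real_inner_smul_right, hx, hy, ← add_mul, hst, one_mul]

/-- The arrangement looks the same from all points of one cell: a hyperplane missing the points is
not crossed by small translations, and for one through them the sign of `⟪ν, w⟫` decides in both
cases. -/
lemma eventually_signVec_add_eq (hS : S.Finite) {x y : Euc m} (h : signVec S x = signVec S y) :
    ∀ᶠ w in 𝓝 (0 : Euc m), signVec S (x + w) = signVec S (y + w) := by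
  have : Finite S := hS.to_subtype
  have key : ∀ p : S, ∀ᶠ w in 𝓝 (0 : Euc m), signVec S (x + w) p = signVec S (y + w) p := by
    intro p
    have hp := congrFun h p
    have hc : ∀ z : Euc m, Tendsto (fun w : Euc m => ⟪p.1.1, z + w⟫ - p.1.2) (𝓝 0)
        (𝓝 (⟪p.1.1, z⟫ - p.1.2)) := by
      intro z
      have : Continuous (fun w : Euc m => ⟪p.1.1, z + w⟫ - p.1.2) := by fun_prop
      simpa using this.tendsto 0
    simp only [signVec] at hp ⊢
    rcases lt_trichotomy (⟪p.1.1, x⟫ - p.1.2) 0 with hx | hx | hx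
    · have hy : ⟪p.1.1, y⟫ - p.1.2 < 0 := by rwa [sign_neg hx, eq_comm, sign_eq_neg_one_iff] at hp
      filter_upwards [(hc x).eventually (gt_mem_nhds hx), (hc y).eventually (gt_mem_nhds hy)]
        with w h1 h2
      rw [sign_neg h1, sign_neg h2]
    · have hy : ⟪p.1.1, y⟫ - p.1.2 = 0 := by rwa [hx, sign_zero, eq_comm, sign_eq_zero_iff] at hp
      filter_upwards with w
      rw [inner_add_right, inner_add_right, add_sub_right_comm, add_sub_right_comm, hx, hy]
    · have hy : 0 < ⟪p.1.1, y⟫ - p.1.2 := by rwa [sign_pos hx, eq_comm, sign_eq_one_iff] at hp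
      filter_upwards [(hc x).eventually (lt_mem_nhds hx), (hc y).eventually (lt_mem_nhds hy)]
        with w h1 h2
      rw [sign_pos h1, sign_pos h2]
  filter_upwards [eventually_all.2 key] with w hw using funext hw

/-- Cells are convex and relatively open in the affine space they span, so a segment from `q` to an
adherent point leaves the cell of `q` at its far end at most. -/
lemma signVec_openSegment {q p z : Euc m}
    (hp : p ∈ closure {y | signVec S y = signVec S q}) (hz : z ∈ openSegment ℝ q p) :
    signVec S z = signVec S q := by
  obtain ⟨s, t, hs, ht, hst, rfl⟩ := hz
  funext r
  have hcont : Continuous (fun y : Euc m => ⟪r.1.1, y⟫ - r.1.2) := by fun_prop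
  have hcl : ∀ C : Set ℝ, IsClosed C →
      (∀ y, signVec S y = signVec S q → ⟪r.1.1, y⟫ - r.1.2 ∈ C) → ⟪r.1.1, p⟫ - r.1.2 ∈ C :=
    fun C hC h => closure_minimal (t := (fun y : Euc m => ⟪r.1.1, y⟫ - r.1.2) ⁻¹' C)
      (fun y hy => h y hy) (hC.preimage hcont) hp
  have hval : ⟪r.1.1, s • q + t • p⟫ - r.1.2 =
      s * (⟪r.1.1, q⟫ - r.1.2) + t * (⟪r.1.1, p⟫ - r.1.2) := by
    rw [inner_add_right, real_inner_smul_right, real_inner_smul_right]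
    linear_combination r.1.2 * hst
  simp only [signVec]
  rw [hval]
  rcases lt_trichotomy (⟪r.1.1, q⟫ - r.1.2) 0 with hq | hq | hq
  · have := hcl (Iic 0) isClosed_Iic fun y hy => by
      have := congrFun hy r
      simp only [signVec] at this
      rw [sign_neg hq, sign_eq_neg_one_iff] at this
      exact this.le
    rw [sign_neg hq, sign_eq_neg_one_iff]
    have := mul_nonpos_of_nonneg_of_nonpos ht.le this
    nlinarith
  · have := hcl {0} isClosed_singleton fun y hy => by
      have := congrFun hy r
      simp only [signVec] at this
      rwa [hq, sign_zero, sign_eq_zero_iff] at this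
    rw [hq, mem_singleton_iff.1 this]; simp
  · have := hcl (Ici 0) isClosed_Ici fun y hy => by
      have := congrFun hy r
      simp only [signVec] at this
      rw [sign_pos hq, sign_eq_one_iff] at this
      exact this.le
    rw [sign_pos hq, sign_eq_one_iff]
    have := mul_nonneg ht.le this
    nlinarith

lemma signVec_segment {q p z : Euc m} (hqp : signVec S p = signVec S q)
    (hz : z ∈ segment ℝ q p) : signVec S z = signVec S q := by
  rw [← insert_endpoints_openSegment] at hz
  rcases hz with rfl | rfl | hz
  · rfl
  · exact hqp
  · exact signVec_openSegment (subset_closure hqp) hz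

/-- The points that lie on no hyperplane of the family `S`. -/
def generic (S : Set (Euc m × ℝ)) : Set (Euc m) := {x | ∀ p ∈ S, x ∉ hyperplane p.1 p.2}

lemma generic_of_signVec_eq {x y : Euc m} (h : signVec S x = signVec S y) (hx : x ∈ generic S) :
    y ∈ generic S := fun p hp hy =>
  hx p hp ((signVec_eq_zero_iff ⟨p, hp⟩).1 (h ▸ (signVec_eq_zero_iff ⟨p, hp⟩).2 hy))

lemma dense_generic (hS : S.Finite) (hne : ∀ p ∈ S, p.1 ≠ 0) : Dense (generic S) := by
  have : generic S = ⋂ p ∈ S, (hyperplane p.1 p.2)ᶜ := by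
    ext x; simp [generic]
  rw [this]
  refine dense_biInter_of_isOpen (fun p _ => (isClosed_hyperplane p.1 p.2).isOpen_compl)
    hS.countable fun p hp => ?_
  rw [← interior_eq_empty_iff_dense_compl, eq_empty_iff_forall_notMem]
  intro x hx
  rw [mem_interior_iff_mem_nhds] at hx
  have hcont : Continuous (fun s : ℝ => x + s • p.1) := by fun_prop
  have h0 : Tendsto (fun s : ℝ => x + s • p.1) (𝓝 0) (𝓝 x) := by simpa using hcont.tendsto 0
  have h1 := mem_nhdsWithin_of_mem_nhds (t := Ioi 0) (h0 hx)
  obtain ⟨s, hs, hs0⟩ := (Filter.nonempty_of_mem (inter_mem h1 self_mem_nhdsWithin))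
  have hxm : x ∈ hyperplane p.1 p.2 := mem_of_mem_nhds hx
  have hx' : ⟪p.1, x⟫ = p.2 := hxm
  have hs' : ⟪p.1, x + s • p.1⟫ = p.2 := hs
  rw [inner_add_right, hx', real_inner_smul_right, real_inner_self_eq_norm_sq] at hs'
  have : s * ‖p.1‖ ^ 2 = 0 := by linarith
  rcases mul_eq_zero.1 this with h | h
  · exact (ne_of_gt hs0) h
  · exact hne p hp (by simpa using h)

/-- Approach `x` by generic points of `A` and translate by `y - x`. The two germs of the arrangement
agree, so the translated points lie in `A`. Density of generic points is what allows invariance to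
be assumed for those only. -/
lemma mem_closure_of_signVec_eq (hS : S.Finite) (hne : ∀ p ∈ S, p.1 ≠ 0) {A : Set (Euc m)}
    (hA : IsOpen A)
    (hinv : ∀ x y, signVec S x = signVec S y → x ∈ generic S → x ∈ A → y ∈ A) {x y : Euc m}
    (h : signVec S x = signVec S y) (hx : x ∈ closure A) : y ∈ closure A := by
  have hx' : x ∈ closure (A ∩ generic S) :=
    closure_minimal ((dense_generic hS hne).open_subset_closure_inter hA) isClosed_closure hx
  rw [mem_closure_iff_frequently] at hx' ⊢
  have hxt : Tendsto (fun z => z - x) (𝓝 x) (𝓝 0) := by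
    have : Continuous (fun z : Euc m => z - x) := by fun_prop
    simpa using this.tendsto x
  have hyt : Tendsto (fun z => y + (z - x)) (𝓝 x) (𝓝 y) := by
    have : Continuous (fun z : Euc m => y + (z - x)) := by fun_prop
    simpa using this.tendsto x
  refine hyt.frequently (p := fun z => z ∈ A) ?_
  refine (hx'.and_eventually (hxt.eventually (eventually_signVec_add_eq hS h))).mono ?_
  rintro z ⟨⟨hzA, hzg⟩, hz⟩
  rw [add_sub_cancel] at hz
  exact hinv _ _ hz hzg hzA

end Arrangement

/-! ### The boundary of a Lipschitz polytopal domain -/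

section Boundary

variable {m : ℕ} {S : Set (Euc m × ℝ)} {Ω : Set (Euc m)}

/-- Moving from `x` in the direction `e` enters the strict epigraph, an open set disjoint from `Ω`,
hence from its closure. This excludes slits, for which the boundary need not be a union of cells. -/
lemma frontier_subset_closure_compl_closure (hΩ : IsOpen Ω) (hLip : HasLipschitzBoundary Ω) :
    frontier Ω ⊆ closure (closure Ω)ᶜ := by
  intro x hx
  obtain ⟨r, hr, e, he, L, η, hη, hsub⟩ := hLip x hx
  have hx0 : x ∉ Ω := fun h => by
    rw [hΩ.frontier_eq] at hx; exact hx.2 h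
  have hcont : Continuous (fun s : ℝ => x + s • e) := by fun_prop
  have h0 : Tendsto (fun s : ℝ => x + s • e) (𝓝[>] 0) (𝓝 x) := by
    have : Tendsto (fun s : ℝ => x + s • e) (𝓝 0) (𝓝 x) := by simpa using hcont.tendsto 0
    exact this.mono_left nhdsWithin_le_nhds
  refine mem_closure_of_tendsto h0 ?_
  filter_upwards [h0.eventually (Metric.ball_mem_nhds x hr), self_mem_nhdsWithin] with s hs hs0
  have hx1 : η (x - ⟪e, x⟫ • e) ≤ ⟪e, x⟫ := by
    rw [hsub x (Metric.mem_ball_self hr)] at hx0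
    exact not_lt.1 hx0
  have hval : η ((x + s • e) - ⟪e, x + s • e⟫ • e) < ⟪e, x + s • e⟫ := by
    have h1 : ⟪e, x + s • e⟫ = ⟪e, x⟫ + s := by
      rw [inner_add_right, real_inner_smul_right, real_inner_self_eq_norm_sq, he]; ring
    rw [h1, add_smul, add_sub_add_right_eq_sub]
    have : (0 : ℝ) < s := hs0
    linarith
  have hηc := hη.continuous
  have hopen : IsOpen {y : Euc m | η (y - ⟪e, y⟫ • e) < ⟪e, y⟫} :=
    isOpen_lt (by fun_prop) (by fun_prop)
  have hdis : Disjoint (Metric.ball x r ∩ {y : Euc m | η (y - ⟪e, y⟫ • e) < ⟪e, y⟫}) Ω := by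
    rw [disjoint_left]
    rintro y ⟨hy1, hy2⟩ hy3
    exact lt_asymm hy2 ((hsub y hy1).1 hy3)
  have hdis' := hdis.closure_right (Metric.isOpen_ball.inter hopen)
  exact fun h => disjoint_left.1 hdis' ⟨hs, hval⟩ h

/-- The boundary is a union of cells. A generic cell is convex and misses the boundary, so it lies
in `Ω` or in the exterior. Hence `closure Ω` and the closure of the exterior are unions of cells,
and for a Lipschitz domain a boundary point belongs to both. -/
lemma mem_frontier_of_signVec_eq (hΩ : IsOpen Ω) (hLip : HasLipschitzBoundary Ω) (hS : S.Finite)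
    (hne : ∀ p ∈ S, p.1 ≠ 0) (hfr : frontier Ω ⊆ ⋃ p ∈ S, hyperplane p.1 p.2) {x y : Euc m}
    (h : signVec S x = signVec S y) (hx : x ∈ frontier Ω) : y ∈ frontier Ω := by
  have hgen : ∀ x y, signVec S x = signVec S y → x ∈ generic S → x ∈ Ω → y ∈ Ω := by
    intro x y hxy hxg hxΩ
    by_contra hy
    have hg : ∀ z ∈ generic S, z ∉ frontier Ω := fun z hz hzf => by
      obtain ⟨p, hp, hzp⟩ := mem_iUnion₂.1 (hfr hzf)
      exact hz p hp hzp
    have hyc : ∀ z ∈ generic S, z ∉ Ω → z ∈ (closure Ω)ᶜ := fun z hz hzΩ hzc =>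
      hg z hz (by rw [hΩ.frontier_eq]; exact ⟨hzc, hzΩ⟩)
    obtain ⟨z, -, hz1, hz2⟩ := (convex_segment x y).isPreconnected Ω (closure Ω)ᶜ hΩ
      isClosed_closure.isOpen_compl
      (fun z hz => by
        by_cases hzΩ : z ∈ Ω
        · exact Or.inl hzΩ
        · exact Or.inr (hyc z (generic_of_signVec_eq (signVec_segment hxy.symm hz).symm hxg) hzΩ))
      ⟨x, left_mem_segment _ _ _, hxΩ⟩
      ⟨y, right_mem_segment _ _ _, hyc y (generic_of_signVec_eq hxy hxg) hy⟩
    exact hz2 (subset_closure hz1)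
  have h1 : ∀ {x y}, signVec S x = signVec S y → x ∈ closure Ω → y ∈ closure Ω :=
    fun h hx => mem_closure_of_signVec_eq hS hne hΩ hgen h hx
  have h2 : ∀ {x y}, signVec S x = signVec S y → x ∈ closure (closure Ω)ᶜ → y ∈ closure (closure Ω)ᶜ :=
    fun h hx => mem_closure_of_signVec_eq hS hne isClosed_closure.isOpen_compl
      (fun _ _ h' _ hx' hy' => hx' (h1 h'.symm hy')) h hx
  have h3 := h2 h (frontier_subset_closure_compl_closure hΩ hLip hx)
  rw [frontier_eq_closure_inter_closure]
  exact ⟨h1 h (frontier_subset_closure hx), closure_mono (compl_subset_compl.2 subset_closure) h3⟩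

end Boundary


/-! ### Chains of segments in a flat part of the boundary -/

section Chain

variable {m : ℕ} {S : Set (Euc m × ℝ)} {Ω : Set (Euc m)}

lemma mem_flatPart_iff {ν : Euc m} {c : ℝ} {x : Euc m} :
    x ∈ flatPart Ω ν c ↔
      x ∈ hyperplane ν c ∧ ∀ᶠ y in 𝓝 x, y ∈ hyperplane ν c → y ∈ frontier Ω := by
  refine and_congr_right fun _ => ?_
  rw [Metric.eventually_nhds_iff_ball]
  exact ⟨fun ⟨r, hr, h⟩ => ⟨r, hr, fun y hy hy' => h ⟨hy, hy'⟩⟩,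
    fun ⟨r, hr, h⟩ => ⟨r, hr, fun y hy => h y hy.1 hy.2⟩⟩

lemma flatPart_subset_frontier {ν : Euc m} {c : ℝ} : flatPart Ω ν c ⊆ frontier Ω := by
  intro x hx
  rw [mem_flatPart_iff] at hx
  exact hx.2.self_of_nhds hx.1

lemma flatPart_congr {ν ν' : Euc m} {c c' : ℝ} (h : hyperplane ν c = hyperplane ν' c') :
    flatPart Ω ν c = flatPart Ω ν' c' := by
  simp only [flatPart, h]

lemma subset_flatPart {ν : Euc m} {c : ℝ} {O : Set (Euc m)} (hO : IsOpen O)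
    (h : O ∩ hyperplane ν c ⊆ frontier Ω) : O ∩ hyperplane ν c ⊆ flatPart Ω ν c := by
  rintro x ⟨hxO, hxH⟩
  rw [mem_flatPart_iff]
  exact ⟨hxH, by filter_upwards [hO.mem_nhds hxO] with y hy hyH using h ⟨hy, hyH⟩⟩

/-- Every point of `flatPart` has a relative ball inside the same component. -/
lemma exists_ball_inter_subset_component {ν : Euc m} {c : ℝ} {x y : Euc m}
    (hy : y ∈ connectedComponentIn (flatPart Ω ν c) x) :
    ∃ r > 0, Metric.ball y r ∩ hyperplane ν c ⊆ connectedComponentIn (flatPart Ω ν c) x := by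
  have hy' := connectedComponentIn_subset _ _ hy
  obtain ⟨hyH, r, hr, h⟩ := hy'
  refine ⟨r, hr, ?_⟩
  rw [connectedComponentIn_eq hy]
  exact ((convex_ball y r).inter (convex_hyperplane ν c)).isPreconnected.subset_connectedComponentIn
    ⟨Metric.mem_ball_self hr, hyH⟩ (subset_flatPart Metric.isOpen_ball h)

/-- `F` contains the segment from `q ∈ F` to `p ∈ F` whenever `p` is adherent to the cell of `q` in
the arrangement of the hyperplanes of `S`. -/
structure IsCellular (S : Set (Euc m × ℝ)) (F : Set (Euc m)) : Prop where
  segment_subset : ∀ q ∈ F, ∀ p ∈ F, p ∈ closure {y | signVec S y = signVec S q} →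
    segment ℝ q p ⊆ F

/-- At two points of one cell the germs of the arrangement agree, hence so do those of the boundary:
the flat part is a union of cells. A segment towards an adherent point runs in the starting cell up
to its endpoint, so it stays in the flat part and, being connected, in the component. -/
lemma isCellular_component (hS : S.Finite)
    (hfr : ∀ x y, signVec S x = signVec S y → x ∈ frontier Ω → y ∈ frontier Ω)
    {p : Euc m × ℝ} (hp : p ∈ S) :
    (∀ x y, signVec S x = signVec S y → x ∈ flatPart Ω p.1 p.2 → y ∈ flatPart Ω p.1 p.2) ∧
    ∀ x, IsCellular S (connectedComponentIn (flatPart Ω p.1 p.2) x) := by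
  have hH : ∀ x y, signVec S x = signVec S y → x ∈ hyperplane p.1 p.2 → y ∈ hyperplane p.1 p.2 :=
    fun x y h hx => (signVec_eq_zero_iff ⟨p, hp⟩).1 (h ▸ (signVec_eq_zero_iff ⟨p, hp⟩).2 hx)
  have hflat : ∀ x y, signVec S x = signVec S y → x ∈ flatPart Ω p.1 p.2 →
      y ∈ flatPart Ω p.1 p.2 := by
    intro x y h hx
    rw [mem_flatPart_iff] at hx ⊢
    refine ⟨hH x y h hx.1, ?_⟩
    have hyt : Tendsto (fun z => z - y) (𝓝 y) (𝓝 0) := by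
      have : Continuous (fun z : Euc m => z - y) := by fun_prop
      simpa using this.tendsto y
    have hxt : Tendsto (fun z => x + (z - y)) (𝓝 y) (𝓝 x) := by
      have : Continuous (fun z : Euc m => x + (z - y)) := by fun_prop
      simpa using this.tendsto y
    filter_upwards [hxt.eventually hx.2, hyt.eventually (eventually_signVec_add_eq hS h)]
      with z hz1 hz2 hzH
    rw [add_sub_cancel] at hz2
    exact hfr _ _ hz2 (hz1 (hH _ _ hz2.symm hzH))
  refine ⟨hflat, fun x => ⟨fun q hq r hr hcl => ?_⟩⟩
  have hsub : segment ℝ q r ⊆ flatPart Ω p.1 p.2 := by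
    intro z hz
    rw [← insert_endpoints_openSegment] at hz
    rcases hz with rfl | rfl | hz
    · exact connectedComponentIn_subset _ _ hq
    · exact connectedComponentIn_subset _ _ hr
    · exact hflat q z (signVec_openSegment hcl hz).symm (connectedComponentIn_subset _ _ hq)
  rw [connectedComponentIn_eq hq]
  exact (convex_segment q r).isPreconnected.subset_connectedComponentIn
    (left_mem_segment _ _ _) hsub

/-- Two cells are adjacent if points of `σ` in these cells are joined by a segment in `F`. -/
def cellGraph (S : Set (Euc m × ℝ)) (F σ : Set (Euc m)) : SimpleGraph (S → SignType) where
  Adj e e' := e ≠ e' ∧ ∃ p ∈ σ, ∃ q ∈ σ, signVec S p = e ∧ signVec S q = e' ∧ segment ℝ p q ⊆ F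
  symm := ⟨fun _ _ ⟨hne, p, hp, q, hq, h1, h2, h⟩ =>
    ⟨hne.symm, q, hq, p, hp, h2, h1, segment_symm ℝ p q ▸ h⟩⟩
  loopless := ⟨fun _ h => h.1 rfl⟩

/-- Otherwise split `σ` into its reachable and unreachable cells. By connectedness some `p ∈ σ` is
adherent to both parts. Since there are finitely many cells, `p` is adherent to one cell of each
kind, and the cell of `p` is joined to both, which is absurd. -/
lemma cellGraph_reachable (hS : S.Finite) {F σ : Set (Euc m)} (hF : IsCellular S F)
    (hσF : σ ⊆ F) (hσ : IsPreconnected σ) {x y : Euc m} (hx : x ∈ σ) (hy : y ∈ σ) :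
    (cellGraph S F σ).Reachable (signVec S x) (signVec S y) := by
  have : Finite S := hS.to_subtype
  let R : (S → SignType) → Prop := fun e => (cellGraph S F σ).Reachable (signVec S x) e
  have hclos : ∀ Q : (S → SignType) → Prop, ∀ p ∈ closure {z ∈ σ | Q (signVec S z)},
      ∃ q ∈ σ, Q (signVec S q) ∧ p ∈ closure {z | signVec S z = signVec S q} := by
    intro Q p hp
    have heq : {z ∈ σ | Q (signVec S z)} = ⋃ e : {e // Q e}, {z ∈ σ | signVec S z = e} := by
      ext z; simp only [mem_iUnion, mem_ofPred_eq]
      exact ⟨fun ⟨h1, h2⟩ => ⟨⟨_, h2⟩, h1, rfl⟩, fun ⟨e, h1, h2⟩ => ⟨h1, h2 ▸ e.2⟩⟩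
    rw [heq, closure_iUnion_of_finite, mem_iUnion] at hp
    obtain ⟨e, he⟩ := hp
    obtain ⟨q, hq, hqe⟩ := closure_nonempty_iff.1 ⟨p, he⟩
    refine ⟨q, hq, hqe ▸ e.2, closure_mono ?_ he⟩
    rintro z ⟨-, hz⟩
    exact hz.trans hqe.symm
  have hstep : ∀ q ∈ σ, ∀ p ∈ σ, p ∈ closure {z | signVec S z = signVec S q} →
      (cellGraph S F σ).Reachable (signVec S q) (signVec S p) := by
    intro q hq p hp hcl
    by_cases hne : signVec S q = signVec S p
    · rw [hne]
    · exact SimpleGraph.Adj.reachable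
        ⟨hne, q, hq, p, hp, rfl, rfl, hF.segment_subset q (hσF hq) p (hσF hp) hcl⟩
  by_contra hyR
  obtain ⟨p, hpσ, hp1, hp2⟩ := isPreconnected_closed_iff.1 hσ
    (closure {z ∈ σ | R (signVec S z)}) (closure {z ∈ σ | ¬ R (signVec S z)})
    isClosed_closure isClosed_closure
    (fun z hz => by
      by_cases hzR : R (signVec S z)
      · exact Or.inl (subset_closure ⟨hz, hzR⟩)
      · exact Or.inr (subset_closure ⟨hz, hzR⟩))
    ⟨x, hx, subset_closure ⟨hx, SimpleGraph.Reachable.refl _⟩⟩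
    ⟨y, hy, subset_closure ⟨hy, hyR⟩⟩
  obtain ⟨q, hq, hqR, hqcl⟩ := hclos R p hp1
  obtain ⟨q', hq', hqR', hqcl'⟩ := hclos (fun e => ¬ R e) p hp2
  exact hqR' ((SimpleGraph.Reachable.trans hqR (hstep q hq p hpσ hqcl)).trans
    (hstep q' hq' p hpσ hqcl').symm)

/-- In a connected subset `σ` of a cellular set `F`, any two points are joined by a chain of points
of `σ`, of uniformly bounded length, with successive segments in `F`. -/
theorem exists_chain (hS : S.Finite) : ∃ N : ℕ, ∀ F σ : Set (Euc m), IsCellular S F → σ ⊆ F →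
    IsPreconnected σ → ∀ (P : ℕ → Euc m → Prop) (x : Euc m), x ∈ σ → P 0 x →
    (∀ k, ∀ y ∈ σ, ∀ z ∈ σ, segment ℝ y z ⊆ F → P k y → P (k + 1) z) →
    ∀ y ∈ σ, ∃ k ≤ N, P k y := by
  classical
  have : Finite S := hS.to_subtype
  have : Fintype S := Fintype.ofFinite S
  -- A path has fewer edges than there are sign vectors. Each edge costs one move inside a cell and
  -- one move across, and a last move reaches `y` within its cell.
  refine ⟨2 * Fintype.card (S → SignType) + 1, ?_⟩
  intro F σ hF hσF hσ P x hx hP0 hP y hy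
  have hsame : ∀ k, ∀ y ∈ σ, ∀ z ∈ σ, signVec S y = signVec S z → P k y → P (k + 1) z :=
    fun k y hy z hz h hk => hP k y hy z hz
      (hF.segment_subset y (hσF hy) z (hσF hz) (subset_closure h.symm)) hk
  have hwalk : ∀ (e e' : S → SignType) (p : (cellGraph S F σ).Walk e e') (j : ℕ),
      ∀ x ∈ σ, signVec S x = e → P j x → ∀ y ∈ σ, signVec S y = e' →
      P (j + 2 * p.length + 1) y := by
    intro e e' p
    induction p with
    | nil =>
      intro j x hx hxe hj y hy hye
      simpa using hsame j x hx y hy (hxe.trans hye.symm) hj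
    | cons hadj p ih =>
      intro j x hx hxe hj y hy hye
      have hadj' := hadj
      obtain ⟨-, r, hr, q, hq, hre, hqe, hseg⟩ := hadj'
      have h1 := hsame j x hx r hr (hxe.trans hre.symm) hj
      have h2 := hP (j + 1) r hr q hq hseg h1
      have h3 := ih (j + 1 + 1) q hq hqe h2 y hy hye
      rw [SimpleGraph.Walk.length_cons]
      convert h3 using 1
      ring
  obtain ⟨p, hp⟩ := (cellGraph_reachable hS hF hσF hσ hx hy).exists_isPath
  refine ⟨_, ?_, hwalk _ _ p 0 x hx rfl hP0 y hy rfl⟩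
  have := hp.length_lt
  omega

end Chain


/-! ### The surface measure -/

section Surface

variable {n : ℕ}

lemma exists_affineIsometry_range_eq_hyperplane {ν : Euc (n + 1)} (hν : ν ≠ 0) (c : ℝ) :
    ∃ ι : Euc n →ᵃⁱ[ℝ] Euc (n + 1), range ι = hyperplane ν c := by
  have : Fact (Module.finrank ℝ (Euc (n + 1)) = n + 1) := ⟨by simp⟩
  let b := OrthonormalBasis.fromOrthogonalSpanSingleton (𝕜 := ℝ) n hν
  let x₀ : Euc (n + 1) := (c / ‖ν‖ ^ 2) • ν
  have hν2 : ‖ν‖ ^ 2 ≠ 0 := by simpa using hν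
  have hx₀ : ⟪ν, x₀⟫ = c := by
    rw [real_inner_smul_right, real_inner_self_eq_norm_sq]; field_simp
  let lin : Euc n →ₗᵢ[ℝ] Euc (n + 1) :=
    ((ℝ ∙ ν)ᗮ.subtypeₗᵢ).comp b.repr.symm.toLinearIsometry
  let ι : Euc n →ᵃⁱ[ℝ] Euc (n + 1) :=
    (AffineIsometryEquiv.constVAdd ℝ (Euc (n + 1)) x₀).toAffineIsometry.comp lin.toAffineIsometry
  have hι : ∀ z, ι z = x₀ + b.repr.symm z := fun z => rfl
  refine ⟨ι, Subset.antisymm ?_ ?_⟩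
  · rintro _ ⟨z, rfl⟩
    have : ⟪ν, (b.repr.symm z : Euc (n + 1))⟫ = 0 :=
      Submodule.mem_orthogonal_singleton_iff_inner_right.1 (b.repr.symm z).2
    simp [hyperplane, hι, inner_add_right, hx₀, this]
  · intro x hx
    have hmem : x - x₀ ∈ (ℝ ∙ ν)ᗮ := by
      rw [Submodule.mem_orthogonal_singleton_iff_inner_right, inner_sub_right, hx₀, hx, sub_self]
    refine ⟨b.repr ⟨x - x₀, hmem⟩, ?_⟩
    rw [hι, LinearIsometryEquiv.symm_apply_apply]
    simp

/-- Isometries preserve Hausdorff measure, whose normalisation is that of Lebesgue measure;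
questions on the surface measure thus become Lebesgue ones in coordinates of a hyperplane. -/
lemma hausdorff_eq_volume_preimage (ι : Euc n →ᵃⁱ[ℝ] Euc (n + 1)) {A : Set (Euc (n + 1))}
    (hA : A ⊆ range ι) : (μHE[n] : Measure (Euc (n + 1))) A = volume (ι ⁻¹' A) := by
  rw [← EuclideanSpace.euclideanHausdorffMeasure_eq_volume n,
    ι.isometry.euclideanHausdorffMeasure_preimage, inter_eq_left.2 hA]

/-- A hyperplane as an affine subspace. -/
def hyperplaneAff {m : ℕ} (ν : Euc m) (c : ℝ) : AffineSubspace ℝ (Euc m) where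
  carrier := hyperplane ν c
  smul_vsub_vadd_mem' := by
    intro s p₁ p₂ p₃ h₁ h₂ h₃
    have h₁' : ⟪ν, p₁⟫ = c := h₁
    have h₂' : ⟪ν, p₂⟫ = c := h₂
    have h₃' : ⟪ν, p₃⟫ = c := h₃
    change ⟪ν, s • (p₁ - p₂) + p₃⟫ = c
    rw [inner_add_right, real_inner_smul_right, inner_sub_right, h₁', h₂', h₃']
    ring

lemma volume_preimage_hyperplane_eq_zero (ι : Euc n →ᵃⁱ[ℝ] Euc (n + 1)) {ν : Euc (n + 1)} {c : ℝ}
    (h : ¬ range ι ⊆ hyperplane ν c) : volume (ι ⁻¹' hyperplane ν c) = 0 := by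
  have := Measure.addHaar_affineSubspace (volume : Measure (Euc n))
    ((hyperplaneAff ν c).comap ι.toAffineMap) ?_
  · exact this
  · intro htop
    refine h ?_
    rintro _ ⟨z, rfl⟩
    have hz : z ∈ (hyperplaneAff ν c).comap ι.toAffineMap := htop ▸ AffineSubspace.mem_top ℝ _ z
    exact hz

lemma hyperplane_eq_of_subset {ν ν' : Euc (n + 1)} {c c' : ℝ} (hν : ν ≠ 0) (hν' : ν' ≠ 0)
    (h : hyperplane ν c ⊆ hyperplane ν' c') : hyperplane ν c = hyperplane ν' c' := by
  let x₀ : Euc (n + 1) := (c / ‖ν‖ ^ 2) • ν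
  have hν2 : ‖ν‖ ^ 2 ≠ 0 := by simpa using hν
  have hx₀ : ⟪ν, x₀⟫ = c := by
    rw [real_inner_smul_right, real_inner_self_eq_norm_sq]; field_simp
  have hx₀' : ⟪ν', x₀⟫ = c' := h hx₀
  -- Every direction of the first hyperplane is orthogonal to `ν'`, so `ν'` is a multiple of `ν`.
  have hmem : ν' ∈ (ℝ ∙ ν)ᗮᗮ := by
    rw [Submodule.mem_orthogonal]
    intro w hw
    have hw' : ⟪ν, w⟫ = 0 := Submodule.mem_orthogonal_singleton_iff_inner_right.1 hw
    have : ⟪ν', x₀ + w⟫ = c' := h (show ⟪ν, x₀ + w⟫ = c by rw [inner_add_right, hx₀, hw', add_zero])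
    rw [inner_add_right, hx₀'] at this
    rw [real_inner_comm]
    linarith
  rw [Submodule.orthogonal_orthogonal] at hmem
  obtain ⟨k, rfl⟩ := Submodule.mem_span_singleton.1 hmem
  have hk : k ≠ 0 := fun hk => hν' (by simp [hk])
  rw [real_inner_smul_left, hx₀] at hx₀'
  refine h.antisymm fun x hx => ?_
  have hx' : ⟪k • ν, x⟫ = c' := hx
  rw [real_inner_smul_left, ← hx₀'] at hx'
  exact mul_left_cancel₀ hk hx'

lemma hausdorff_inter_hyperplane_eq_zero {ν ν' : Euc (n + 1)} {c c' : ℝ} (hν : ν ≠ 0) (hν' : ν' ≠ 0)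
    (h : hyperplane ν c ≠ hyperplane ν' c') :
    (μHE[n] : Measure (Euc (n + 1))) (hyperplane ν c ∩ hyperplane ν' c') = 0 := by
  obtain ⟨ι, hι⟩ := exists_affineIsometry_range_eq_hyperplane hν c
  rw [hausdorff_eq_volume_preimage ι (hι ▸ inter_subset_left)]
  refine measure_mono_null (preimage_mono inter_subset_right)
    (volume_preimage_hyperplane_eq_zero ι ?_)
  rw [hι]
  exact fun h' => h (hyperplane_eq_of_subset hν hν' h')

lemma hausdorff_ball_inter_hyperplane_ne_zero {ν : Euc (n + 1)} {c : ℝ} (hν : ν ≠ 0)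
    {x : Euc (n + 1)} (hx : x ∈ hyperplane ν c) {r : ℝ} (hr : 0 < r) :
    (μHE[n] : Measure (Euc (n + 1))) (Metric.ball x r ∩ hyperplane ν c) ≠ 0 := by
  obtain ⟨ι, hι⟩ := exists_affineIsometry_range_eq_hyperplane hν c
  obtain ⟨z, rfl⟩ := (hι ▸ hx : x ∈ range ι)
  rw [hausdorff_eq_volume_preimage ι (hι ▸ inter_subset_right)]
  have hsub : ι ⁻¹' Metric.ball (ι z) r ⊆ ι ⁻¹' (Metric.ball (ι z) r ∩ hyperplane ν c) :=
    fun y hy => ⟨hy, hι ▸ mem_range_self y⟩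
  refine fun h0 => ?_
  have hopen : IsOpen (ι ⁻¹' Metric.ball (ι z) r) := Metric.isOpen_ball.preimage ι.continuous
  exact (hopen.measure_pos volume ⟨z, Metric.mem_ball_self hr⟩).ne' (measure_mono_null hsub h0)

/-- A relative ball of the flat part has positive measure and is covered by the finitely many
hyperplanes of `S`. Were all of them different from `hyperplane ν c`, they would cut it in null
sets. Faces, defined with arbitrary hyperplanes, thus all lie in hyperplanes of `S`. -/
lemma hyperplane_eq_of_frontier {Ω : Set (Euc (n + 1))} {S : Set (Euc (n + 1) × ℝ)} (hS : S.Finite)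
    (hne : ∀ p ∈ S, p.1 ≠ 0) (hfr : frontier Ω ⊆ ⋃ p ∈ S, hyperplane p.1 p.2)
    {ν : Euc (n + 1)} {c : ℝ} (hν : ν ≠ 0) (h : (flatPart Ω ν c).Nonempty) :
    ∃ p ∈ S, hyperplane ν c = hyperplane p.1 p.2 := by
  by_contra! hcon
  obtain ⟨x, hxH, r, hr, hsub⟩ := h
  refine hausdorff_ball_inter_hyperplane_ne_zero hν hxH hr ?_
  refine measure_mono_null (t := ⋃ p ∈ S, hyperplane ν c ∩ hyperplane p.1 p.2) ?_
    ((measure_biUnion_null_iff hS.countable).2 fun p hp =>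
      hausdorff_inter_hyperplane_eq_zero hν (hne p hp) (hcon p hp))
  intro y hy
  obtain ⟨p, hp, hyp⟩ := mem_iUnion₂.1 (hfr (hsub hy))
  exact mem_iUnion₂.2 ⟨p, hp, hy.2, hyp⟩

lemma surf_apply {Ω A : Set (Euc (n + 1))} (hA : A ⊆ frontier Ω) :
    surf Ω A = (μHE[n] : Measure (Euc (n + 1))) A := by
  rw [surf, Measure.restrict_apply' isClosed_frontier.measurableSet, inter_eq_left.2 hA]

lemma isFiniteMeasure_surf {Ω : Set (Euc (n + 1))} (h : IsPolytopal Ω) :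
    IsFiniteMeasure (surf Ω) := by
  obtain ⟨-, hb, S, hS, hne, hfr⟩ := h
  refine ⟨?_⟩
  rw [surf, Measure.restrict_apply_univ]
  have hsub : frontier Ω ⊆ ⋃ p ∈ S, hyperplane p.1 p.2 ∩ frontier Ω := fun x hx => by
    obtain ⟨p, hp, hxp⟩ := mem_iUnion₂.1 (hfr hx)
    exact mem_iUnion₂.2 ⟨p, hp, hxp, hx⟩
  refine (measure_mono hsub).trans_lt ?_
  refine measure_biUnion_lt_top hS fun p hp => ?_
  obtain ⟨ι, hι⟩ := exists_affineIsometry_range_eq_hyperplane (hne p hp) p.2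
  rw [hausdorff_eq_volume_preimage ι (hι ▸ inter_subset_left)]
  refine Bornology.IsBounded.measure_lt_top ?_
  refine ι.isometry.antilipschitz.isBounded_preimage (hb.closure.subset ?_)
  exact inter_subset_right.trans frontier_subset_closure

end Surface

/-! ### The faces of `∂Ω` -/

section Faces

variable {n : ℕ} {Ω : Set (Euc (n + 1))}

lemma exists_eq_component_of_isBoundaryFace {S : Set (Euc (n + 1) × ℝ)} (hS : S.Finite)
    (hne : ∀ p ∈ S, p.1 ≠ 0) (hfr : frontier Ω ⊆ ⋃ p ∈ S, hyperplane p.1 p.2)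
    {F : Set (Euc (n + 1))} (hF : IsBoundaryFace Ω F) :
    ∃ p ∈ S, ∃ x ∈ flatPart Ω p.1 p.2, F = connectedComponentIn (flatPart Ω p.1 p.2) x := by
  obtain ⟨ν, c, hν, x, hx, rfl⟩ := hF
  obtain ⟨p, hp, h⟩ := hyperplane_eq_of_frontier hS hne hfr hν ⟨x, hx⟩
  rw [flatPart_congr h] at hx ⊢
  exact ⟨p, hp, x, hx, rfl⟩

lemma IsBoundaryFace.isCellular {S : Set (Euc (n + 1) × ℝ)} (hΩ : IsOpen Ω)
    (hLip : HasLipschitzBoundary Ω) (hS : S.Finite)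
    (hne : ∀ p ∈ S, p.1 ≠ 0) (hfr : frontier Ω ⊆ ⋃ p ∈ S, hyperplane p.1 p.2)
    {F : Set (Euc (n + 1))} (hF : IsBoundaryFace Ω F) : IsCellular S F := by
  obtain ⟨p, hp, x, hx, rfl⟩ := exists_eq_component_of_isBoundaryFace hS hne hfr hF
  exact (isCellular_component hS (fun _ _ => mem_frontier_of_signVec_eq hΩ hLip hS hne hfr) hp).2 x

/-- A face is determined by its hyperplane in `S` and the sign vector of any one of its points: two
points of the flat part in one cell are joined by a segment of the flat part. -/
lemma finite_boundaryFaces (h : IsPolytopal Ω) (hLip : HasLipschitzBoundary Ω) :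
    {F | IsBoundaryFace Ω F}.Finite := by
  classical
  obtain ⟨hΩ, -, S, hS, hne, hfr⟩ := h
  have : Finite S := hS.to_subtype
  let f : S × (S → SignType) → Set (Euc (n + 1)) := fun q =>
    if h : ∃ x ∈ flatPart Ω q.1.1.1 q.1.1.2, signVec S x = q.2 then
      connectedComponentIn (flatPart Ω q.1.1.1 q.1.1.2) h.choose else ∅
  refine (finite_range f).subset ?_
  intro F hF
  obtain ⟨p, hp, x, hx, rfl⟩ := exists_eq_component_of_isBoundaryFace hS hne hfr hF
  refine ⟨(⟨p, hp⟩, signVec S x), ?_⟩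
  have hex : ∃ y ∈ flatPart Ω p.1 p.2, signVec S y = signVec S x := ⟨x, hx, rfl⟩
  have hf : f (⟨p, hp⟩, signVec S x) = connectedComponentIn (flatPart Ω p.1 p.2) hex.choose :=
    dif_pos hex
  rw [hf]
  have hinv := (isCellular_component (Ω := Ω) hS
    (fun _ _ => mem_frontier_of_signVec_eq hΩ hLip hS hne hfr) hp).1
  have hsub : segment ℝ x hex.choose ⊆ flatPart Ω p.1 p.2 := fun z hz =>
    hinv x z (signVec_segment hex.choose_spec.2 hz).symm hx
  refine (connectedComponentIn_eq ?_).symm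
  exact (convex_segment x hex.choose).isPreconnected.subset_connectedComponentIn
    (left_mem_segment _ _ _) hsub (right_mem_segment _ _ _)

lemma IsBoundaryFace.subset_frontier {F : Set (Euc (n + 1))} (hF : IsBoundaryFace Ω F) :
    F ⊆ frontier Ω := by
  obtain ⟨ν, c, hν, x, hx, rfl⟩ := hF
  exact (connectedComponentIn_subset _ _).trans flatPart_subset_frontier

/-- The chart `ι` is only known to cover `F`. As `F` contains a relative ball of positive measure,
the range of `ι` must lie in the hyperplane of `F`, in which `F` is relatively open. -/
lemma IsBoundaryFace.isOpen_preimage {F : Set (Euc (n + 1))} (hF : IsBoundaryFace Ω F)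
    {ι : Euc n →ᵃⁱ[ℝ] Euc (n + 1)} (hι : F ⊆ range ι) : IsOpen (ι ⁻¹' F) := by
  obtain ⟨ν, c, hν, x, hx, rfl⟩ := hF
  obtain ⟨r, hr, hball⟩ := exists_ball_inter_subset_component (mem_connectedComponentIn hx)
  have hrange : range ι ⊆ hyperplane ν c := by
    by_contra hcon
    refine hausdorff_ball_inter_hyperplane_ne_zero hν hx.1 hr ?_
    rw [hausdorff_eq_volume_preimage ι (hball.trans hι)]
    exact measure_mono_null (preimage_mono inter_subset_right)
      (volume_preimage_hyperplane_eq_zero ι hcon)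
  rw [Metric.isOpen_iff]
  intro z hz
  obtain ⟨r, hr, hball⟩ := exists_ball_inter_subset_component hz
  refine ⟨r, hr, fun y hy => hball ⟨?_, hrange (mem_range_self y)⟩⟩
  rw [Metric.mem_ball, ι.dist_map]
  exact hy

/-- A connected relatively open piece of a hyperplane in `∂Ω` lies in a face of `∂Ω`. -/
lemma exists_boundaryFace_of_isConnected {σ : Set (Euc (n + 1))} (hσ : IsConnected σ)
    (hσΩ : σ ⊆ frontier Ω) {ν : Euc (n + 1)} {c : ℝ} {O : Set (Euc (n + 1))} (hν : ν ≠ 0)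
    (hO : IsOpen O) (hσO : σ = O ∩ hyperplane ν c) : ∃ F, IsBoundaryFace Ω F ∧ σ ⊆ F := by
  subst hσO
  have hflat := subset_flatPart hO hσΩ
  obtain ⟨x, hx⟩ := hσ.nonempty
  exact ⟨_, ⟨ν, c, hν, x, hflat hx, rfl⟩, hσ.isPreconnected.subset_connectedComponentIn hx hflat⟩

/-- Quadratic deviation from a level set of positive measure, on connected pieces of the faces of
`∂Ω`. -/
theorem exists_quadratic_bound (h : IsPolytopal Ω) (hLip : HasLipschitzBoundary Ω)
    {t : L2Bd Ω} {γ : Euc (n + 1) → ℝ} (hγ : IsW2InftyRep t γ) :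
    ∃ L : ℝ, 0 ≤ L ∧ ∀ (a : ℝ) (σ F : Set (Euc (n + 1))), IsBoundaryFace Ω F → σ ⊆ F →
      IsPreconnected σ → MeasurableSet σ → surf Ω {x ∈ σ | γ x = a} ≠ 0 →
      ∀ x ∈ σ, |γ x - a| ≤ L * Metric.diam σ ^ 2 := by
  obtain ⟨hΩ, hb, S, hS, hne, hfr⟩ := h
  obtain ⟨N, hN⟩ := exists_chain hS
  have hface : ∀ F, IsBoundaryFace Ω F → ∃ L : ℝ, 0 ≤ L ∧ ∀ (a : ℝ) (σ : Set (Euc (n + 1))),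
      σ ⊆ F → IsPreconnected σ → MeasurableSet σ → surf Ω {x ∈ σ | γ x = a} ≠ 0 →
      ∀ x ∈ σ, |γ x - a| ≤ L * Metric.diam σ ^ 2 := by
    intro F hF
    obtain ⟨ι, hι, hW⟩ := hγ.memW2Infty F hF
    have hU := hF.isOpen_preimage hι
    have hcont : ContinuousOn (γ ∘ ι) (ι ⁻¹' F) :=
      (hγ.continuousOn F hF).comp ι.continuous.continuousOn fun z hz => hz
    obtain ⟨L, hL, p, hp⟩ := exists_taylor_of_memW2Infty hU hcont hW
    refine ⟨N ^ 2 * L, by positivity, fun a σ hσF hσ hσm hpos x hx => ?_⟩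
    have hσb : Bornology.IsBounded σ :=
      hb.closure.subset (hσF.trans (hF.subset_frontier.trans frontier_subset_closure))
    have hZm : MeasurableSet (ι ⁻¹' {x ∈ σ | γ x = a}) := by
      have h1 : MeasurableSet (ι ⁻¹' σ) := ι.continuous.measurable hσm
      obtain ⟨u, hu, hu'⟩ := (continuousOn_iff_isClosed.1 hcont) {a} isClosed_singleton
      have : ι ⁻¹' {x ∈ σ | γ x = a} = ι ⁻¹' σ ∩ u := by
        ext z
        have := Set.ext_iff.1 hu' z
        simp only [mem_inter_iff, mem_preimage, mem_singleton_iff, Function.comp] at this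
        constructor
        · rintro ⟨h1, h2⟩
          exact ⟨h1, (this.1 ⟨h2, hσF h1⟩).1⟩
        · rintro ⟨h1, h2⟩
          exact ⟨h1, (this.2 ⟨h2, hσF h1⟩).1⟩
      rw [this]
      exact h1.inter hu.measurableSet
    have hZσ : {x ∈ σ | γ x = a} ⊆ σ := fun x hx => hx.1
    rw [surf_apply (hZσ.trans (hσF.trans hF.subset_frontier)),
      hausdorff_eq_volume_preimage ι (hZσ.trans (hσF.trans hι))] at hpos
    -- The chain starts at a contact point where the tangential gradient vanishes.
    obtain ⟨z₀, hz₀, hpz₀⟩ := exists_deriv_eq_zero_of_level_set hU (fun x y hxy => (hp x y hxy).2)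
      hZm (preimage_mono (hZσ.trans hσF)) (fun z hz => hz.2) hpos
    set d := Metric.diam σ with hd
    have hd0 : 0 ≤ d := Metric.diam_nonneg
    -- Each segment of the chain has length at most `d`. After `k` of them the gradient is at most
    -- `k L d` and the deviation from `a` at most `k² L d²`; the induction closes because `k² + k +
    -- 1 ≤ (k + 1)²`.
    obtain ⟨k, hkN, z, hzx, hk1, hk2⟩ := hN F σ (hF.isCellular hΩ hLip hS hne hfr) hσF hσ
      (fun k x => ∃ z, ι z = x ∧ ‖p z‖ ≤ k * (L * d) ∧ |γ x - a| ≤ (k : ℝ) ^ 2 * (L * d ^ 2))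
      (ι z₀) hz₀.1 ⟨z₀, rfl, by simp [hpz₀], by
        have : γ (ι z₀) = a := hz₀.2
        simp [this]⟩
      (by
        rintro k y hy y' hy' hseg ⟨z, rfl, h1, h2⟩
        obtain ⟨z', rfl⟩ := hι (hσF hy')
        have hseg' : segment ℝ z z' ⊆ ι ⁻¹' F := by
          intro w hw
          refine hseg ?_
          have : ι w ∈ ι.toAffineMap '' segment ℝ z z' := ⟨w, hw, rfl⟩
          rwa [image_segment] at this
        obtain ⟨hp1, hp2⟩ := hp z z' hseg'
        have hdist : ‖z' - z‖ ≤ d := by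
          rw [← dist_eq_norm, ← ι.dist_map]
          exact Metric.dist_le_diam_of_mem hσb hy' hy
        have hLd : L * ‖z' - z‖ ≤ L * d := by gcongr
        refine ⟨z', rfl, ?_, ?_⟩
        · have := norm_le_norm_add_norm_sub' (p z') (p z)
          push_cast
          linarith
        · have e1 : |p z (z' - z)| ≤ k * (L * d) * d :=
            ((p z).le_opNorm _).trans (by gcongr)
          have e2 : L * ‖z' - z‖ ^ 2 ≤ L * d ^ 2 := by gcongr
          have e3 : γ (ι z') - a = (γ (ι z') - γ (ι z) - p z (z' - z)) + (γ (ι z) - a)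
            + p z (z' - z) := by ring
          rw [e3]
          refine (abs_add_three _ _ _).trans ?_
          have e4 : |γ (ι z') - γ (ι z) - p z (z' - z)| ≤ L * ‖z' - z‖ ^ 2 := hp2
          have e5 : 0 ≤ (k : ℝ) * (L * d ^ 2) := by positivity
          push_cast
          nlinarith)
      x hx
    refine hk2.trans ?_
    rw [← mul_assoc]
    gcongr
  choose! L hL0 hL using hface
  -- The constants depend on the face of `∂Ω`; finiteness of the faces gives a common one.
  obtain ⟨B, hB⟩ := ((finite_boundaryFaces ⟨hΩ, hb, S, hS, hne, hfr⟩ hLip).image L).bddAbove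
  refine ⟨max B 0, le_max_right _ _, fun a σ F hF hσF hσ hσm hpos x hx => ?_⟩
  refine (hL F hF a σ hσF hσ hσm hpos x hx).trans ?_
  gcongr
  exact (hB (mem_image_of_mem L hF)).trans (le_max_left _ _)

end Faces

/-! ### The boundary faces of a mesh -/

section Mesh

variable {n : ℕ} {Ω : Set (Euc (n + 1))} (T : PolytopalMesh Ω)

lemma PolytopalMesh.size_nonneg : 0 ≤ T.size :=
  Real.sSup_nonneg (by rintro _ ⟨K, -, rfl⟩; exact Metric.diam_nonneg)

lemma PolytopalMesh.measurableSet_face {σ : Set (Euc (n + 1))} (hσ : σ ∈ T.faces) :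
    MeasurableSet σ := by
  obtain ⟨ν, c, O, -, hO, rfl⟩ := T.faces_open σ hσ
  exact hO.measurableSet.inter (isClosed_hyperplane ν c).measurableSet

lemma PolytopalMesh.exists_face_of_extFaces {σ : Set (Euc (n + 1))} (hσ : σ ∈ T.extFaces) :
    ∃ F, IsBoundaryFace Ω F ∧ σ ⊆ F := by
  obtain ⟨ν, c, O, hν, hO, h⟩ := T.faces_open σ hσ.1
  exact exists_boundaryFace_of_isConnected (T.boundary_connected σ hσ.1 hσ.2) hσ.2 hν hO h

lemma PolytopalMesh.diam_le_size (hΩ : IsOpen Ω) {σ : Set (Euc (n + 1))} (hσ : σ ∈ T.extFaces) :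
    Metric.diam σ ≤ T.size := by
  have hK : ∃ K ∈ T.cells, σ ∈ T.cellFaces K := by
    rcases T.faces_cells σ hσ.1 with ⟨h, -⟩ | ⟨-, h⟩
    · have : {K ∈ T.cells | σ ∈ T.cellFaces K}.Nonempty :=
        nonempty_of_ncard_ne_zero (by rw [h]; exact one_ne_zero)
      exact this
    · obtain ⟨x, hx⟩ := T.faces_nonempty σ hσ.1
      have := hσ.2 hx
      rw [hΩ.frontier_eq] at this
      exact absurd (h hx) this.2
  obtain ⟨K, hK, hσK⟩ := hK
  have hsub : σ ⊆ closure K := by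
    refine subset_trans ?_ (frontier_subset_closure (s := K))
    rw [T.frontier_eq K hK]
    exact subset_closure.trans (subset_biUnion_of_mem (u := fun σ => closure σ) hσK)
  have hKb := (T.cells_polytopal K hK).2.1
  calc Metric.diam σ ≤ Metric.diam (closure K) := Metric.diam_mono hsub hKb.closure
    _ = Metric.diam K := Metric.diam_closure K
    _ ≤ T.size := le_csSup (T.cells_finite.image _).bddAbove (mem_image_of_mem _ hK)

/-- A boundary point lies in the closure of some face of the mesh. For a boundary face only its null
relative boundary is lost. For an interior face `σ` in a hyperplane `H`, consider a boundary point
of `closure σ` lying on no hyperplane of `S` other than `H`. Nearby points of `σ` have the same sign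
vector, so they would be boundary points too, against `σ ⊆ Ω`. What remains is covered by finitely
many intersections of distinct hyperplanes. -/
lemma PolytopalMesh.surf_compl_extFaces (h : IsPolytopal Ω) (hLip : HasLipschitzBoundary Ω) :
    surf Ω (⋃ σ ∈ T.extFaces, σ)ᶜ = 0 := by
  obtain ⟨hΩ, hb, S, hS, hne, hfr⟩ := h
  rw [surf, Measure.restrict_apply' isClosed_frontier.measurableSet]
  have hint : ∀ σ ∈ T.faces, σ ⊆ Ω →
      (μHE[n] : Measure (Euc (n + 1))) (closure σ ∩ frontier Ω) = 0 := by
    intro σ hσ hσΩ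
    obtain ⟨ν, c, O, hν, hO, hσO⟩ := T.faces_open σ hσ
    have hσH : closure σ ⊆ hyperplane ν c :=
      closure_minimal (hσO ▸ inter_subset_right) (isClosed_hyperplane ν c)
    refine measure_mono_null (t := ⋃ p ∈ {p ∈ S | hyperplane ν c ≠ hyperplane p.1 p.2},
      hyperplane ν c ∩ hyperplane p.1 p.2) ?_ ?_
    · rintro x ⟨hxσ, hxΩ⟩
      by_contra hcon
      simp only [mem_iUnion, not_exists] at hcon
      have hcon' : ∀ p ∈ S, x ∈ hyperplane p.1 p.2 → hyperplane ν c = hyperplane p.1 p.2 := by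
        intro p hp hxp
        by_contra hne'
        exact hcon p ⟨hp, hne'⟩ ⟨hσH hxσ, hxp⟩
      obtain ⟨p, hp, hxp⟩ := mem_iUnion₂.1 (hfr hxΩ)
      have hev : ∀ᶠ y in 𝓝 x, y ∈ hyperplane ν c → signVec S y = signVec S x := by
        have : Finite S := hS.to_subtype
        have key : ∀ q : S, ∀ᶠ y in 𝓝 x, y ∈ hyperplane ν c → signVec S y q = signVec S x q := by
          intro q
          by_cases hxq : x ∈ hyperplane q.1.1 q.1.2
          · filter_upwards with y hy
            rw [hcon' q.1 q.2 hxq] at hy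
            rw [(signVec_eq_zero_iff q).2 hy, (signVec_eq_zero_iff q).2 hxq]
          · have hx0 : ⟪q.1.1, x⟫ - q.1.2 ≠ 0 := fun h0 => hxq (sub_eq_zero.1 h0)
            have hc : Tendsto (fun y => ⟪q.1.1, y⟫ - q.1.2) (𝓝 x) (𝓝 (⟪q.1.1, x⟫ - q.1.2)) := by
              have : Continuous (fun y => ⟪q.1.1, y⟫ - q.1.2) := by fun_prop
              exact this.tendsto x
            simp only [signVec]
            rcases hx0.lt_or_gt with hlt | hlt
            · filter_upwards [hc.eventually (gt_mem_nhds hlt)] with y hy _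
              rw [sign_neg hy, sign_neg hlt]
            · filter_upwards [hc.eventually (lt_mem_nhds hlt)] with y hy _
              rw [sign_pos hy, sign_pos hlt]
        filter_upwards [eventually_all.2 key] with y hy hyH
        exact funext fun q => hy q hyH
      obtain ⟨y, hyσ, hy⟩ := ((mem_closure_iff_frequently.1 hxσ).and_eventually hev).exists
      have := mem_frontier_of_signVec_eq hΩ hLip hS hne hfr (hy (hσH (subset_closure hyσ))).symm hxΩ
      rw [hΩ.frontier_eq] at this
      exact this.2 (hσΩ hyσ)
    · refine (measure_biUnion_null_iff (hS.subset (sep_subset _ _)).countable).2 fun p hp => ?_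
      exact hausdorff_inter_hyperplane_eq_zero hν (hne p hp.1) hp.2
  refine measure_mono_null (t := (⋃ σ ∈ T.extFaces, closure σ \ σ) ∪
    ⋃ σ ∈ {σ ∈ T.faces | σ ⊆ Ω}, closure σ ∩ frontier Ω) ?_ ?_
  · rintro x ⟨hxc, hxΩ⟩
    have hx' : x ∈ ⋃ K ∈ T.cells, closure K := T.closure_eq ▸ frontier_subset_closure hxΩ
    obtain ⟨K, hK, hxK⟩ := mem_iUnion₂.1 hx'
    have hxfr : x ∈ frontier K := by
      rw [(T.cells_polytopal K hK).1.frontier_eq]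
      refine ⟨hxK, fun hx => ?_⟩
      rw [hΩ.frontier_eq] at hxΩ
      exact hxΩ.2 (T.cells_subset K hK hx)
    rw [T.frontier_eq K hK] at hxfr
    obtain ⟨σ, hσ, hxσ⟩ := mem_iUnion₂.1 hxfr
    have hσf := T.cellFaces_subset K hK hσ
    rcases T.faces_cells σ hσf with ⟨-, h⟩ | ⟨-, h⟩
    · refine Or.inl (mem_iUnion₂.2 ⟨σ, ⟨hσf, h⟩, hxσ, fun hx => hxc ?_⟩)
      exact mem_iUnion₂.2 ⟨σ, ⟨hσf, h⟩, hx⟩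
    · exact Or.inr (mem_iUnion₂.2 ⟨σ, ⟨hσf, h⟩, hxσ, hxΩ⟩)
  · refine measure_union_null ?_ ?_
    · exact (measure_biUnion_null_iff (T.faces_finite.subset (sep_subset _ _)).countable).2
        fun σ hσ => T.boundary_null σ hσ.1 hσ.2
    · exact (measure_biUnion_null_iff (T.faces_finite.subset (sep_subset _ _)).countable).2
        fun σ hσ => hint σ hσ.1 hσ.2

end Mesh


/-! ### Superposition operators on `L²` -/

section Superposition

variable {α E : Type*} [MeasurableSpace α] {μ : Measure α} [NormedAddCommGroup E]
  [InnerProductSpace ℝ E]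

lemma L2_norm_sq_eq_integral (h : Lp E 2 μ) : ‖h‖ ^ 2 = ∫ x, ‖h x‖ ^ 2 ∂μ := by
  rw [← real_inner_self_eq_norm_sq, L2.inner_def]
  simp only [real_inner_self_eq_norm_sq]

lemma memLp_comp_smul {A : ℝ × ℝ → ℝ} (hA : Continuous A) {B : ℝ} (hB : ∀ z, |A z| ≤ B)
    (f g : Lp ℝ 2 μ) (V : Lp E 2 μ) : MemLp (fun x => A (f x, g x) • V x) 2 μ := by
  refine (Lp.memLp V).of_le_mul (c := B) ?_ (Eventually.of_forall fun x => ?_)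
  · exact (hA.comp_aestronglyMeasurable ((Lp.aestronglyMeasurable f).prodMk
      (Lp.aestronglyMeasurable g))).smul (Lp.aestronglyMeasurable V)
  · rw [norm_smul]
    exact mul_le_mul_of_nonneg_right (hB _) (norm_nonneg _)

/-- The function `A(f, g) V`. -/
def compSMul {A : ℝ × ℝ → ℝ} (hA : Continuous A) {B : ℝ} (hB : ∀ z, |A z| ≤ B)
    (f g : Lp ℝ 2 μ) (V : Lp E 2 μ) : Lp E 2 μ :=
  (memLp_comp_smul hA hB f g V).toLp _

lemma coeFn_compSMul {A : ℝ × ℝ → ℝ} (hA : Continuous A) {B : ℝ} (hB : ∀ z, |A z| ≤ B)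
    (f g : Lp ℝ 2 μ) (V : Lp E 2 μ) :
    compSMul hA hB f g V =ᵐ[μ] fun x => A (f x, g x) • V x :=
  MemLp.coeFn_toLp _

/-- The bounded factor absorbs the convergence of `V`; for the fixed field `V₀`, dominated
convergence handles the coefficients. These need only be continuous, hence the almost everywhere
convergence assumed of `f` and `g`. -/
lemma tendsto_compSMul {A : ℝ × ℝ → ℝ} (hA : Continuous A) {B : ℝ} (hB : ∀ z, |A z| ≤ B)
    {f g : ℕ → Lp ℝ 2 μ} {f₀ g₀ : Lp ℝ 2 μ} {V : ℕ → Lp E 2 μ} {V₀ : Lp E 2 μ}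
    (hf : ∀ᵐ x ∂μ, Tendsto (fun k => f k x) atTop (𝓝 (f₀ x)))
    (hg : ∀ᵐ x ∂μ, Tendsto (fun k => g k x) atTop (𝓝 (g₀ x)))
    (hV : Tendsto V atTop (𝓝 V₀)) :
    Tendsto (fun k => compSMul hA hB (f k) (g k) (V k)) atTop (𝓝 (compSMul hA hB f₀ g₀ V₀)) := by
  have hB0 : 0 ≤ B := (abs_nonneg _).trans (hB 0)
  have h1 : Tendsto (fun k => compSMul hA hB (f k) (g k) (V k) - compSMul hA hB (f k) (g k) V₀)
      atTop (𝓝 0) := by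
    refine squeeze_zero_norm (a := fun k => B * ‖V k - V₀‖) (fun k => ?_) ?_
    · refine Lp.norm_le_mul_norm_of_ae_le_mul ?_
      filter_upwards [Lp.coeFn_sub (compSMul hA hB (f k) (g k) (V k))
        (compSMul hA hB (f k) (g k) V₀), coeFn_compSMul hA hB (f k) (g k) (V k),
        coeFn_compSMul hA hB (f k) (g k) V₀, Lp.coeFn_sub (V k) V₀] with x e1 e2 e3 e4
      rw [e1, e4, Pi.sub_apply, Pi.sub_apply, e2, e3, ← smul_sub, norm_smul]
      exact mul_le_mul_of_nonneg_right (hB _) (norm_nonneg _)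
    · simpa using ((tendsto_iff_norm_sub_tendsto_zero.1 hV).const_mul B)
  have h2 : Tendsto (fun k => compSMul hA hB (f k) (g k) V₀ - compSMul hA hB f₀ g₀ V₀)
      atTop (𝓝 0) := by
    rw [tendsto_zero_iff_norm_tendsto_zero]
    have hsq : Tendsto (fun k => ‖compSMul hA hB (f k) (g k) V₀ - compSMul hA hB f₀ g₀ V₀‖ ^ 2)
        atTop (𝓝 0) := by
      have heq : ∀ k, ‖compSMul hA hB (f k) (g k) V₀ - compSMul hA hB f₀ g₀ V₀‖ ^ 2 =
          ∫ x, ‖(A (f k x, g k x) - A (f₀ x, g₀ x)) • V₀ x‖ ^ 2 ∂μ := by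
        intro k
        rw [L2_norm_sq_eq_integral]
        refine integral_congr_ae ?_
        filter_upwards [Lp.coeFn_sub (compSMul hA hB (f k) (g k) V₀)
          (compSMul hA hB f₀ g₀ V₀), coeFn_compSMul hA hB (f k) (g k) V₀,
          coeFn_compSMul hA hB f₀ g₀ V₀] with x e1 e2 e3
        rw [e1, Pi.sub_apply, e2, e3, sub_smul]
      simp only [heq]
      have hdct := tendsto_integral_of_dominated_convergence (μ := μ)
        (F := fun k x => ‖(A (f k x, g k x) - A (f₀ x, g₀ x)) • V₀ x‖ ^ 2) (f := fun _ => (0 : ℝ))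
        (fun x => (2 * B) ^ 2 * ‖V₀ x‖ ^ 2) ?_ ?_ ?_ ?_
      · simpa using hdct
      · intro k
        refine AEStronglyMeasurable.pow (AEStronglyMeasurable.norm ?_) 2
        refine AEStronglyMeasurable.smul (AEStronglyMeasurable.sub ?_ ?_)
          (Lp.aestronglyMeasurable V₀)
        · exact hA.comp_aestronglyMeasurable ((Lp.aestronglyMeasurable (f k)).prodMk
            (Lp.aestronglyMeasurable (g k)))
        · exact hA.comp_aestronglyMeasurable ((Lp.aestronglyMeasurable f₀).prodMk
            (Lp.aestronglyMeasurable g₀))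
      · exact ((Lp.memLp V₀).integrable_norm_pow (by norm_num)).const_mul _
      · intro k
        refine Eventually.of_forall fun x => ?_
        rw [Real.norm_eq_abs, abs_of_nonneg (by positivity), norm_smul, mul_pow]
        gcongr
        rw [Real.norm_eq_abs]
        have := abs_sub (A (f k x, g k x)) (A (f₀ x, g₀ x))
        linarith [hB (f k x, g k x), hB (f₀ x, g₀ x)]
      · filter_upwards [hf, hg] with x hfx hgx
        have hAx : Tendsto (fun k => A (f k x, g k x)) atTop (𝓝 (A (f₀ x, g₀ x))) :=
          (hA.tendsto _).comp (hfx.prodMk_nhds hgx)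
        have := (((hAx.sub_const (A (f₀ x, g₀ x))).smul_const (V₀ x)).norm).pow 2
        simpa using this
    have := hsq.sqrt
    simpa using this
  have h3 := h1.add h2
  simp only [sub_add_sub_cancel, add_zero] at h3
  exact tendsto_sub_nhds_zero_iff.1 h3

/-- Almost everywhere convergence along a common subsequence. -/
lemma exists_subseq_ae_tendsto {f g : ℕ → Lp ℝ 2 μ} {f₀ g₀ : Lp ℝ 2 μ}
    (hf : Tendsto f atTop (𝓝 f₀)) (hg : Tendsto g atTop (𝓝 g₀)) :
    ∃ ns : ℕ → ℕ, StrictMono ns ∧ (∀ᵐ x ∂μ, Tendsto (fun k => f (ns k) x) atTop (𝓝 (f₀ x))) ∧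
      ∀ᵐ x ∂μ, Tendsto (fun k => g (ns k) x) atTop (𝓝 (g₀ x)) := by
  obtain ⟨n₁, hn₁, h₁⟩ := (tendstoInMeasure_of_tendsto_Lp hf).exists_seq_tendsto_ae
  obtain ⟨n₂, hn₂, h₂⟩ :=
    (tendstoInMeasure_of_tendsto_Lp (hg.comp hn₁.tendsto_atTop)).exists_seq_tendsto_ae
  refine ⟨n₁ ∘ n₂, hn₁.comp hn₂, ?_, h₂⟩
  filter_upwards [h₁] with x hx using hx.comp hn₂.tendsto_atTop

variable {T θ : ℝ → ℝ} {B : ℝ}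

lemma abs_mul_sub_mul_le (hT : ∀ x, |T x| ≤ B) (hθ : ∀ x, |θ x| ≤ B)
    (hT' : ∀ x y, |T x - T y| ≤ B * |x - y|) (hθ' : ∀ x y, |θ x - θ y| ≤ B * |x - y|)
    (x y x' y' : ℝ) :
    |T x * θ y - T x' * θ y'| ≤ B ^ 2 * (|x - x'| + |y - y'|) := by
  have hB0 : 0 ≤ B := (abs_nonneg _).trans (hT 0)
  have : T x * θ y - T x' * θ y' = (T x - T x') * θ y + T x' * (θ y - θ y') := by ring
  rw [this]
  refine (abs_add_le _ _).trans ?_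
  rw [abs_mul, abs_mul]
  have h1 : |T x - T x'| * |θ y| ≤ (B * |x - x'|) * B := by gcongr; exacts [hT' _ _, hθ _]
  have h2 : |T x'| * |θ y - θ y'| ≤ B * (B * |y - y'|) := by gcongr; exacts [hT _, hθ' _ _]
  linarith

/-- The normalisation `T 0 = 0` and the Lipschitz bound give `|T(f)| ≤ B |f|`, hence square
integrability. -/
lemma memLp_mul_comp (hTc : Continuous T) (hθc : Continuous θ) (hT0 : T 0 = 0)
    (hθ : ∀ x, |θ x| ≤ B) (hT' : ∀ x y, |T x - T y| ≤ B * |x - y|) (f g : Lp ℝ 2 μ) :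
    MemLp (fun x => T (f x) * θ (g x)) 2 μ := by
  refine (Lp.memLp f).of_le_mul (c := B * B) ?_ (Eventually.of_forall fun x => ?_)
  · exact (hTc.comp_aestronglyMeasurable (Lp.aestronglyMeasurable f)).mul
      (hθc.comp_aestronglyMeasurable (Lp.aestronglyMeasurable g))
  · have hB0 : 0 ≤ B := (abs_nonneg _).trans (hθ 0)
    rw [norm_mul, Real.norm_eq_abs, Real.norm_eq_abs, Real.norm_eq_abs]
    have := hT' (f x) 0
    rw [hT0, sub_zero, sub_zero] at this
    have := mul_le_mul this (hθ (g x)) (abs_nonneg _) (by positivity)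
    linarith

lemma tendsto_mul_comp (hTc : Continuous T) (hθc : Continuous θ) (hT0 : T 0 = 0)
    (hT : ∀ x, |T x| ≤ B)
    (hθ : ∀ x, |θ x| ≤ B) (hT' : ∀ x y, |T x - T y| ≤ B * |x - y|)
    (hθ' : ∀ x y, |θ x - θ y| ≤ B * |x - y|)
    {f g : ℕ → Lp ℝ 2 μ} {f₀ g₀ : Lp ℝ 2 μ}
    (hf : Tendsto f atTop (𝓝 f₀)) (hg : Tendsto g atTop (𝓝 g₀)) :
    Tendsto (fun k => (memLp_mul_comp hTc hθc hT0 hθ hT' (f k) (g k)).toLp _) atTop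
      (𝓝 ((memLp_mul_comp hTc hθc hT0 hθ hT' f₀ g₀).toLp _)) := by
  rw [tendsto_iff_norm_sub_tendsto_zero]
  refine squeeze_zero (g := fun k => B ^ 2 * (‖f k - f₀‖ + ‖g k - g₀‖))
    (fun _ => norm_nonneg _) (fun k => ?_) ?_
  · have h1 : ‖|f k - f₀| + |g k - g₀|‖ ≤ ‖f k - f₀‖ + ‖g k - g₀‖ := by
      refine (norm_add_le _ _).trans ?_
      rw [norm_abs_eq_norm, norm_abs_eq_norm]
    refine le_trans (Lp.norm_le_mul_norm_of_ae_le_mul (g := |f k - f₀| + |g k - g₀|) ?_)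
      (mul_le_mul_of_nonneg_left h1 (sq_nonneg B))
    filter_upwards [Lp.coeFn_sub ((memLp_mul_comp hTc hθc hT0 hθ hT' (f k) (g k)).toLp _)
      ((memLp_mul_comp hTc hθc hT0 hθ hT' f₀ g₀).toLp _),
      (memLp_mul_comp hTc hθc hT0 hθ hT' (f k) (g k)).coeFn_toLp,
      (memLp_mul_comp hTc hθc hT0 hθ hT' f₀ g₀).coeFn_toLp,
      Lp.coeFn_add |f k - f₀| |g k - g₀|, Lp.coeFn_abs (f k - f₀), Lp.coeFn_abs (g k - g₀),
      Lp.coeFn_sub (f k) f₀, Lp.coeFn_sub (g k) g₀] with x e1 e2 e3 e4 e5 e6 e7 e8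
    rw [e1, e4, Pi.sub_apply, Pi.add_apply, e2, e3, e5, e6, e7, e8, Pi.sub_apply, Pi.sub_apply,
      Real.norm_eq_abs, Real.norm_eq_abs, abs_of_nonneg (a := |_| + |_|) (by positivity)]
    exact abs_mul_sub_mul_le hT hθ hT' hθ' _ _ _ _
  · have h1 := tendsto_iff_norm_sub_tendsto_zero.1 hf
    have h2 := tendsto_iff_norm_sub_tendsto_zero.1 hg
    simpa using (h1.add h2).const_mul (B ^ 2)

end Superposition

/-! ### The graph of the trace -/

section Trace

variable {n : ℕ} {Ω : Set (Euc (n + 1))}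

lemma memLp_restrict_of_isTest {m : ℕ} {U : Set (Euc m)} {φ : Euc m → ℝ} (hφ : IsTest univ φ) :
    MemLp φ 2 (volume.restrict U) :=
  (hφ.1.continuous.memLp_of_hasCompactSupport hφ.2.1).restrict U

lemma continuous_gradient {m : ℕ} {φ : Euc m → ℝ} (hφ : ContDiff ℝ ∞ φ) :
    Continuous (gradient φ) :=
  (InnerProductSpace.toDual ℝ (Euc m)).symm.continuous.comp (hφ.continuous_fderiv (by simp))

lemma memLp_gradient_of_isTest {m : ℕ} {U : Set (Euc m)} {φ : Euc m → ℝ} (hφ : IsTest univ φ) :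
    MemLp (gradient φ) 2 (volume.restrict U) := by
  refine ((continuous_gradient hφ.1).memLp_of_hasCompactSupport ?_).restrict U
  exact (hφ.2.1.fderiv ℝ).comp_left (g := (InnerProductSpace.toDual ℝ (Euc m)).symm) (map_zero _)

lemma inner_gradient {m : ℕ} (φ : Euc m → ℝ) (x e : Euc m) :
    ⟪gradient φ x, e⟫ = fderiv ℝ φ x e := by
  rw [gradient, InnerProductSpace.toDual_symm_apply]

lemma IsTest.mono {m : ℕ} {U V : Set (Euc m)} (h : U ⊆ V) {φ : Euc m → ℝ} (hφ : IsTest U φ) :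
    IsTest V φ := ⟨hφ.1, hφ.2.1, hφ.2.2.trans h⟩

/-- The closure of the triples `(φ|_Ω, ∇φ|_Ω, φ|_∂Ω)`, i.e. the triples `(w, ∇w, γ(w))`. -/
def traceGraph (Ω : Set (Euc (n + 1))) : Submodule ℝ (L2 Ω × L2V Ω × L2Bd Ω) :=
  Submodule.topologicalClosure
    { carrier := smoothTriples Ω
      zero_mem' := by
        refine ⟨0, ⟨contDiff_const, HasCompactSupport.zero, subset_univ _⟩, ?_, ?_, ?_⟩
        · exact Lp.coeFn_zero _ _ _
        · have : gradient (0 : Euc (n + 1) → ℝ) = 0 := by ext x; simp [gradient]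
          rw [this]; exact Lp.coeFn_zero _ _ _
        · exact Lp.coeFn_zero _ _ _
      add_mem' := by
        rintro p q ⟨φ, hφ, h1, h2, h3⟩ ⟨ψ, hψ, k1, k2, k3⟩
        refine ⟨φ + ψ, ⟨hφ.1.add hψ.1, hφ.2.1.add hψ.2.1, subset_univ _⟩, ?_, ?_, ?_⟩
        · exact (Lp.coeFn_add _ _).trans (h1.add k1)
        · have : gradient (φ + ψ) = gradient φ + gradient ψ := by
            ext1 x
            simp only [gradient, Pi.add_apply]
            rw [fderiv_add (hφ.1.differentiable (by simp) x) (hψ.1.differentiable (by simp) x),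
              map_add]
          rw [this]; exact (Lp.coeFn_add _ _).trans (h2.add k2)
        · exact (Lp.coeFn_add _ _).trans (h3.add k3)
      smul_mem' := by
        rintro c p ⟨φ, hφ, h1, h2, h3⟩
        refine ⟨c • φ, ⟨contDiff_const.smul hφ.1, hφ.2.1.smul_left (f := fun _ => c),
          subset_univ _⟩, ?_, ?_, ?_⟩
        · exact (Lp.coeFn_smul _ _).trans (h1.const_smul c)
        · have : gradient (c • φ) = c • gradient φ := by
            ext1 x
            simp only [gradient, Pi.smul_apply]
            rw [fderiv_const_smul (hφ.1.differentiable (by simp) x)]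
            simp
          rw [this]; exact (Lp.coeFn_smul _ _).trans (h2.const_smul c)
        · exact (Lp.coeFn_smul _ _).trans (h3.const_smul c) }

lemma isTrace_iff {w : H1 Ω} {t : L2Bd Ω} : IsTrace w t ↔ (w.fn, w.grad, t) ∈ traceGraph Ω :=
  Iff.rfl

lemma isWeakGrad_of_isTest {m : ℕ} {U : Set (Euc m)} {ψ : Euc m → ℝ} (hψ : IsTest univ ψ) :
    IsWeakGrad U ψ (gradient ψ) := by
  intro φ hφ e
  have h0 : ∀ x, x ∉ U → φ x = 0 := fun x hx => image_eq_zero_of_notMem_tsupport fun h => hx (hφ.2.2 h)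
  have h0' : ∀ x, x ∉ U → fderiv ℝ φ x e = 0 := fun x hx => by
    rw [fderiv_of_notMem_tsupport (𝕜 := ℝ) fun h => hx (hφ.2.2 h)]; rfl
  rw [setIntegral_eq_integral_of_forall_compl_eq_zero fun x hx => by rw [h0' x hx, mul_zero],
    setIntegral_eq_integral_of_forall_compl_eq_zero fun x hx => by rw [h0 x hx, mul_zero]]
  simp only [inner_gradient]
  have hcφ := hφ.1.continuous
  have hcψ := hψ.1.continuous
  have hcφ' : Continuous fun x => fderiv ℝ φ x e :=
    (hφ.1.continuous_fderiv (by simp)).clm_apply continuous_const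
  have hcψ' : Continuous fun x => fderiv ℝ ψ x e :=
    (hψ.1.continuous_fderiv (by simp)).clm_apply continuous_const
  refine integral_mul_fderiv_eq_neg_fderiv_mul_of_integrable ?_ ?_ ?_
    (fun x _ => hψ.1.differentiable (by simp) x) (fun x _ => hφ.1.differentiable (by simp) x)
  · exact (hcψ'.mul hcφ).integrable_of_hasCompactSupport hφ.2.1.mul_left
  · exact (hcψ.mul hcφ').integrable_of_hasCompactSupport hψ.2.1.mul_right
  · exact (hcψ.mul hcφ).integrable_of_hasCompactSupport hφ.2.1.mul_left

/-- The weak gradient identity holds for smooth functions and, for each test function, is a closed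
condition in `L²`. Every element of `traceGraph Ω` therefore gives a function of `H¹(Ω)`, which
makes the graph a source of competitors. -/
lemma isWeakGrad_of_mem_traceGraph {p : L2 Ω × L2V Ω × L2Bd Ω} (hp : p ∈ traceGraph Ω) :
    IsWeakGrad Ω p.1 p.2.1 := by
  intro φ hφ e
  have hφ' := hφ.mono (subset_univ Ω)
  have hd : MemLp (fun x => fderiv ℝ φ x e) 2 (volume.restrict Ω) := by
    have := (memLp_gradient_of_isTest (U := Ω) hφ').inner_const e (𝕜 := ℝ)
    simpa only [inner_gradient] using this
  have hv : MemLp (fun x => φ x • e) 2 (volume.restrict Ω) := by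
    refine (memLp_restrict_of_isTest (U := Ω) hφ').of_le_mul (c := ‖e‖) ?_ (Eventually.of_forall fun x => ?_)
    · exact (hφ.1.continuous.smul continuous_const).aestronglyMeasurable
    · rw [norm_smul, mul_comm]
  have hL : ∀ q : L2 Ω × L2V Ω × L2Bd Ω,
      (∫ x in Ω, q.1 x * fderiv ℝ φ x e) = ⟪hd.toLp _, q.1⟫ := by
    intro q
    rw [L2.inner_def]
    refine integral_congr_ae ?_
    filter_upwards [hd.coeFn_toLp] with x hx
    rw [hx]; simp
  have hR : ∀ q : L2 Ω × L2V Ω × L2Bd Ω,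
      (∫ x in Ω, ⟪q.2.1 x, e⟫ * φ x) = ⟪hv.toLp _, q.2.1⟫ := by
    intro q
    rw [L2.inner_def]
    refine integral_congr_ae ?_
    filter_upwards [hv.coeFn_toLp] with x hx
    rw [hx, real_inner_smul_left, real_inner_comm, mul_comm]
  have hclosed : IsClosed {q : L2 Ω × L2V Ω × L2Bd Ω |
      (∫ x in Ω, q.1 x * fderiv ℝ φ x e) = - ∫ x in Ω, ⟪q.2.1 x, e⟫ * φ x} := by
    simp only [hL, hR]
    exact isClosed_eq (by fun_prop) (by fun_prop)
  refine closure_minimal (s := smoothTriples Ω) ?_ hclosed hp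
  rintro q ⟨ψ, hψ, h1, h2, -⟩
  have := isWeakGrad_of_isTest (U := Ω) hψ φ hφ e
  change (∫ x in Ω, q.1 x * fderiv ℝ φ x e) = - ∫ x in Ω, ⟪q.2.1 x, e⟫ * φ x
  have i1 : ∫ x in Ω, q.1 x * fderiv ℝ φ x e = ∫ x in Ω, ψ x * fderiv ℝ φ x e :=
    integral_congr_ae (h1.mono fun x hx => by simp only [hx])
  have i2 : ∫ x in Ω, ⟪q.2.1 x, e⟫ * φ x = ∫ x in Ω, ⟪gradient ψ x, e⟫ * φ x :=
    integral_congr_ae (h2.mono fun x hx => by simp only [hx])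
  rw [i1, i2, this]

/-- The function of `H¹(Ω)` given by a triple `(w, ∇w, γ(w))`. -/
def H1.ofTraceGraph (p : L2 Ω × L2V Ω × L2Bd Ω) (hp : p ∈ traceGraph Ω) : H1 Ω :=
  ⟨p.1, p.2.1, isWeakGrad_of_mem_traceGraph hp⟩

lemma isTrace_ofTraceGraph (p : L2 Ω × L2V Ω × L2Bd Ω) (hp : p ∈ traceGraph Ω) :
    IsTrace (H1.ofTraceGraph p hp) p.2.2 := hp

lemma test_mem_traceGraph (hΩ : IsOpen Ω) {φ : Euc (n + 1) → ℝ} (hφ : IsTest Ω φ) :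
    ((memLp_restrict_of_isTest (U := Ω) (hφ.mono (subset_univ _))).toLp φ,
      (memLp_gradient_of_isTest (U := Ω) (hφ.mono (subset_univ _))).toLp (gradient φ), 0) ∈
      traceGraph Ω := by
  refine Submodule.le_topologicalClosure _ ⟨φ, hφ.mono (subset_univ _),
    (memLp_restrict_of_isTest (hφ.mono (subset_univ _))).coeFn_toLp,
    (memLp_gradient_of_isTest (hφ.mono (subset_univ _))).coeFn_toLp, ?_⟩
  refine (Lp.coeFn_zero _ _ _).trans ?_
  rw [surf]
  filter_upwards [ae_restrict_mem isClosed_frontier.measurableSet] with x hx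
  rw [hΩ.frontier_eq] at hx
  exact (image_eq_zero_of_notMem_tsupport fun h => hx.2 (hφ.2.2 h)).symm

lemma abs_sub_le_of_abs_deriv_le {T : ℝ → ℝ} {B : ℝ} (hT : Differentiable ℝ T)
    (h : ∀ x, |deriv T x| ≤ B) (x y : ℝ) : |T x - T y| ≤ B * |x - y| :=
  convex_univ.norm_image_sub_le_of_norm_deriv_le (fun z _ => hT z) (fun z _ => h z)
    (mem_univ y) (mem_univ x)

lemma gradient_mul_comp {m : ℕ} {T θ : ℝ → ℝ} {φ ψ : Euc m → ℝ} {x : Euc m}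
    (hT : Differentiable ℝ T) (hθ : Differentiable ℝ θ) (hφ : DifferentiableAt ℝ φ x)
    (hψ : DifferentiableAt ℝ ψ x) :
    gradient (fun x => T (φ x) * θ (ψ x)) x =
      (deriv T (φ x) * θ (ψ x)) • gradient φ x + (T (φ x) * deriv θ (ψ x)) • gradient ψ x := by
  have h1 : HasFDerivAt (fun x => T (φ x)) (deriv T (φ x) • fderiv ℝ φ x) x :=
    (hT (φ x)).hasDerivAt.comp_hasFDerivAt x hφ.hasFDerivAt
  have h2 : HasFDerivAt (fun x => θ (ψ x)) (deriv θ (ψ x) • fderiv ℝ ψ x) x :=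
    (hθ (ψ x)).hasDerivAt.comp_hasFDerivAt x hψ.hasFDerivAt
  have h3 : HasFDerivAt (fun x => T (φ x) * θ (ψ x)) _ x := h1.mul h2
  simp only [gradient]
  rw [h3.fderiv]
  simp only [map_add, smul_smul, map_smul]
  rw [add_comm, mul_comm (θ (ψ x))]

/-- The trace of `T(w₁) θ(w₂)` is `T(γ(w₁)) θ(γ(w₂))`. -/
theorem exists_isTrace_mul_comp {w₁ w₂ : H1 Ω} {t₁ t₂ : L2Bd Ω} (h₁ : IsTrace w₁ t₁)
    (h₂ : IsTrace w₂ t₂) {T θ : ℝ → ℝ} {B : ℝ} (hT : ContDiff ℝ ∞ T) (hθ : ContDiff ℝ ∞ θ)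
    (hT0 : T 0 = 0) (hTB : ∀ x, |T x| ≤ B) (hθB : ∀ x, |θ x| ≤ B)
    (hTB' : ∀ x, |deriv T x| ≤ B) (hθB' : ∀ x, |deriv θ x| ≤ B) :
    ∃ (w : H1 Ω) (s : L2Bd Ω), IsTrace w s ∧ s =ᵐ[surf Ω] fun x => T (t₁ x) * θ (t₂ x) := by
  have hB0 : 0 ≤ B := (abs_nonneg _).trans (hTB 0)
  have hTd := hT.differentiable (by simp)
  have hθd := hθ.differentiable (by simp)
  have hTL := abs_sub_le_of_abs_deriv_le hTd hTB'
  have hθL := abs_sub_le_of_abs_deriv_le hθd hθB'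
  have hTc := hT.continuous
  have hθc := hθ.continuous
  have hTc' : Continuous (deriv T) := hT.continuous_deriv (by simp)
  have hθc' : Continuous (deriv θ) := hθ.continuous_deriv (by simp)
  obtain ⟨p, hp, hp'⟩ := mem_closure_iff_seq_limit.1 h₁
  obtain ⟨q, hq, hq'⟩ := mem_closure_iff_seq_limit.1 h₂
  -- The gradient of `T(φ) θ(ψ)` involves `T'` and `θ'`, for which no Lipschitz bound is assumed;
  -- its limit is taken along an almost everywhere convergent subsequence.
  obtain ⟨ns, hns, hae₁, hae₂⟩ := exists_subseq_ae_tendsto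
    ((continuous_fst.tendsto _).comp hp') ((continuous_fst.tendsto _).comp hq')
  have hpn := hp'.comp hns.tendsto_atTop
  have hqn := hq'.comp hns.tendsto_atTop
  let A₁ : ℝ × ℝ → ℝ := fun z => deriv T z.1 * θ z.2
  let A₂ : ℝ × ℝ → ℝ := fun z => T z.1 * deriv θ z.2
  have hA₁ : Continuous A₁ := by fun_prop
  have hA₂ : Continuous A₂ := by fun_prop
  have hA₁B : ∀ z, |A₁ z| ≤ B * B := fun z => by
    simp only [A₁, abs_mul]; gcongr; exacts [hTB' _, hθB _]
  have hA₂B : ∀ z, |A₂ z| ≤ B * B := fun z => by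
    simp only [A₂, abs_mul]; gcongr; exacts [hTB _, hθB' _]
  let P : (L2 Ω × L2V Ω × L2Bd Ω) → (L2 Ω × L2V Ω × L2Bd Ω) → (L2 Ω × L2V Ω × L2Bd Ω) :=
    fun p q => ((memLp_mul_comp hTc hθc hT0 hθB hTL p.1 q.1).toLp _,
      compSMul hA₁ hA₁B p.1 q.1 p.2.1 + compSMul hA₂ hA₂B p.1 q.1 q.2.1,
      (memLp_mul_comp hTc hθc hT0 hθB hTL p.2.2 q.2.2).toLp _)
  have hlim : Tendsto (fun k => P (p (ns k)) (q (ns k))) atTop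
      (𝓝 (P (w₁.fn, w₁.grad, t₁) (w₂.fn, w₂.grad, t₂))) := by
    refine Tendsto.prodMk_nhds ?_ (Tendsto.prodMk_nhds ?_ ?_)
    · exact tendsto_mul_comp hTc hθc hT0 hTB hθB hTL hθL ((continuous_fst.tendsto _).comp hpn)
        ((continuous_fst.tendsto _).comp hqn)
    · exact (tendsto_compSMul hA₁ hA₁B hae₁ hae₂
        (((continuous_fst.comp continuous_snd).tendsto _).comp hpn)).add
        (tendsto_compSMul hA₂ hA₂B hae₁ hae₂
        (((continuous_fst.comp continuous_snd).tendsto _).comp hqn))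
    · exact tendsto_mul_comp hTc hθc hT0 hTB hθB hTL hθL
        (((continuous_snd.comp continuous_snd).tendsto _).comp hpn)
        (((continuous_snd.comp continuous_snd).tendsto _).comp hqn)
  have hmem : P (w₁.fn, w₁.grad, t₁) (w₂.fn, w₂.grad, t₂) ∈ traceGraph Ω := by
    refine mem_closure_of_tendsto hlim (Eventually.of_forall fun k => ?_)
    obtain ⟨φ, hφ, e1, e2, e3⟩ := hp (ns k)
    obtain ⟨ψ, hψ, k1, k2, k3⟩ := hq (ns k)
    refine ⟨fun x => T (φ x) * θ (ψ x), ⟨(hT.comp hφ.1).mul (hθ.comp hψ.1), ?_, subset_univ _⟩,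
      ?_, ?_, ?_⟩
    · exact (hφ.2.1.comp_left (g := T) hT0).mul_right
    · refine (memLp_mul_comp hTc hθc hT0 hθB hTL (p (ns k)).1 (q (ns k)).1).coeFn_toLp.trans ?_
      filter_upwards [e1, k1] with x hx hx'
      rw [hx, hx']
    · refine (Lp.coeFn_add _ _).trans ?_
      filter_upwards [e1, k1, e2, k2, coeFn_compSMul hA₁ hA₁B (p (ns k)).1 (q (ns k)).1 (p (ns k)).2.1,
        coeFn_compSMul hA₂ hA₂B (p (ns k)).1 (q (ns k)).1 (q (ns k)).2.1] with x a1 a2 a3 a4 a5 a6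
      rw [Pi.add_apply, a5, a6, a1, a2, a3, a4, gradient_mul_comp hTd hθd
        (hφ.1.differentiable (by simp) x) (hψ.1.differentiable (by simp) x)]
    · refine (memLp_mul_comp hTc hθc hT0 hθB hTL (p (ns k)).2.2 (q (ns k)).2.2).coeFn_toLp.trans ?_
      filter_upwards [e3, k3] with x hx hx'
      rw [hx, hx']
  exact ⟨H1.ofTraceGraph _ hmem, _, isTrace_ofTraceGraph _ hmem,
    (memLp_mul_comp hTc hθc hT0 hθB hTL t₁ t₂).coeFn_toLp⟩

end Trace


/-! ### The diffusion tensor -/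

section Diffusion

variable {m : ℕ} {Ω : Set (Euc m)} {Λ : Euc m → Matrix (Fin m) (Fin m) ℝ}

lemma inner_toEuclideanLin (A : Matrix (Fin m) (Fin m) ℝ) (v w : Euc m) :
    ⟪Matrix.toEuclideanLin A v, w⟫ = w.ofLp ⬝ᵥ (A.mulVec v.ofLp) := by
  simp [EuclideanSpace.inner_eq_star_dotProduct, Matrix.toLpLin_apply]

lemma inner_nonneg_of_spectrum_nonneg {A : Matrix (Fin m) (Fin m) ℝ} (hA : A.IsSymm)
    (h : ∀ x ∈ spectrum ℝ A, 0 ≤ x) (v : Euc m) : 0 ≤ ⟪Matrix.toEuclideanLin A v, v⟫ := by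
  have hps : A.PosSemidef := Matrix.posSemidef_iff_isHermitian_and_spectrum_nonneg.2
    ⟨by rw [Matrix.IsHermitian, Matrix.conjTranspose_eq_transpose_of_trivial]; exact hA, h⟩
  rw [inner_toEuclideanLin]
  simpa using hps.dotProduct_mulVec_nonneg v.ofLp

lemma bounds_of_spectrum_subset {A : Matrix (Fin m) (Fin m) ℝ} (hA : A.IsSymm) {lo hi : ℝ}
    (hhi : 0 < hi) (hlo : 0 < lo) (h : spectrum ℝ A ⊆ Icc lo hi) (v : Euc m) :
    lo * ‖v‖ ^ 2 ≤ ⟪Matrix.toEuclideanLin A v, v⟫ ∧ ‖Matrix.toEuclideanLin A v‖ ≤ hi * ‖v‖ := by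
  have hone : ∀ (c : ℝ) (v : Euc m), Matrix.toEuclideanLin (algebraMap ℝ _ c) v = c • v := by
    intro c v
    ext i
    simp [Matrix.toLpLin_apply, Matrix.algebraMap_eq_diagonal, Matrix.mulVec_diagonal]
  have hsym : ∀ c : ℝ, (algebraMap ℝ (Matrix (Fin m) (Fin m) ℝ) c).IsSymm := fun c => by
    rw [Matrix.algebraMap_eq_diagonal]; exact Matrix.isSymm_diagonal _
  have h1 : ∀ v : Euc m, lo * ‖v‖ ^ 2 ≤ ⟪Matrix.toEuclideanLin A v, v⟫ := by
    intro v
    have := inner_nonneg_of_spectrum_nonneg (A := A - algebraMap ℝ _ lo) (hA.sub (hsym lo)) ?_ v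
    · rw [map_sub, LinearMap.sub_apply, hone, inner_sub_left, real_inner_smul_left,
        real_inner_self_eq_norm_sq] at this
      linarith
    · intro x hx
      rw [← spectrum.sub_singleton_eq, Set.mem_sub] at hx
      obtain ⟨y, hy, z, hz, rfl⟩ := hx
      rw [mem_singleton_iff.1 hz]
      linarith [(h hy).1]
  have h2 : ∀ v : Euc m, ⟪Matrix.toEuclideanLin A v, v⟫ ≤ hi * ‖v‖ ^ 2 := by
    intro v
    have := inner_nonneg_of_spectrum_nonneg (A := algebraMap ℝ _ hi - A) ((hsym hi).sub hA) ?_ v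
    · rw [map_sub, LinearMap.sub_apply, hone, inner_sub_left, real_inner_smul_left,
        real_inner_self_eq_norm_sq] at this
      linarith
    · intro x hx
      rw [← spectrum.singleton_sub_eq, Set.mem_sub] at hx
      obtain ⟨z, hz, y, hy, rfl⟩ := hx
      rw [mem_singleton_iff.1 hz]
      linarith [(h hy).2]
  refine ⟨h1 v, ?_⟩
  have hsa : ∀ v w : Euc m, ⟪Matrix.toEuclideanLin A v, w⟫ = ⟪Matrix.toEuclideanLin A w, v⟫ := by
    intro v w
    rw [inner_toEuclideanLin, inner_toEuclideanLin, Matrix.dotProduct_mulVec,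
      ← Matrix.mulVec_transpose, hA.eq, dotProduct_comm]
  set w := Matrix.toEuclideanLin A v with hw
  -- With `w = A v`, positivity at `hi v - w` reads `hi² ⟪A v, v⟫ - 2 hi ‖w‖² + ⟪A w, w⟫ ≥ 0`.
  -- Bounding both forms from above by `hi` leaves `‖w‖² ≤ hi² ‖v‖²`.
  have hp : 0 ≤ ⟪Matrix.toEuclideanLin A (hi • v - w), hi • v - w⟫ :=
    (mul_nonneg hlo.le (sq_nonneg _)).trans (h1 _)
  have hvw : ⟪Matrix.toEuclideanLin A w, v⟫ = ‖w‖ ^ 2 := by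
    rw [← hsa, ← hw, real_inner_self_eq_norm_sq]
  simp only [map_sub, map_smul, inner_sub_left, inner_sub_right, real_inner_smul_left,
    real_inner_smul_right, ← hw, hvw, real_inner_self_eq_norm_sq] at hp
  have hq1 := h2 v
  have hq2 := h2 w
  rw [← hw] at hq1
  have hsq : ‖w‖ ^ 2 ≤ (hi * ‖v‖) ^ 2 := by
    have : hi * ‖w‖ ^ 2 ≤ hi * (hi * ‖v‖) ^ 2 := by
      have := mul_le_mul_of_nonneg_left hq1 (sq_nonneg hi)
      nlinarith
    exact le_of_mul_le_mul_left this hhi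
  exact abs_le_of_sq_le_sq' hsq (by positivity) |>.2

lemma IsDiffusionTensor.exists_bounds (h : IsDiffusionTensor Ω Λ) : ∃ lo hi : ℝ, 0 < lo ∧ 0 < hi ∧
    ∀ᵐ x ∂(volume.restrict Ω), ∀ v : Euc m,
      lo * ‖v‖ ^ 2 ≤ ⟪Matrix.toEuclideanLin (Λ x) v, v⟫ ∧
        ‖Matrix.toEuclideanLin (Λ x) v‖ ≤ hi * ‖v‖ := by
  obtain ⟨-, lo, hi, hlo, hhi, hae⟩ := h
  refine ⟨lo, hi, hlo, hhi, ?_⟩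
  filter_upwards [hae] with x hx v
  exact bounds_of_spectrum_subset hx.1 hhi hlo hx.2 v

lemma IsDiffusionTensor.aestronglyMeasurable_flux (h : IsDiffusionTensor Ω Λ) (G : L2V Ω) :
    AEStronglyMeasurable (flux Λ G) (volume.restrict Ω) := by
  have hG : ∀ j, AEMeasurable (fun x => G x j) (volume.restrict Ω) := fun j =>
    ((EuclideanSpace.proj (𝕜 := ℝ) j).continuous.comp_aestronglyMeasurable
      (Lp.aestronglyMeasurable G)).aemeasurable
  have h1 : AEMeasurable (fun x => (Λ x).mulVec (G x).ofLp) (volume.restrict Ω) := by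
    refine aemeasurable_pi_lambda _ fun i => ?_
    simp only [Matrix.mulVec, dotProduct]
    exact Finset.aemeasurable_fun_sum _ fun j _ => (h.1 i j).mul (hG j)
  exact ((PiLp.continuous_toLp 2 _).measurable.comp_aemeasurable h1).aestronglyMeasurable

lemma IsDiffusionTensor.memLp_flux (h : IsDiffusionTensor Ω Λ) (G : L2V Ω) :
    MemLp (flux Λ G) 2 (volume.restrict Ω) := by
  obtain ⟨lo, hi, -, -, hae⟩ := h.exists_bounds
  refine (Lp.memLp G).of_le_mul (c := hi) (h.aestronglyMeasurable_flux G) ?_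
  filter_upwards [hae] with x hx using (hx _).2

/-- The operator `G ↦ Λ G` of `L²(Ω)^m`. -/
def fluxLp (h : IsDiffusionTensor Ω Λ) (G : L2V Ω) : L2V Ω := (h.memLp_flux G).toLp _

lemma coeFn_fluxLp (h : IsDiffusionTensor Ω Λ) (G : L2V Ω) :
    fluxLp h G =ᵐ[volume.restrict Ω] flux Λ G := (h.memLp_flux G).coeFn_toLp

lemma fluxLp_sub (h : IsDiffusionTensor Ω Λ) (G H : L2V Ω) :
    fluxLp h (G - H) = fluxLp h G - fluxLp h H := by
  refine Lp.ext ?_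
  filter_upwards [coeFn_fluxLp h (G - H), coeFn_fluxLp h G, coeFn_fluxLp h H,
    Lp.coeFn_sub G H, Lp.coeFn_sub (fluxLp h G) (fluxLp h H)] with x e1 e2 e3 e4 e5
  rw [e1, e5, Pi.sub_apply, e2, e3]
  simp only [flux]
  rw [e4, Pi.sub_apply, map_sub]

lemma integral_flux_inner (h : IsDiffusionTensor Ω Λ) (G H : L2V Ω) :
    ∫ x in Ω, ⟪flux Λ G x, H x⟫ = ⟪fluxLp h G, H⟫ := by
  rw [L2.inner_def]
  refine integral_congr_ae ?_
  filter_upwards [coeFn_fluxLp h G] with x hx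
  rw [hx]

lemma exists_fluxLp_bounds (h : IsDiffusionTensor Ω Λ) : ∃ lo hi : ℝ, 0 < lo ∧ 0 < hi ∧
    ∀ G : L2V Ω, lo * ‖G‖ ^ 2 ≤ ⟪fluxLp h G, G⟫ ∧ ‖fluxLp h G‖ ≤ hi * ‖G‖ := by
  obtain ⟨lo, hi, hlo, hhi, hae⟩ := h.exists_bounds
  refine ⟨lo, hi, hlo, hhi, fun G => ⟨?_, ?_⟩⟩
  · rw [L2_norm_sq_eq_integral, ← integral_const_mul, L2.inner_def]
    refine integral_mono_ae (((Lp.memLp G).integrable_norm_pow (by norm_num)).const_mul _)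
      (L2.integrable_inner (𝕜 := ℝ) (fluxLp h G) G) ?_
    filter_upwards [hae, coeFn_fluxLp h G] with x hx hx'
    rw [hx']; exact (hx _).1
  · refine Lp.norm_le_mul_norm_of_ae_le_mul ?_
    filter_upwards [hae, coeFn_fluxLp h G] with x hx hx'
    rw [hx']; exact (hx _).2

end Diffusion

/-! ### The Signorini problem -/

section Problem

variable {n : ℕ} {Ω : Set (Euc (n + 1))}
  {Λ : Euc (n + 1) → Matrix (Fin (n + 1)) (Fin (n + 1)) ℝ}

lemma integral_mul_eq_inner {α : Type*} [MeasurableSpace α] {μ : Measure α} (f g : Lp ℝ 2 μ) :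
    ∫ x, f x * g x ∂μ = ⟪f, g⟫ := by
  rw [L2.inner_def]
  exact integral_congr_ae (Eventually.of_forall fun x => by simp [mul_comm])

lemma IsSignoriniSolution.inner_le (hΛ : IsDiffusionTensor Ω Λ) {f : L2 Ω}
    {Γ₁ Γ₃ : Set (Euc (n + 1))} {a : ℝ} {u : H1 Ω} {t : L2Bd Ω}
    (h : IsSignoriniSolution Λ f Γ₁ Γ₃ a u t) {v : H1 Ω} {s : L2Bd Ω} (hv : MemK Γ₁ Γ₃ a v s) :
    ⟪fluxLp hΛ u.grad, u.grad - v.grad⟫ ≤ ⟪f, u.fn - v.fn⟫ := by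
  have := h.2 v s hv
  rw [← integral_flux_inner, ← integral_mul_eq_inner]
  refine le_of_eq_of_le ?_ (this.trans_eq ?_)
  · refine integral_congr_ae ?_
    filter_upwards [Lp.coeFn_sub u.grad v.grad] with x hx
    rw [hx, Pi.sub_apply]
  · refine integral_congr_ae ?_
    filter_upwards [Lp.coeFn_sub u.fn v.fn] with x hx
    rw [hx, Pi.sub_apply]

/-- Admissible variations of the trace. -/
lemma IsSignoriniSolution.inner_eq_of_admissible (hΛ : IsDiffusionTensor Ω Λ) {f : L2 Ω}
    {Γ₁ Γ₃ : Set (Euc (n + 1))} {a : ℝ} {u : H1 Ω} {t : L2Bd Ω}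
    (h : IsSignoriniSolution Λ f Γ₁ Γ₃ a u t) {p : L2 Ω × L2V Ω × L2Bd Ω} (hp : p ∈ traceGraph Ω)
    (h₁ : ∀ᵐ x ∂(surf Ω).restrict Γ₁, p.2.2 x = 0)
    (h₃ : ∀ᵐ x ∂(surf Ω).restrict Γ₃, t x + |p.2.2 x| ≤ a) :
    ⟪fluxLp hΛ u.grad, p.2.1⟫ = ⟪f, p.1⟫ := by
  -- Both `ū - p` and `ū + p` are admissible, so the variational inequality holds with either sign.
  have key : ∀ c : ℝ, |c| = 1 → c * ⟪fluxLp hΛ u.grad, p.2.1⟫ ≤ c * ⟪f, p.1⟫ := by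
    intro c hc
    have hmem := (traceGraph Ω).sub_mem (isTrace_iff.1 h.1.1) ((traceGraph Ω).smul_mem c hp)
    have hK : MemK Γ₁ Γ₃ a (H1.ofTraceGraph _ hmem) (t - c • p.2.2) := by
      refine ⟨isTrace_ofTraceGraph _ hmem, ?_, ?_⟩
      · filter_upwards [h.1.2.1, h₁, ae_restrict_of_ae (Lp.coeFn_sub t (c • p.2.2)),
          ae_restrict_of_ae (Lp.coeFn_smul c p.2.2)] with x e1 e2 e3 e4
        rw [e3, Pi.sub_apply, e4, Pi.smul_apply, e1, e2]; simp
      · filter_upwards [h₃, ae_restrict_of_ae (Lp.coeFn_sub t (c • p.2.2)),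
          ae_restrict_of_ae (Lp.coeFn_smul c p.2.2)] with x e2 e3 e4
        rw [e3, Pi.sub_apply, e4, Pi.smul_apply, smul_eq_mul]
        have : |c * p.2.2 x| = |p.2.2 x| := by rw [abs_mul, hc, one_mul]
        linarith [neg_le_abs (c * p.2.2 x)]
    have := h.inner_le hΛ hK
    have e1 : u.grad - (H1.ofTraceGraph _ hmem).grad = c • p.2.1 := by
      change u.grad - (u.grad - c • p.2.1) = _
      rw [sub_sub_cancel]
    have e2 : u.fn - (H1.ofTraceGraph _ hmem).fn = c • p.1 := by
      change u.fn - (u.fn - c • p.1) = _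
      rw [sub_sub_cancel]
    rwa [e1, e2, inner_smul_right, inner_smul_right] at this
  have k1 := key 1 (by simp)
  have k2 := key (-1) (by simp)
  linarith

lemma IsSignoriniSolution.inner_eq_of_trace_zero (hΛ : IsDiffusionTensor Ω Λ) {f : L2 Ω}
    {Γ₁ Γ₃ : Set (Euc (n + 1))} {a : ℝ} {u : H1 Ω} {t : L2Bd Ω}
    (h : IsSignoriniSolution Λ f Γ₁ Γ₃ a u t) {p : L2 Ω × L2V Ω × L2Bd Ω} (hp : p ∈ traceGraph Ω)
    (h₀ : p.2.2 = 0) : ⟪fluxLp hΛ u.grad, p.2.1⟫ = ⟪f, p.1⟫ := by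
  have hz : ∀ᵐ x ∂surf Ω, p.2.2 x = 0 := by rw [h₀]; exact Lp.coeFn_zero _ _ _
  refine h.inner_eq_of_admissible hΛ hp (ae_restrict_of_ae hz) ?_
  filter_upwards [h.1.2.2, ae_restrict_of_ae hz] with x e1 e2
  rw [e2, abs_zero, add_zero]; exact e1

/-- `weakDiv` is a choice; uniqueness is what permits replacing it by an explicit divergence. -/
lemma ae_eq_of_isWeakDiv {m : ℕ} {U : Set (Euc m)} (hU : IsOpen U) {ψ : Euc m → Euc m}
    {δ δ' : L2 U} (h : IsWeakDiv U ψ δ) (h' : IsWeakDiv U ψ δ') : δ = δ' := by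
  rw [← sub_eq_zero]
  refine Lp.eq_zero_iff_ae_eq_zero.2 ?_
  have hloc : LocallyIntegrableOn (δ - δ' : L2 U) U volume :=
    locallyIntegrableOn_of_locallyIntegrable_restrict
      ((Lp.memLp (δ - δ')).locallyIntegrable one_le_two)
  have hae := hU.ae_eq_zero_of_integral_contDiff_smul_eq_zero hloc fun φ h1 h2 h3 => by
    have hφ : IsTest U φ := ⟨h1, h2, h3⟩
    have hφL := memLp_restrict_of_isTest (U := U) (hφ.mono (subset_univ _))
    have e1 := h φ hφ
    have e2 := h' φ hφ
    rw [e1, neg_inj] at e2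
    have h0 : ∀ x, x ∉ U → φ x • (δ - δ' : L2 U) x = 0 := fun x hx => by
      rw [image_eq_zero_of_notMem_tsupport fun h => hx (h3 h), zero_smul]
    rw [← setIntegral_eq_integral_of_forall_compl_eq_zero h0]
    have i1 : Integrable (fun x => δ x * φ x) (volume.restrict U) := (Lp.memLp δ).integrable_mul hφL
    have i2 : Integrable (fun x => δ' x * φ x) (volume.restrict U) :=
      (Lp.memLp δ').integrable_mul hφL
    rw [← sub_eq_zero, ← integral_sub i1 i2] at e2
    rw [← e2]
    refine integral_congr_ae ?_
    filter_upwards [Lp.coeFn_sub δ δ'] with x hx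
    rw [hx, Pi.sub_apply, smul_eq_mul]; ring
  exact (ae_restrict_iff' hU.measurableSet).2 hae

/-- `- div(Λ∇ū) = f`. -/
lemma IsSignoriniSolution.weakDiv_eq (hΩ : IsOpen Ω) (hΛ : IsDiffusionTensor Ω Λ) {f : L2 Ω}
    {Γ₁ Γ₃ : Set (Euc (n + 1))} {a : ℝ} {u : H1 Ω} {t : L2Bd Ω}
    (h : IsSignoriniSolution Λ f Γ₁ Γ₃ a u t) : weakDiv Ω (flux Λ u.grad) = -f := by
  have hdiv : IsWeakDiv Ω (flux Λ u.grad) (-f : L2 Ω) := by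
    intro φ hφ
    have hφL := memLp_restrict_of_isTest (U := Ω) (hφ.mono (subset_univ _))
    have hφL' := memLp_gradient_of_isTest (U := Ω) (hφ.mono (subset_univ _))
    have key := h.inner_eq_of_trace_zero hΛ (test_mem_traceGraph hΩ hφ) rfl
    rw [← integral_flux_inner, ← integral_mul_eq_inner] at key
    have e1 : ∫ x in Ω, fderiv ℝ φ x (flux Λ u.grad x) =
        ∫ x in Ω, ⟪flux Λ u.grad x, hφL'.toLp _ x⟫ := by
      refine integral_congr_ae ?_
      filter_upwards [hφL'.coeFn_toLp] with x hx
      rw [hx, real_inner_comm, inner_gradient]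
    rw [e1, key, ← integral_neg]
    refine integral_congr_ae ?_
    filter_upwards [hφL.coeFn_toLp, Lp.coeFn_neg f] with x hx hx'
    rw [hx, hx', Pi.neg_apply, neg_mul, neg_neg]
  have hex : ∃ δ : L2 Ω, IsWeakDiv Ω (flux Λ u.grad) δ := ⟨_, hdiv⟩
  rw [weakDiv, dif_pos hex]
  exact ae_eq_of_isWeakDiv hΩ hex.choose_spec hdiv

/-- Green's formula for the flux of the solution. -/
lemma IsSignoriniSolution.normalTracePairing_eq (hΩ : IsOpen Ω) (hΛ : IsDiffusionTensor Ω Λ)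
    {f : L2 Ω} {Γ₁ Γ₃ : Set (Euc (n + 1))} {a : ℝ} {u : H1 Ω} {t : L2Bd Ω}
    (h : IsSignoriniSolution Λ f Γ₁ Γ₃ a u t) {w : H1 Ω} {s : L2Bd Ω} (hw : IsTrace w s) :
    normalTracePairing Ω (flux Λ u.grad) s = ⟪fluxLp hΛ u.grad, w.grad⟫ - ⟪f, w.fn⟫ := by
  have hex : ∃ w : H1 Ω, IsTrace w s := ⟨w, hw⟩
  rw [normalTracePairing, dif_pos hex, h.weakDiv_eq hΩ hΛ, integral_flux_inner hΛ,
    integral_mul_eq_inner, inner_neg_left]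
  -- The lifting chosen in `normalTracePairing` and `w` differ by a function of zero trace, on which
  -- the weak equation is an equality: the pairing does not depend on the lifting.
  have hmem := (traceGraph Ω).sub_mem (isTrace_iff.1 hw) (isTrace_iff.1 hex.choose_spec)
  have := h.inner_eq_of_trace_zero hΛ hmem (sub_self s)
  simp only [Prod.mk_sub_mk, inner_sub_right] at this
  linarith

end Problem

/-! ### Localisation away from the contact set -/

section Localisation

/-- A smooth bounded approximation of the identity. -/
def softTrunc (κ x : ℝ) : ℝ := κ * x / (κ + x ^ 2)

/-- A smooth approximation of the indicator of `{y ≠ a}`. -/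
def softInd (κ a y : ℝ) : ℝ := κ * (y - a) ^ 2 / (1 + κ * (y - a) ^ 2)

variable {κ : ℝ}

lemma contDiff_softTrunc (hκ : 1 ≤ κ) : ContDiff ℝ ∞ (softTrunc κ) := by
  unfold softTrunc
  exact (contDiff_const.mul contDiff_id).div (contDiff_const.add (contDiff_id.pow 2))
    fun x => by positivity

lemma contDiff_softInd (hκ : 1 ≤ κ) (a : ℝ) : ContDiff ℝ ∞ (softInd κ a) := by
  unfold softInd
  exact (contDiff_const.mul ((contDiff_id.sub contDiff_const).pow 2)).div
    (contDiff_const.add (contDiff_const.mul ((contDiff_id.sub contDiff_const).pow 2)))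
    fun x => by positivity

lemma abs_softTrunc_le (hκ : 1 ≤ κ) (x : ℝ) : |softTrunc κ x| ≤ κ := by
  have hp : 0 < κ + x ^ 2 := by positivity
  rw [softTrunc, abs_div, abs_of_pos hp, div_le_iff₀ hp, abs_mul, abs_of_pos (by positivity)]
  gcongr
  nlinarith [sq_abs x, sq_nonneg (|x| - 1), abs_nonneg x]

lemma abs_softTrunc_le_abs (hκ : 1 ≤ κ) (x : ℝ) : |softTrunc κ x| ≤ |x| := by
  have hp : 0 < κ + x ^ 2 := by positivity
  rw [softTrunc, abs_div, abs_of_pos hp, div_le_iff₀ hp, abs_mul, abs_of_pos (by positivity),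
    mul_comm]
  gcongr
  nlinarith

lemma softInd_nonneg (hκ : 1 ≤ κ) (a y : ℝ) : 0 ≤ softInd κ a y := by
  unfold softInd; positivity

lemma softInd_le_one (hκ : 1 ≤ κ) (a y : ℝ) : softInd κ a y ≤ 1 := by
  have hp : 0 < 1 + κ * (y - a) ^ 2 := by positivity
  rw [softInd, div_le_one hp]; linarith

/-- Linear vanishing at `a` keeps a small multiple of a cut-off variation below the distance to the
barrier. -/
lemma softInd_le (hκ : 1 ≤ κ) (a y : ℝ) : softInd κ a y ≤ κ * |y - a| := by
  have hp : 0 < 1 + κ * (y - a) ^ 2 := by positivity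
  rw [softInd, div_le_iff₀ hp, mul_assoc]
  gcongr
  rw [← sq_abs (y - a)]
  have h0 := abs_nonneg (y - a)
  have : |y - a| ≤ 1 + κ * |y - a| ^ 2 := by nlinarith [sq_nonneg (|y - a| - 1)]
  nlinarith

lemma abs_deriv_softTrunc_le (hκ : 1 ≤ κ) (x : ℝ) : |deriv (softTrunc κ) x| ≤ κ := by
  have hp : 0 < κ + x ^ 2 := by positivity
  have h : HasDerivAt (softTrunc κ)
      ((κ * 1 * (κ + x ^ 2) - κ * x * (2 * x)) / (κ + x ^ 2) ^ 2) x := by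
    have h1 : HasDerivAt (fun x : ℝ => κ * x) (κ * 1) x := (hasDerivAt_id x).const_mul κ
    have h2 : HasDerivAt (fun x : ℝ => κ + x ^ 2) (2 * x) x := by
      simpa using (hasDerivAt_pow 2 x).const_add κ
    exact h1.div h2 hp.ne'
  rw [h.deriv, abs_div, abs_of_pos (show 0 < (κ + x ^ 2) ^ 2 by positivity),
    div_le_iff₀ (by positivity), abs_le]
  constructor <;> nlinarith [sq_nonneg x, sq_nonneg (κ + x ^ 2), mul_nonneg (sq_nonneg x) (by linarith : 0 ≤ κ),
    mul_nonneg (by linarith : 0 ≤ κ) (sq_nonneg (x^2))]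

lemma abs_deriv_softInd_le (hκ : 1 ≤ κ) (a y : ℝ) : |deriv (softInd κ a) y| ≤ κ := by
  have hp : 0 < 1 + κ * (y - a) ^ 2 := by positivity
  have h : HasDerivAt (softInd κ a)
      ((κ * (2 * (y - a)) * (1 + κ * (y - a) ^ 2) - κ * (y - a) ^ 2 * (κ * (2 * (y - a)))) /
        (1 + κ * (y - a) ^ 2) ^ 2) y := by
    have h0 : HasDerivAt (fun y : ℝ => (y - a) ^ 2) (2 * (y - a)) y := by
      simpa using ((hasDerivAt_id y).sub_const a).fun_pow 2
    exact (h0.const_mul κ).div ((h0.const_mul κ).const_add 1) hp.ne'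
  have e : κ * (2 * (y - a)) * (1 + κ * (y - a) ^ 2) - κ * (y - a) ^ 2 * (κ * (2 * (y - a))) =
      κ * (2 * (y - a)) := by ring
  rw [h.deriv, e, abs_div, abs_of_pos (show 0 < (1 + κ * (y - a) ^ 2) ^ 2 by positivity),
    div_le_iff₀ (by positivity), abs_mul, abs_of_pos (show 0 < κ by positivity)]
  gcongr
  rw [abs_le]
  constructor <;> nlinarith [sq_nonneg (y - a - 1), sq_nonneg (y - a + 1), sq_nonneg (κ * (y - a) ^ 2),
    mul_nonneg (sub_nonneg.2 hκ) (sq_nonneg (y - a))]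

lemma tendsto_softTrunc (x : ℝ) : Tendsto (fun k : ℕ => softTrunc ((k : ℝ) + 1) x) atTop (𝓝 x) := by
  have h1 : Tendsto (fun k : ℕ => (k : ℝ) + 1 + x ^ 2) atTop atTop :=
    tendsto_atTop_add_const_right _ _
      (tendsto_atTop_add_const_right _ _ tendsto_natCast_atTop_atTop)
  have h2 : Tendsto (fun k : ℕ => x - x ^ 3 / ((k : ℝ) + 1 + x ^ 2)) atTop (𝓝 (x - 0)) :=
    tendsto_const_nhds.sub (h1.const_div_atTop (x ^ 3))
  rw [sub_zero] at h2
  refine h2.congr fun k => ?_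
  have : (0 : ℝ) < (k : ℝ) + 1 + x ^ 2 := by positivity
  rw [softTrunc]; field_simp; ring

lemma tendsto_softInd (a y : ℝ) : Tendsto (fun k : ℕ => softInd ((k : ℝ) + 1) a y) atTop
    (𝓝 (if y = a then 0 else 1)) := by
  split_ifs with h
  · simp [softInd, h]
  · have hy : 0 < (y - a) ^ 2 := by have := sub_ne_zero.2 h; positivity
    have h1 : Tendsto (fun k : ℕ => 1 + ((k : ℝ) + 1) * (y - a) ^ 2) atTop atTop :=
      tendsto_atTop_add_const_left _ _ ((tendsto_atTop_add_const_right _ _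
        tendsto_natCast_atTop_atTop).atTop_mul_const hy)
    have h2 : Tendsto (fun k : ℕ => 1 - 1 / (1 + ((k : ℝ) + 1) * (y - a) ^ 2)) atTop (𝓝 (1 - 0)) :=
      tendsto_const_nhds.sub (h1.const_div_atTop 1)
    rw [sub_zero] at h2
    refine h2.congr fun k => ?_
    have : (0 : ℝ) < 1 + ((k : ℝ) + 1) * (y - a) ^ 2 := by positivity
    rw [softInd]; field_simp; ring

variable {n : ℕ} {Ω : Set (Euc (n + 1))}
  {Λ : Euc (n + 1) → Matrix (Fin (n + 1)) (Fin (n + 1)) ℝ}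

/-- The normal trace of the flux acts on functions vanishing on `Γ₁` through the contact set
`{γ(ū) = a}` only. -/
theorem IsSignoriniSolution.integral_normalTrace_eq (hΩ : IsOpen Ω) (hΛ : IsDiffusionTensor Ω Λ)
    {f : L2 Ω} {Γ₁ Γ₃ : Set (Euc (n + 1))} {a : ℝ} {u : H1 Ω} {t : L2Bd Ω}
    (h : IsSignoriniSolution Λ f Γ₁ Γ₃ a u t) {g : L2Bd Ω}
    (hg : ∀ s : L2Bd Ω, MemHhalf s →
      normalTracePairing Ω (flux Λ u.grad) s = ∫ x, g x * s x ∂(surf Ω))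
    {s : L2Bd Ω} (hs : MemHhalf s) (hs₁ : ∀ᵐ x ∂(surf Ω).restrict Γ₁, s x = 0) :
    ∫ x, g x * (s x * if t x = a then 0 else 1) ∂(surf Ω) = 0 := by
  obtain ⟨w, hw⟩ := hs
  have hzero : ∀ k : ℕ, ∫ x, g x * (softTrunc ((k : ℝ) + 1) (s x) *
      softInd ((k : ℝ) + 1) a (t x)) ∂(surf Ω) = 0 := by
    intro k
    have hκ : (1 : ℝ) ≤ (k : ℝ) + 1 := by linarith [k.cast_nonneg (α := ℝ)]
    set κ : ℝ := (k : ℝ) + 1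
    obtain ⟨w', r, hr, hrae⟩ := exists_isTrace_mul_comp hw h.1.1 (contDiff_softTrunc hκ)
      (contDiff_softInd hκ a) (by simp [softTrunc]) (abs_softTrunc_le hκ)
      (fun y => by
        rw [abs_of_nonneg (softInd_nonneg hκ a y)]; exact (softInd_le_one hκ a y).trans hκ)
      (abs_deriv_softTrunc_le hκ) (abs_deriv_softInd_le hκ a)
    have hκ0 : 0 < κ ^ 2 := by positivity
    -- On `Γ₃` the truncation is at most `κ` and the cut-off at most `κ (a - t)`. Division by `κ²`
    -- bounds the variation by `a - t`, so adding or subtracting it respects the barrier.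
    have hadm := h.inner_eq_of_admissible hΛ
      ((traceGraph Ω).smul_mem ((κ ^ 2)⁻¹) (isTrace_iff.1 hr)) ?_ ?_
    · have := hg r ⟨w', hr⟩
      rw [h.normalTracePairing_eq hΩ hΛ hr] at this
      simp only [Prod.smul_mk, inner_smul_right] at hadm
      have hadm' := mul_left_cancel₀ (inv_ne_zero hκ0.ne') hadm
      rw [hadm', sub_self] at this
      rw [this]
      refine integral_congr_ae ?_
      filter_upwards [hrae] with x hx
      rw [hx]
    · filter_upwards [hs₁, ae_restrict_of_ae hrae,
        ae_restrict_of_ae (Lp.coeFn_smul ((κ ^ 2)⁻¹) r)] with x e1 e2 e3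
      change ((κ ^ 2)⁻¹ • r) x = 0
      rw [e3, Pi.smul_apply, e2, e1]; simp [softTrunc]
    · filter_upwards [h.1.2.2, ae_restrict_of_ae hrae,
        ae_restrict_of_ae (Lp.coeFn_smul ((κ ^ 2)⁻¹) r)] with x e1 e2 e3
      change t x + |((κ ^ 2)⁻¹ • r) x| ≤ a
      rw [e3, Pi.smul_apply, e2, smul_eq_mul, abs_mul, abs_of_pos (inv_pos.2 hκ0), abs_mul,
        abs_of_nonneg (softInd_nonneg hκ a _)]
      have b1 : |softTrunc κ (s x)| * softInd κ a (t x) ≤ κ * (κ * |t x - a|) := by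
        gcongr
        · exact softInd_nonneg hκ a _
        · exact abs_softTrunc_le hκ _
        · exact softInd_le hκ a _
      have b2 : (κ ^ 2)⁻¹ * (|softTrunc κ (s x)| * softInd κ a (t x)) ≤ |t x - a| := by
        rw [inv_mul_le_iff₀ hκ0]; linarith
      rw [abs_of_nonpos (show t x - a ≤ 0 by linarith)] at b2
      linarith
  -- As `κ → ∞` the truncation tends to `s` and the cut-off to the indicator of `{t ≠ a}`, with `|g
  -- s|` as dominating function.
  have hlim := tendsto_integral_of_dominated_convergence (μ := surf Ω)
    (F := fun k x => g x * (softTrunc ((k : ℝ) + 1) (s x) * softInd ((k : ℝ) + 1) a (t x)))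
    (f := fun x => g x * (s x * if t x = a then 0 else 1)) (fun x => ‖g x * s x‖) ?_ ?_ ?_ ?_
  · simp only [hzero] at hlim
    exact (tendsto_nhds_unique hlim tendsto_const_nhds)
  · intro k
    have hκ : (1 : ℝ) ≤ (k : ℝ) + 1 := by linarith [k.cast_nonneg (α := ℝ)]
    exact (Lp.aestronglyMeasurable g).mul (((contDiff_softTrunc hκ).continuous.comp_aestronglyMeasurable
      (Lp.aestronglyMeasurable s)).mul ((contDiff_softInd hκ a).continuous.comp_aestronglyMeasurable
      (Lp.aestronglyMeasurable t)))
  · exact ((Lp.memLp g).integrable_mul (Lp.memLp s)).norm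
  · intro k
    have hκ : (1 : ℝ) ≤ (k : ℝ) + 1 := by linarith [k.cast_nonneg (α := ℝ)]
    refine Eventually.of_forall fun x => ?_
    rw [norm_mul, norm_mul, norm_mul]
    gcongr
    rw [Real.norm_eq_abs, Real.norm_eq_abs, abs_of_nonneg (softInd_nonneg hκ a _)]
    refine (mul_le_mul (abs_softTrunc_le_abs hκ _) (softInd_le_one hκ a _)
      (softInd_nonneg hκ a _) (abs_nonneg _)).trans_eq ?_
    rw [mul_one, Real.norm_eq_abs]
  · exact Eventually.of_forall fun x =>
      ((tendsto_softTrunc (s x)).mul (tendsto_softInd a (t x))).const_mul (g x)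

end Localisation


/-! ### Gradient discretisations -/

section Discretisation

variable {n : ℕ} {Ω Γ₁ : Set (Euc (n + 1))} {X : Type*} [AddCommGroup X] [Module ℝ X]
  [FiniteDimensional ℝ X] (D : GradientDiscretisation Ω Γ₁ X)

namespace GradientDiscretisation

lemma recGrad_pos {v : X} (hv : v ≠ 0) : 0 < ‖D.recGrad v‖ :=
  lt_of_le_of_ne (norm_nonneg _) fun h => hv (D.recGrad_norm v h.symm)

/-- Linear maps on `X` are bounded with respect to the norm `‖∇_D v‖`. -/
lemma exists_norm_le {Y : Type*} [NormedAddCommGroup Y] [NormedSpace ℝ Y] (L : X →ₗ[ℝ] Y) :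
    ∃ c : ℝ, 0 ≤ c ∧ ∀ v, ‖L v‖ ≤ c * ‖D.recGrad v‖ := by
  have hinj : Function.Injective D.recGrad := by
    rw [injective_iff_map_eq_zero]
    exact fun v hv => D.recGrad_norm v (by rw [hv, norm_zero])
  let e := LinearEquiv.ofInjective D.recGrad hinj
  let A := LinearMap.toContinuousLinearMap (L.comp e.symm.toLinearMap)
  refine ⟨‖A‖, A.opNorm_nonneg, fun v => ?_⟩
  have h1 : A (e v) = L v := by simp [A]
  rw [← h1]
  exact A.le_opNorm (e v)

/-- A supremum of reals is meaningful only for a bounded family; the a priori constant `c` ensures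
this. The lemma serves both `C_D` and `W_D`. -/
lemma le_iSup_mul {q : X → ℝ} {c : ℝ} (hc : ∀ v, v ≠ 0 → q v ≤ c * ‖D.recGrad v‖)
    (hq0 : q 0 = 0) (v : X) :
    q v ≤ (⨆ v : {v : X // v ≠ 0}, 1 / ‖D.recGrad v‖ * q v) * ‖D.recGrad v‖ := by
  by_cases hv : v = 0
  · rw [hv, hq0, map_zero, norm_zero, mul_zero]
  · have hp := D.recGrad_pos hv
    have hbdd : BddAbove (range fun v : {v : X // v ≠ 0} => 1 / ‖D.recGrad v‖ * q v) := by
      refine ⟨c, ?_⟩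
      rintro _ ⟨w, rfl⟩
      have hw := D.recGrad_pos w.2
      have := hc w w.2
      simp only
      rw [one_div, inv_mul_le_iff₀ hw]
      linarith
    have := le_ciSup hbdd ⟨v, hv⟩
    simp only at this
    rw [one_div, inv_mul_le_iff₀ hp] at this
    linarith

end GradientDiscretisation

lemma H1.norm_nonneg {m : ℕ} {Ω : Set (Euc m)} (w : H1 Ω) : 0 ≤ w.norm := Real.sqrt_nonneg _

lemma hhalfNorm_nonneg (t : L2Bd Ω) : 0 ≤ hhalfNorm t :=
  Real.sInf_nonneg (by rintro _ ⟨w, -, rfl⟩; exact w.norm_nonneg)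

lemma hhalfNorm_zero : hhalfNorm (0 : L2Bd Ω) = 0 := by
  refine le_antisymm ?_ (hhalfNorm_nonneg 0)
  refine csInf_le ⟨0, by rintro _ ⟨w, -, rfl⟩; exact w.norm_nonneg⟩
    ⟨H1.ofTraceGraph 0 (Submodule.zero_mem _), isTrace_ofTraceGraph _ _, ?_⟩
  simp [H1.norm, H1.ofTraceGraph]

/-- The given lifting competes in the infimum. The factor `2` is a crude bound for `√2`, from
passing from the Euclidean to the maximum norm. -/
lemma hhalfNorm_le {p : L2 Ω × L2V Ω × L2Bd Ω} (hp : p ∈ traceGraph Ω) :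
    hhalfNorm p.2.2 ≤ 2 * ‖p‖ := by
  have h0 : hhalfNorm p.2.2 ≤ (H1.ofTraceGraph p hp).norm :=
    csInf_le ⟨0, by rintro _ ⟨w, -, rfl⟩; exact w.norm_nonneg⟩
      ⟨H1.ofTraceGraph p hp, isTrace_ofTraceGraph p hp, rfl⟩
  refine h0.trans ?_
  have h1 : ‖p.1‖ ≤ ‖p‖ := norm_fst_le p
  have h2 : ‖p.2.1‖ ≤ ‖p‖ := (norm_fst_le p.2).trans (norm_snd_le p)
  refine Real.sqrt_le_iff.2 ⟨by positivity, ?_⟩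
  change ‖p.1‖ ^ 2 + ‖p.2.1‖ ^ 2 ≤ _
  have := pow_le_pow_left₀ (norm_nonneg _) h1 2
  have := pow_le_pow_left₀ (norm_nonneg _) h2 2
  nlinarith [norm_nonneg p]

namespace GradientDiscretisation

/-- A linear lifting of the reconstructed trace to `H¹(Ω)`. -/
lemma exists_lift : ∃ L : X →ₗ[ℝ] (L2 Ω × L2V Ω × L2Bd Ω),
    ∀ v, L v ∈ traceGraph Ω ∧ (L v).2.2 = D.recTrace v := by
  let π : traceGraph Ω →ₗ[ℝ] L2Bd Ω :=
    (LinearMap.snd ℝ _ _ ∘ₗ LinearMap.snd ℝ _ _) ∘ₗ (traceGraph Ω).subtype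
  have hmem : ∀ v, D.recTrace v ∈ LinearMap.range π := by
    intro v
    obtain ⟨w, hw⟩ := D.recTrace_mem v
    exact ⟨⟨_, isTrace_iff.1 hw⟩, rfl⟩
  -- A vector space is projective, so the lifting can be linear, hence bounded on the
  -- finite-dimensional `X`. The `L²(∂Ω)` norm of the trace alone would not control `hhalfNorm`.
  obtain ⟨L, hL⟩ := Module.projective_lifting_property π.rangeRestrict
    (D.recTrace.codRestrict _ hmem) π.surjective_rangeRestrict
  refine ⟨(traceGraph Ω).subtype ∘ₗ L, fun v => ⟨(L v).2, ?_⟩⟩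
  have := congrArg Subtype.val (LinearMap.congr_fun hL v)
  exact this

/-- The discrete Poincaré inequality. The trace term of `C_D` is simply dropped, but it has to be
bounded first for the supremum to be finite. -/
lemma norm_recFn_le (v : X) : ‖D.recFn v‖ ≤ D.coercivity * ‖D.recGrad v‖ := by
  obtain ⟨L, hL⟩ := D.exists_lift
  obtain ⟨c₁, -, h₁⟩ := D.exists_norm_le D.recFn
  obtain ⟨c₂, -, h₂⟩ := D.exists_norm_le L
  have := D.le_iSup_mul (q := fun v => ‖D.recFn v‖ + hhalfNorm (D.recTrace v)) (c := c₁ + 2 * c₂)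
    (fun v _ => by
      have e1 := h₁ v
      have e2 := hhalfNorm_le (hL v).1
      rw [(hL v).2] at e2
      have e3 := h₂ v
      linarith) (by simp [hhalfNorm_zero]) v
  have heq : D.coercivity = ⨆ v : {v : X // v ≠ 0}, 1 / ‖D.recGrad v‖ *
      (‖D.recFn v‖ + hhalfNorm (D.recTrace v)) := by
    rw [coercivity]
    congr 1 with v
    ring
  rw [heq]
  have h3 := hhalfNorm_nonneg (D.recTrace v)
  linarith

variable {Λ : Euc (n + 1) → Matrix (Fin (n + 1)) (Fin (n + 1)) ℝ}

lemma limitConformity_nonneg (ψ : Euc (n + 1) → Euc (n + 1)) : 0 ≤ D.limitConformity ψ :=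
  Real.iSup_nonneg fun _ => mul_nonneg (one_div_nonneg.2 (norm_nonneg _)) (abs_nonneg _)

/-- Since `div ψ = -f` and `g` represents the normal trace, the defect in `W_D(ψ)` is an explicit
bounded linear form of `v`. -/
lemma abs_conformity_defect_le (hΩ : IsOpen Ω) (hΛ : IsDiffusionTensor Ω Λ) {f : L2 Ω}
    {Γ₃ : Set (Euc (n + 1))} {a : ℝ} {u : H1 Ω} {t : L2Bd Ω}
    (h : IsSignoriniSolution Λ f Γ₁ Γ₃ a u t) {g : L2Bd Ω}
    (hg : ∀ s : L2Bd Ω, MemHhalf s →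
      normalTracePairing Ω (flux Λ u.grad) s = ∫ x, g x * s x ∂(surf Ω)) (v : X) :
    |⟪fluxLp hΛ u.grad, D.recGrad v⟫ - ⟪f, D.recFn v⟫ - ⟪g, D.recTrace v⟫| ≤
      D.limitConformity (flux Λ u.grad) * ‖D.recGrad v‖ := by
  have hdefect : ∀ v, (∫ x in Ω, (⟪D.recGrad v x, flux Λ u.grad x⟫ +
      D.recFn v x * weakDiv Ω (flux Λ u.grad) x)) -
      normalTracePairing Ω (flux Λ u.grad) (D.recTrace v) =
      ⟪fluxLp hΛ u.grad, D.recGrad v⟫ - ⟪f, D.recFn v⟫ - ⟪g, D.recTrace v⟫ := by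
    intro v
    rw [hg _ (D.recTrace_mem v), integral_mul_eq_inner, h.weakDiv_eq hΩ hΛ]
    congr 1
    have e1 : ∫ x in Ω, (⟪D.recGrad v x, flux Λ u.grad x⟫ + D.recFn v x * (-f : L2 Ω) x) =
        ∫ x in Ω, (⟪D.recGrad v x, fluxLp hΛ u.grad x⟫ + ⟪D.recFn v x, (-f : L2 Ω) x⟫) := by
      refine integral_congr_ae ?_
      filter_upwards [coeFn_fluxLp hΛ u.grad] with x hx
      rw [hx]; simp [mul_comm]
    rw [e1, integral_add (L2.integrable_inner (𝕜 := ℝ) _ _) (L2.integrable_inner (𝕜 := ℝ) _ _),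
      ← L2.inner_def, ← L2.inner_def, inner_neg_right, real_inner_comm, real_inner_comm f]
    ring
  obtain ⟨c₁, -, h₁⟩ := D.exists_norm_le D.recFn
  obtain ⟨c₂, -, h₂⟩ := D.exists_norm_le D.recTrace
  have := D.le_iSup_mul
    (q := fun v => |⟪fluxLp hΛ u.grad, D.recGrad v⟫ - ⟪f, D.recFn v⟫ - ⟪g, D.recTrace v⟫|)
    (c := ‖fluxLp hΛ u.grad‖ + ‖f‖ * c₁ + ‖g‖ * c₂)
    (fun v _ => by
      have e1 := abs_real_inner_le_norm (fluxLp hΛ u.grad) (D.recGrad v)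
      have e2 := (abs_real_inner_le_norm f (D.recFn v)).trans
        (mul_le_mul_of_nonneg_left (h₁ v) (norm_nonneg f))
      have e3 := (abs_real_inner_le_norm g (D.recTrace v)).trans
        (mul_le_mul_of_nonneg_left (h₂ v) (norm_nonneg g))
      have e4 := abs_sub (⟪fluxLp hΛ u.grad, D.recGrad v⟫ - ⟪f, D.recFn v⟫) ⟪g, D.recTrace v⟫
      have e5 := abs_sub ⟪fluxLp hΛ u.grad, D.recGrad v⟫ ⟪f, D.recFn v⟫
      linarith) (by simp) v
  simp only [limitConformity, hdefect]
  exact this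

/-- The discrete variational inequality, tested with `v`. -/
lemma IsSolution.inner_le {D : GradientDiscretisation Ω Γ₁ X} (hΛ : IsDiffusionTensor Ω Λ)
    {f : L2 Ω} {Γ₃ : Set (Euc (n + 1))} {a : ℝ} {u v : X} (hu : D.IsSolution Λ f Γ₃ a u)
    (hv : D.MemK Γ₃ a v) :
    ⟪fluxLp hΛ (D.recGrad u), D.recGrad (u - v)⟫ ≤ ⟪f, D.recFn (u - v)⟫ := by
  have := hu.2 v hv
  rwa [integral_flux_inner hΛ, integral_mul_eq_inner] at this

/-- The energy estimate for the difference of the discrete solution and an interpolant. -/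
lemma energy_estimate (hΩ : IsOpen Ω) (hΛ : IsDiffusionTensor Ω Λ) {lo hi : ℝ} (hhi : 0 < hi)
    (hb : ∀ G : L2V Ω, lo * ‖G‖ ^ 2 ≤ ⟪fluxLp hΛ G, G⟫ ∧ ‖fluxLp hΛ G‖ ≤ hi * ‖G‖) {f : L2 Ω}
    {Γ₃ : Set (Euc (n + 1))} {a : ℝ} {ubar : H1 Ω} {t : L2Bd Ω}
    (h : IsSignoriniSolution Λ f Γ₁ Γ₃ a ubar t) {g : L2Bd Ω}
    (hg : ∀ s : L2Bd Ω, MemHhalf s →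
      normalTracePairing Ω (flux Λ ubar.grad) s = ∫ x, g x * s x ∂(surf Ω))
    {u v : X} (hu : D.IsSolution Λ f Γ₃ a u) (hv : D.MemK Γ₃ a v) :
    lo * ‖D.recGrad (u - v)‖ ^ 2 ≤
      (D.limitConformity (flux Λ ubar.grad) + hi * D.consistency ubar v) * ‖D.recGrad (u - v)‖ +
        ⟪g, D.recTrace v - t⟫ := by
  have hdisc := hu.inner_le hΛ hv
  have hdef := (abs_le.1 (D.abs_conformity_defect_le hΩ hΛ h hg (u - v))).1
  -- A lifting of `𝕋_D u` belongs to `𝒦`, so it may be inserted in the continuous inequality, which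
  -- Green's formula turns into a sign on the boundary.
  have hcont : ⟪g, t - D.recTrace u⟫ ≤ 0 := by
    obtain ⟨w, hw⟩ := D.recTrace_mem u
    have h1 := h.inner_le hΛ (v := w) (s := D.recTrace u) ⟨hw, D.recTrace_zero u, hu.1⟩
    have h2 := h.normalTracePairing_eq hΩ hΛ hw
    have h3 := h.normalTracePairing_eq hΩ hΛ h.1.1
    rw [hg _ ⟨_, hw⟩, integral_mul_eq_inner] at h2
    rw [hg _ ⟨_, h.1.1⟩, integral_mul_eq_inner] at h3
    rw [inner_sub_right] at h1 ⊢
    rw [inner_sub_right] at h1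
    linarith
  have hbd := (hb (D.recGrad (u - v))).1
  -- The three terms are controlled by the scheme, by the conformity defect and by the consistency
  -- error.
  have hsplit : fluxLp hΛ (D.recGrad (u - v)) = fluxLp hΛ (D.recGrad u) - fluxLp hΛ ubar.grad -
      fluxLp hΛ (D.recGrad v - ubar.grad) := by
    rw [map_sub, fluxLp_sub, fluxLp_sub]; abel
  have hcons : -⟪fluxLp hΛ (D.recGrad v - ubar.grad), D.recGrad (u - v)⟫ ≤
      hi * D.consistency ubar v * ‖D.recGrad (u - v)‖ := by
    refine (neg_le_abs _).trans ((abs_real_inner_le_norm _ _).trans ?_)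
    gcongr
    refine (hb _).2.trans ?_
    gcongr
    exact le_add_of_nonneg_left (norm_nonneg _)
  rw [hsplit, inner_sub_left, inner_sub_left] at hbd
  have htr : ⟪g, D.recTrace (u - v)⟫ = - ⟪g, t - D.recTrace u⟫ - ⟪g, D.recTrace v - t⟫ := by
    rw [map_sub, inner_sub_right, inner_sub_right, inner_sub_right]; ring
  rw [htr] at hdef
  linarith

end GradientDiscretisation

end Discretisation

/-! ### The boundary term -/

section BoundaryTerm

variable {n : ℕ} {Ω : Set (Euc (n + 1))}

/-- An `L²` bound on `∂Ω` from bounds on the boundary faces of a mesh. -/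
lemma eLpNorm_surf_le_of_faces (hpoly : IsPolytopal Ω) (hLip : HasLipschitzBoundary Ω)
    (T : PolytopalMesh Ω) {r : Euc (n + 1) → ℝ} {c : ℝ≥0∞}
    (hr : ∀ σ ∈ T.extFaces, eLpNorm r 2 ((surf Ω).restrict σ) ≤ c * surf Ω σ ^ (1 / 2 : ℝ)) :
    eLpNorm r 2 (surf Ω) ≤ c * surf Ω univ ^ (1 / 2 : ℝ) := by
  have hfin : T.extFaces.Finite := T.faces_finite.subset (sep_subset _ _)
  have hsq : ∀ μ : Measure (Euc (n + 1)), eLpNorm r 2 μ ^ (2 : ℝ) = ∫⁻ x, ‖r x‖ₑ ^ (2 : ℝ) ∂μ :=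
    fun μ => by
      have := eLpNorm_nnreal_pow_eq_lintegral (f := r) (μ := μ) (p := 2) two_ne_zero
      simpa using this
  have hpow : ∀ y : ℝ≥0∞, (y ^ (1 / 2 : ℝ)) ^ (2 : ℝ) = y := fun y => by
    rw [← ENNReal.rpow_mul]; norm_num
  rw [← ENNReal.rpow_le_rpow_iff (z := 2) two_pos, hsq, ENNReal.mul_rpow_of_nonneg _ _ zero_le_two,
    hpow]
  -- Up to a null set `∂Ω` is the disjoint union of the boundary faces, so the squares of the local
  -- norms add up.
  have hcover : (surf Ω).restrict (⋃ σ ∈ hfin.toFinset, σ) = surf Ω := by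
    rw [Measure.restrict_eq_self_of_ae_mem]
    rw [ae_iff]
    refine measure_mono_null ?_ (T.surf_compl_extFaces hpoly hLip)
    intro x hx hx'
    exact hx (by simpa using hx')
  have hdisj : PairwiseDisjoint (↑hfin.toFinset : Set (Set (Euc (n + 1)))) id := by
    rw [hfin.coe_toFinset]
    exact T.faces_disjoint.subset (sep_subset _ _)
  have hmeas : ∀ σ ∈ hfin.toFinset, MeasurableSet (id σ) := fun σ hσ =>
    T.measurableSet_face (hfin.mem_toFinset.1 hσ).1
  calc ∫⁻ x, ‖r x‖ₑ ^ (2 : ℝ) ∂(surf Ω)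
      = ∫⁻ x in ⋃ σ ∈ hfin.toFinset, id σ, ‖r x‖ₑ ^ (2 : ℝ) ∂(surf Ω) := by
        simp only [id]; rw [hcover]
    _ = ∑ σ ∈ hfin.toFinset, ∫⁻ x in σ, ‖r x‖ₑ ^ (2 : ℝ) ∂(surf Ω) :=
        lintegral_biUnion_finset hdisj hmeas _
    _ ≤ ∑ σ ∈ hfin.toFinset, c ^ (2 : ℝ) * surf Ω σ := by
        refine Finset.sum_le_sum fun σ hσ => ?_
        rw [← hsq]
        refine (ENNReal.rpow_le_rpow (hr σ (hfin.mem_toFinset.1 hσ)) zero_le_two).trans_eq ?_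
        rw [ENNReal.mul_rpow_of_nonneg _ _ zero_le_two, hpow]
    _ = c ^ (2 : ℝ) * surf Ω (⋃ σ ∈ hfin.toFinset, id σ) := by
        rw [← Finset.mul_sum, measure_biUnion_finset hdisj hmeas]; rfl
    _ ≤ c ^ (2 : ℝ) * surf Ω univ := by gcongr; exact subset_univ _

/-- If the contact part of `σ` is null the function vanishes almost everywhere on `σ`. Otherwise `s
- a = (s - γ x₀) + (γ x₀ - a)`: interpolation bounds the first term, quadratic flatness near the
contact set the second. -/
lemma eLpNorm_contact_le (hpoly : IsPolytopal Ω) {t s : L2Bd Ω} {γ : Euc (n + 1) → ℝ}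
    (hγ : t =ᵐ[surf Ω] γ) {a L C₂ h : ℝ} (hL : 0 ≤ L) {σ : Set (Euc (n + 1))} (hσ : MeasurableSet σ)
    (hσh : Metric.diam σ ≤ h) {x₀ : Euc (n + 1)}
    (hquad : surf Ω {x ∈ σ | γ x = a} ≠ 0 → |γ x₀ - a| ≤ L * Metric.diam σ ^ 2)
    (hs : eLpNorm (fun y => s y - γ x₀) 2 ((surf Ω).restrict σ) ≤
      ENNReal.ofReal (C₂ * Metric.diam σ ^ 2 * ((surf Ω).real σ) ^ (1 / 2 : ℝ))) :
    eLpNorm (fun x => if t x = a then s x - a else 0) 2 ((surf Ω).restrict σ) ≤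
      ENNReal.ofReal ((|C₂| + L) * h ^ 2) * surf Ω σ ^ (1 / 2 : ℝ) := by
  have := isFiniteMeasure_surf hpoly
  have hd0 : 0 ≤ Metric.diam σ := Metric.diam_nonneg
  by_cases hZ : surf Ω {x ∈ σ | γ x = a} = 0
  · have : (fun x => if t x = a then s x - a else 0) =ᵐ[(surf Ω).restrict σ] 0 := by
      have h1 : ∀ᵐ x ∂surf Ω, ¬ (x ∈ σ ∧ γ x = a) := by
        rw [ae_iff]; simpa using hZ
      filter_upwards [ae_restrict_mem hσ, ae_restrict_of_ae h1, ae_restrict_of_ae hγ] with x e1 e2 e3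
      rw [if_neg fun hx => e2 ⟨e1, e3 ▸ hx⟩]; rfl
    rw [eLpNorm_congr_ae this, eLpNorm_zero]
    exact zero_le
  · have hq := hquad hZ
    have hle : eLpNorm (fun x => if t x = a then s x - a else 0) 2 ((surf Ω).restrict σ) ≤
        eLpNorm ((fun y => s y - γ x₀) + fun _ => γ x₀ - a) 2 ((surf Ω).restrict σ) := by
      refine eLpNorm_mono fun x => ?_
      split_ifs
      · simp
      · simp
    refine hle.trans ((eLpNorm_add_le ((Lp.aestronglyMeasurable s).restrict.sub
      aestronglyMeasurable_const) aestronglyMeasurable_const one_le_two).trans ?_)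
    have hconst : eLpNorm (fun _ : Euc (n + 1) => γ x₀ - a) 2 ((surf Ω).restrict σ) ≤
        ENNReal.ofReal (L * h ^ 2) * surf Ω σ ^ (1 / 2 : ℝ) := by
      refine (eLpNorm_le_of_ae_bound (C := L * h ^ 2) (Eventually.of_forall fun x => ?_)).trans_eq ?_
      · exact hq.trans (by gcongr)
      · rw [Measure.restrict_apply_univ, mul_comm]; norm_num
    have hfst : ENNReal.ofReal (C₂ * Metric.diam σ ^ 2 * ((surf Ω).real σ) ^ (1 / 2 : ℝ)) ≤
        ENNReal.ofReal (|C₂| * h ^ 2) * surf Ω σ ^ (1 / 2 : ℝ) := by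
      have : surf Ω σ ^ (1 / 2 : ℝ) = ENNReal.ofReal ((surf Ω).real σ ^ (1 / 2 : ℝ)) := by
        rw [← ENNReal.ofReal_rpow_of_nonneg measureReal_nonneg (by norm_num),
          ofReal_measureReal]
      rw [this, ← ENNReal.ofReal_mul (by positivity)]
      gcongr
      exact le_abs_self _
    rw [add_mul, ENNReal.ofReal_add (by positivity) (by positivity), add_mul]
    exact add_le_add (hs.trans hfst) hconst

end BoundaryTerm


/-! ### Assembling the error estimate -/

section Convergence

variable {n : ℕ} {Ω Γ₁ : Set (Euc (n + 1))} {X : Type*} [AddCommGroup X] [Module ℝ X]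
  [FiniteDimensional ℝ X]
  {Λ : Euc (n + 1) → Matrix (Fin (n + 1)) (Fin (n + 1)) ℝ}

/-- The boundary term is quadratic in the mesh size. -/
lemma inner_normalTrace_le (hpoly : IsPolytopal Ω) (hLip : HasLipschitzBoundary Ω)
    (hΛ : IsDiffusionTensor Ω Λ) (D : GradientDiscretisation Ω Γ₁ X) {f : L2 Ω}
    {Γ₃ : Set (Euc (n + 1))} {a : ℝ} {ubar : H1 Ω} {t : L2Bd Ω}
    (h : IsSignoriniSolution Λ f Γ₁ Γ₃ a ubar t) {g : L2Bd Ω}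
    (hg : ∀ s : L2Bd Ω, MemHhalf s →
      normalTracePairing Ω (flux Λ ubar.grad) s = ∫ x, g x * s x ∂(surf Ω))
    {γ : Euc (n + 1) → ℝ} (hγ : t =ᵐ[surf Ω] γ) {L : ℝ} (hL : 0 ≤ L)
    (hquad : ∀ (a : ℝ) (σ F : Set (Euc (n + 1))), IsBoundaryFace Ω F → σ ⊆ F →
      IsPreconnected σ → MeasurableSet σ → surf Ω {x ∈ σ | γ x = a} ≠ 0 →
      ∀ x ∈ σ, |γ x - a| ≤ L * Metric.diam σ ^ 2)
    (T : PolytopalMesh Ω) {xσ : Set (Euc (n + 1)) → Euc (n + 1)}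
    (hxσ : ∀ σ ∈ T.extFaces, xσ σ ∈ σ) {v : X} {C₂ : ℝ}
    (hv : ∀ σ ∈ T.extFaces, eLpNorm (fun y => D.recTrace v y - γ (xσ σ)) 2
      ((surf Ω).restrict σ) ≤
        ENNReal.ofReal (C₂ * Metric.diam σ ^ 2 * ((surf Ω).real σ) ^ (1 / 2 : ℝ))) :
    ⟪g, D.recTrace v - t⟫ ≤
      ‖g‖ * ((|C₂| + L) * T.size ^ 2 * (surf Ω).real univ ^ (1 / 2 : ℝ)) := by
  have := isFiniteMeasure_surf hpoly
  have hmemH : MemHhalf (D.recTrace v - t) := by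
    obtain ⟨w, hw⟩ := D.recTrace_mem v
    exact ⟨_, isTrace_ofTraceGraph _
      ((traceGraph Ω).sub_mem (isTrace_iff.1 hw) (isTrace_iff.1 h.1.1))⟩
  have hzero := h.integral_normalTrace_eq hpoly.1 hΛ hg hmemH (by
    filter_upwards [D.recTrace_zero v, h.1.2.1, ae_restrict_of_ae (Lp.coeFn_sub (D.recTrace v) t)]
      with x e1 e2 e3
    rw [e3, Pi.sub_apply, e1, e2, sub_zero])
  let r : Euc (n + 1) → ℝ := fun x => if t x = a then D.recTrace v x - a else 0
  have hnorm : eLpNorm r 2 (surf Ω) ≤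
      ENNReal.ofReal ((|C₂| + L) * T.size ^ 2 * (surf Ω).real univ ^ (1 / 2 : ℝ)) := by
    have := eLpNorm_surf_le_of_faces hpoly hLip T (r := r) fun σ hσ => by
      obtain ⟨F, hF, hσF⟩ := T.exists_face_of_extFaces hσ
      have hm := T.measurableSet_face hσ.1
      exact eLpNorm_contact_le hpoly hγ hL hm (T.diam_le_size hpoly.1 hσ)
        (fun hpos => hquad a σ F hF hσF (T.boundary_connected σ hσ.1 hσ.2).isPreconnected hm hpos
          _ (hxσ σ hσ)) (hv σ hσ)
    refine this.trans_eq (Eq.symm ?_)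
    rw [ENNReal.ofReal_mul (p := (|C₂| + L) * T.size ^ 2) (by positivity),
      ← ENNReal.ofReal_rpow_of_nonneg measureReal_nonneg (by norm_num), ofReal_measureReal]
  have hrm : AEStronglyMeasurable r (surf Ω) := by
    have hset : MeasurableSet {x | t x = a} :=
      (Lp.stronglyMeasurable t).measurable (measurableSet_singleton a)
    exact (StronglyMeasurable.ite hset ((Lp.stronglyMeasurable (D.recTrace v)).sub
      stronglyMeasurable_const) stronglyMeasurable_const).aestronglyMeasurable
  have hr : MemLp r 2 (surf Ω) := ⟨hrm, hnorm.trans_lt ENNReal.ofReal_lt_top⟩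
  -- Localisation applies to `𝕋_D v - t`, a trace vanishing on `Γ₁`. Its part off the contact set
  -- integrates to zero against `g`, and on the contact set `t = a`.
  have heq : ⟪g, D.recTrace v - t⟫ = ⟪g, hr.toLp r⟫ := by
    rw [← sub_eq_zero, ← inner_sub_right, ← integral_mul_eq_inner, ← hzero]
    refine integral_congr_ae ?_
    filter_upwards [Lp.coeFn_sub (D.recTrace v - t) (hr.toLp r), hr.coeFn_toLp,
      Lp.coeFn_sub (D.recTrace v) t] with x e1 e2 e3
    rw [e1, Pi.sub_apply, e2, e3, Pi.sub_apply]
    by_cases hx : t x = a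
    · simp [r, hx]
    · simp [r, hx]
  rw [heq]
  refine (real_inner_le_norm _ _).trans ?_
  gcongr
  have hsz := T.size_nonneg
  rw [Lp.norm_toLp]
  exact ENNReal.toReal_le_of_le_ofReal (by positivity) hnorm

/-- If `x > b + c`, then `x > c` and `x - b > c`, whence `x (x - b) > c²`. -/
lemma le_add_of_sq_le {x b c : ℝ} (hb : 0 ≤ b) (hc : 0 ≤ c) (h : x ^ 2 ≤ b * x + c ^ 2) :
    x ≤ b + c := by
  by_contra! hlt
  nlinarith

/-- The error bound, from an energy estimate with a boundary term quadratic in `h`. -/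
lemma error_le_of_energy {lo hi A M C₁ h W S e₁ e₂ x y : ℝ} (hlo : 0 < lo) (hhi : 0 < hi)
    (hA : 0 ≤ A) (hM : 0 ≤ M) (hC₁ : 0 ≤ C₁) (hh : 0 ≤ h) (hW : 0 ≤ W) (hS0 : 0 ≤ S)
    (hS : S ≤ C₁ * h) (hx : lo * x ^ 2 ≤ (W + hi * S) * x + A * h ^ 2) (hy : y ≤ M * x)
    (he : e₁ + e₂ ≤ x + y + S) :
    e₁ + e₂ ≤ ((1 + M) * (hi * C₁ / lo + √(A / lo) + 1 / lo) + C₁) * h +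
      ((1 + M) * (hi * C₁ / lo + √(A / lo) + 1 / lo) + C₁) * W := by
  have hx' : x ≤ (W + hi * S) / lo + √(A / lo) * h := by
    refine le_add_of_sq_le (by positivity) (by positivity) ?_
    rw [mul_pow, Real.sq_sqrt (by positivity)]
    have : (W + hi * S) / lo * x + A / lo * h ^ 2 = ((W + hi * S) * x + A * h ^ 2) / lo := by
      field_simp
    rw [this, le_div_iff₀ hlo]
    linarith
  have h1 : (W + hi * S) / lo ≤ 1 / lo * W + hi * C₁ / lo * h := by
    have : 1 / lo * W + hi * C₁ / lo * h = (W + hi * (C₁ * h)) / lo := by field_simp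
    rw [this]
    gcongr
  have h2 : x ≤ 1 / lo * W + (hi * C₁ / lo + √(A / lo)) * h := by linarith
  have h3 : e₁ + e₂ ≤ (1 + M) * (1 / lo * W + (hi * C₁ / lo + √(A / lo)) * h) + C₁ * h := by
    have := mul_le_mul_of_nonneg_left h2 (show 0 ≤ 1 + M by linarith)
    linarith
  have p1 : 0 ≤ (1 + M) * (1 / lo) * h := by positivity
  have p2 : 0 ≤ (1 + M) * (hi * C₁ / lo + √(A / lo)) * W := by positivity
  have p3 : 0 ≤ C₁ * W := by positivity
  linarith

end Convergence

end

end Signorini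

/-- The space dimension is `d = n + 1 ≥ 1`. The constant `C` is chosen after `Ω`, `Λ`, `a`, `ū`
(with its trace `t = γ(ū)` and the continuous representative `γu` of the latter), `C₁`, `C₂` and the
upper bound `M` of `C_D`, and before everything else. -/
theorem theorem2p3 (n : ℕ)
    (Ω : Set (Signorini.Euc (n + 1))) (hconn : IsConnected Ω)
    (hpoly : Signorini.IsPolytopal Ω) (hLip : Signorini.HasLipschitzBoundary Ω)
    (Λ : Signorini.Euc (n + 1) → Matrix (Fin (n + 1)) (Fin (n + 1)) ℝ)
    (hΛ : Signorini.IsDiffusionTensor Ω Λ)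
    (a : ℝ)
    (ubar : Signorini.H1 Ω) (t : Signorini.L2Bd Ω) (ht : Signorini.IsTrace ubar t)
    (hnormal : Signorini.NormalTraceMemL2 Ω (Signorini.flux Λ ubar.grad))
    (γu : Signorini.Euc (n + 1) → ℝ) (hW2 : Signorini.IsW2InftyRep t γu)
    (C₁ C₂ M : ℝ) :
    ∃ C : ℝ, ∀ (Γ₁ Γ₂ Γ₃ : Set (Signorini.Euc (n + 1))),
      Signorini.IsBoundaryPartition Ω Γ₁ Γ₂ Γ₃ →
      ∀ f : Signorini.L2 Ω, Signorini.IsSignoriniSolution Λ f Γ₁ Γ₃ a ubar t →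
      ∀ (X : Type*) [AddCommGroup X] [Module ℝ X] [FiniteDimensional ℝ X]
        (D : Signorini.GradientDiscretisation Ω Γ₁ X), D.coercivity ≤ M →
      ∀ (T : Signorini.PolytopalMesh Ω)
        (xσ : Set (Signorini.Euc (n + 1)) → Signorini.Euc (n + 1)),
        (∀ σ ∈ T.extFaces, xσ σ ∈ σ) →
      ∀ v : X, D.MemK Γ₃ a v → D.consistency ubar v ≤ C₁ * T.size →
        (∀ σ ∈ T.extFaces,
          MeasureTheory.eLpNorm (fun y => D.recTrace v y - γu (xσ σ)) 2
              ((Signorini.surf Ω).restrict σ) ≤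
            ENNReal.ofReal
              (C₂ * Metric.diam σ ^ 2 * ((Signorini.surf Ω).real σ) ^ (1 / 2 : ℝ))) →
      ∀ u : X, D.IsSolution Λ f Γ₃ a u →
        ‖D.recGrad u - ubar.grad‖ + ‖D.recFn u - ubar.fn‖ ≤
          C * T.size + C * D.limitConformity (Signorini.flux Λ ubar.grad) := by
  obtain ⟨lo, hi, hlo, hhi, hb⟩ := Signorini.exists_fluxLp_bounds hΛ
  obtain ⟨-, g, hg⟩ := hnormal
  obtain ⟨L, hL, hquad⟩ := Signorini.exists_quadratic_bound hpoly hLip hW2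
  -- `A h²` bounds the boundary term. Its ingredients come from `Λ`, `ū`, `Ω` and `C₂` only, before
  -- any data, discretisation or mesh is chosen.
  let A : ℝ := ‖g‖ * ((|C₂| + L) * (Signorini.surf Ω).real Set.univ ^ (1 / 2 : ℝ))
  have hA : 0 ≤ A := by positivity
  -- No sign is assumed for `M` and `C₁`, hence the absolute values. The constant covers the
  -- coefficients of both `h` and `W_D`.
  refine ⟨(1 + |M|) * (hi * |C₁| / lo + √(A / lo) + 1 / lo) + |C₁|, ?_⟩
  intro Γ₁ Γ₂ Γ₃ _ f hsol X _ _ _ D hM T xσ hxσ v hv hcons hvtr u hu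
  have hsize := T.size_nonneg
  have henergy := D.energy_estimate hpoly.1 hΛ hhi hb hsol hg hu hv
  have hbd := Signorini.inner_normalTrace_le hpoly hLip hΛ D hsol hg hW2.ae_eq hL hquad T hxσ hvtr
  have hAh : ‖g‖ * ((|C₂| + L) * T.size ^ 2 * (Signorini.surf Ω).real Set.univ ^ (1 / 2 : ℝ)) =
      A * T.size ^ 2 := by simp only [A]; ring
  rw [hAh] at hbd
  refine Signorini.error_le_of_energy hlo hhi hA (abs_nonneg M) (abs_nonneg C₁) hsize
    (D.limitConformity_nonneg _) (S := D.consistency ubar v)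
    (x := ‖D.recGrad (u - v)‖) (y := ‖D.recFn (u - v)‖)
    (add_nonneg (norm_nonneg _) (norm_nonneg _))
    (hcons.trans (mul_le_mul_of_nonneg_right (le_abs_self _) hsize)) (henergy.trans (by linarith))
    ((D.norm_recFn_le _).trans
      (mul_le_mul_of_nonneg_right (hM.trans (le_abs_self M)) (norm_nonneg _))) ?_
  have h1 : ‖D.recGrad u - ubar.grad‖ ≤ ‖D.recGrad (u - v)‖ + ‖D.recGrad v - ubar.grad‖ := by
    rw [map_sub]; exact norm_sub_le_norm_sub_add_norm_sub _ _ _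
  have h2 : ‖D.recFn u - ubar.fn‖ ≤ ‖D.recFn (u - v)‖ + ‖D.recFn v - ubar.fn‖ := by
    rw [map_sub]; exact norm_sub_le_norm_sub_add_norm_sub _ _ _
  simp only [Signorini.GradientDiscretisation.consistency]
  linarith
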